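/- Let all matroids be finite. A matroid is *covered by two independent sets* if its ground set is the union of two independent sets. A matroid $M$ is a *minor-minimal simple matroid that cannot be covered by two independent sets* if $M$ is simple, cannot be covered by two independent sets, and every proper minor of $M$ that is simple can be covered by two independent sets. The *density* of $M$ is $d(M)=\varepsilon(M)/r(M)$, where $\varepsilon(M)$ is the number of rank-one flats of $M$, with $d(M)=0$ if $r(M)=0$; $M$ is *strictly $2$-density-critical* if $d(M)>2$ and $d(N)\le 2$ for every proper minor $N$ of $M$. Here $U_{r,n}$ is the uniform matroid of rank $r$ on $n$ elements, $M(G)$ is the cycle matroid of the graph $G$, $M^*(G)$ is its dual, $K_5\backslash e$ is $K_5$ with one edge deleted, and $P(M_1,M_2)$ is the parallel connection of $M_1$ and $M_2$ with respect to a basepoint in each. (For the matroids $U_{2,4}$ and $M(K_4)$ used below, the choice of basepoints does not matter up to isomorphism.) The matroids $F_7$, $F_7^-$, $P_7$ and $O_7$ are the simple rank-$3$ matroids on seven points whose lines with at least three points are: - $F_7$ (the Fano matroid): $\{0,1,2\},\{2,3,4\},\{0,4,5\},\{0,3,6\},\{1,4,6\},\{2,5,6\},\{1,3,5\}$; - $F_7^-$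 (the non-Fano matroid): the first six of these; - $P_7$: $\{0,1,2\},\{3,4,5\},\{0,3,6\},\{1,4,6\},\{2,5,6\}$; - $O_7$: $\{0,1,2,3\},\{0,4,5\},\{1,5,6\},\{2,4,6\}$. **Theorem.** The following ten matroids are pairwise non-isomorphic: $$U_{2,5},\ P(U_{2,4},U_{2,4}),\ O_7,\ P_7,\ F_7^-,\ F_7,\ P(U_{2,4},M(K_4)),\ M(K_5\backslash e),\ M^*(K_{3,3}),\ P(M(K_4),M(K_4)).$$ For every matroid $M$: 1. $M$ is a minor-minimal simple matroid that cannot be covered by two independent sets if and only if $M$ is isomorphic to one of these ten matroids; 2. $M$ is strictly $2$-density-critical if and only if $M$ is isomorphic to one of these ten matroids. -/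

import Mathlib

universe u

namespace MatroidCover

/-- `M` and `N` are isomorphic: there is a bijection between the ground sets under which the
independent sets correspond. -/
def IsIso {α β : Type*} (M : Matroid α) (N : Matroid β) : Prop :=
  ∃ e : M.E ≃ N.E, ∀ I : Set M.E,
    M.Indep ((fun x : M.E ↦ (x : α)) '' I) ↔ N.Indep ((fun x : M.E ↦ (e x : β)) '' I)

/-- `M` is simple: it has no loops (the case `x = y`) and no two distinct parallel elements. -/
def IsSimple {α : Type*} (M : Matroid α) : Prop :=
  ∀ x ∈ M.E, ∀ y ∈ M.E, M.Indep {x, y}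

/-- `M` can be covered by `k` independent sets: its ground set is a union of `k` independent
sets. -/
def Coverable {α : Type*} (k : ℕ) (M : Matroid α) : Prop :=
  ∃ I : Fin k → Set α, (∀ i, M.Indep (I i)) ∧ ⋃ i, I i = M.E

/-- `M` is minor-minimal among the simple matroids that cannot be covered by `k` independent
sets. -/
def IsMinimalSimpleObstruction {α : Type*} (k : ℕ) (M : Matroid α) : Prop :=
  (IsSimple M ∧ ¬ Coverable k M) ∧
    ∀ N : Matroid α, N.IsStrictMinor M → ¬ (IsSimple N ∧ ¬ Coverable k N)

/-- The number `ε(M)` of rank-one flats of a (finite) matroid. -/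
noncomputable def numRankOneFlats {α : Type*} (M : Matroid α) : ℕ :=
  {F : Set α | M.IsFlat F ∧ M.eRk F = 1}.ncard

/-- The density of a (finite) matroid: the number of rank-one flats divided by the rank, and `0`
if the rank is `0`. -/
noncomputable def density {α : Type*} (M : Matroid α) : ℝ :=
  if M.eRank = 0 then 0 else (numRankOneFlats M : ℝ) / (M.eRank.toNat : ℝ)

/-- `M` has density greater than `t`, and all its proper minors have density at most `t`. -/
def StrictlyDensityCritical {α : Type*} (t : ℝ) (M : Matroid α) : Prop :=
  t < density M ∧ ∀ N : Matroid α, N.IsStrictMinor M → density N ≤ t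

/-! ### Uniform matroids -/

/-- The uniform matroid `U_{r,n}` (for `r ≤ n`) on the ground set `Fin n`. -/
def uniform (r n : ℕ) : Matroid (Fin n) :=
  (IndepMatroid.ofFinite (E := Set.univ) Set.finite_univ (fun I ↦ I.ncard ≤ r)
    (by simp)
    (fun I J hJ hIJ ↦ (Set.ncard_le_ncard hIJ (Set.toFinite J)).trans hJ)
    (fun I J _ hJ hlt ↦ by
      obtain ⟨e, heJ, heI⟩ := Set.exists_mem_notMem_of_ncard_lt_ncard hlt (Set.toFinite I)
      refine ⟨e, heJ, heI, ?_⟩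
      rw [Set.ncard_insert_of_notMem heI (Set.toFinite I)]
      omega)
    (fun I _ ↦ Set.subset_univ I)).matroid

/-! ### Rank-three matroids given by their lines -/

/-- The matroid of rank at most three on `Fin n` whose long lines (rank-two flats with at least
three points) are the members of `L`; any two of these lines share at most one point.
A set is independent if it has at most three elements and is not three points of a line. -/
def ofLines (n : ℕ) (L : Finset (Finset (Fin n)))
    (hL : ∀ l ∈ L, ∀ m ∈ L, l ≠ m → (l ∩ m).card ≤ 1) : Matroid (Fin n) :=
  (IndepMatroid.ofFinite (E := Set.univ) Set.finite_univ
    (fun I ↦ I.ncard ≤ 3 ∧ ∀ l ∈ L, I ⊆ (l : Set (Fin n)) → I.ncard ≤ 2)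
    (by simp)
    (fun I J hJ hIJ ↦ by
      have h := Set.ncard_le_ncard hIJ (Set.toFinite J)
      refine ⟨h.trans hJ.1, fun l hl hIl ↦ ?_⟩
      by_contra hcon
      have hEq : I = J := Set.eq_of_subset_of_ncard_le hIJ (by have := hJ.1; omega)
        (Set.toFinite J)
      subst hEq
      exact hcon (hJ.2 l hl hIl))
    (fun I J hI hJ hlt ↦ by
      by_cases hI1 : I.ncard ≤ 1
      · obtain ⟨e, heJ, heI⟩ := Set.exists_mem_notMem_of_ncard_lt_ncard hlt (Set.toFinite I)
        have hc := Set.ncard_insert_of_notMem heI (Set.toFinite I)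
        exact ⟨e, heJ, heI, by omega, fun _ _ _ ↦ by omega⟩
      · have hI2 : I.ncard = 2 := by have := hJ.1; omega
        have hJ3 : J.ncard = 3 := by have := hJ.1; omega
        by_contra! hcon
        have key : ∀ e ∈ J, e ∉ I → ∃ l ∈ L, insert e I ⊆ (l : Set (Fin n)) := by
          intro e heJ heI
          have hc := Set.ncard_insert_of_notMem heI (Set.toFinite I)
          obtain ⟨l, hl, hs, -⟩ := hcon e heJ heI (by omega)
          exact ⟨l, hl, hs⟩
        obtain ⟨e, heJ, heI⟩ := Set.exists_mem_notMem_of_ncard_lt_ncard hlt (Set.toFinite I)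
        obtain ⟨l, hl, hls⟩ := key e heJ heI
        have hJl : J ⊆ (l : Set (Fin n)) := by
          intro x hx
          by_cases hxI : x ∈ I
          · exact hls (Set.mem_insert_of_mem _ hxI)
          · obtain ⟨m, hm, hms⟩ := key x hx hxI
            have hlm : l = m := by
              by_contra hne
              have h1 := hL l hl m hm hne
              have h2 : I ⊆ ((l ∩ m : Finset (Fin n)) : Set (Fin n)) := by
                intro y hy
                rw [Finset.coe_inter]
                exact ⟨hls (Set.mem_insert_of_mem _ hy), hms (Set.mem_insert_of_mem _ hy)⟩
              have h3 := Set.ncard_le_ncard h2 (Set.toFinite _)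
              rw [Set.ncard_coe_finset] at h3
              omega
            subst hlm
            exact hms (Set.mem_insert _ _)
        have := hJ.2 l hl hJl
        omega)
    (fun I _ ↦ Set.subset_univ I)).matroid

set_option maxRecDepth 4000 in
/-- The Fano plane `F₇`: seven points and seven three-point lines. -/
def fano : Matroid (Fin 7) :=
  ofLines 7 {{0, 1, 2}, {2, 3, 4}, {0, 4, 5}, {0, 3, 6}, {1, 4, 6}, {2, 5, 6}, {1, 3, 5}}
    (by decide)

set_option maxRecDepth 4000 in
/-- The non-Fano matroid `F₇⁻`: the line `{1, 3, 5}` of the Fano plane is relaxed. -/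
def nonFano : Matroid (Fin 7) :=
  ofLines 7 {{0, 1, 2}, {2, 3, 4}, {0, 4, 5}, {0, 3, 6}, {1, 4, 6}, {2, 5, 6}} (by decide)

set_option maxRecDepth 4000 in
/-- The matroid `P₇`: three three-point lines through the point `6`, and two disjoint
three-point lines, each of which meets all of these three lines. -/
def p7 : Matroid (Fin 7) :=
  ofLines 7 {{0, 1, 2}, {3, 4, 5}, {6, 0, 3}, {6, 1, 4}, {6, 2, 5}} (by decide)

set_option maxRecDepth 4000 in
/-- The matroid `O₇`: one four-point line and three three-point lines; the three-point lines
meet pairwise in three distinct points `4, 5, 6` off the four-point line, and they meet the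
four-point line in three distinct points. -/
def o7 : Matroid (Fin 7) :=
  ofLines 7 {{0, 1, 2, 3}, {0, 4, 5}, {1, 5, 6}, {2, 4, 6}} (by decide)

/-! ### Cycle matroids of graphs -/

/-- The augmentation property of forests. -/
theorem forest_augment {V : Type*} [Finite V] {I J : Set (Sym2 V)}
    (hId : ∀ e ∈ I, ¬ e.IsDiag) (hJd : ∀ e ∈ J, ¬ e.IsDiag)
    (hI : (SimpleGraph.fromEdgeSet I).IsAcyclic) (hJ : (SimpleGraph.fromEdgeSet J).IsAcyclic)
    (hlt : I.ncard < J.ncard) :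
    ∃ e ∈ J, e ∉ I ∧ (SimpleGraph.fromEdgeSet (insert e I)).IsAcyclic := by
  have edges : ∀ S : Set (Sym2 V), (∀ e ∈ S, ¬ e.IsDiag) →
      (SimpleGraph.fromEdgeSet S).edgeSet = S := by
    intro S hS
    rw [SimpleGraph.edgeSet_fromEdgeSet]
    exact sdiff_eq_left.2 (Set.disjoint_left.2 fun e he hd ↦ hS e he hd)
  by_contra! hcon
  -- every edge of `J` joins two vertices of one component of `I`
  have hreach : ∀ x y, s(x, y) ∈ J → (SimpleGraph.fromEdgeSet I).Reachable x y := by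
    intro x y hxy
    by_cases hxyI : s(x, y) ∈ I
    · exact SimpleGraph.Adj.reachable
        ((SimpleGraph.fromEdgeSet_adj I).2 ⟨hxyI, by simpa using hJd _ hxy⟩)
    · by_contra hn
      refine hcon _ hxy hxyI ?_
      have h := hI.sup_edge_of_not_reachable hn
      refine h.anti ?_
      rw [Set.insert_eq, Set.union_comm, SimpleGraph.fromEdgeSet_union]
      exact le_rfl
  obtain ⟨e₀, he₀, -⟩ := Set.exists_mem_notMem_of_ncard_lt_ncard hlt (Set.toFinite I)
  have : Nonempty V := by
    induction e₀ with
    | _ x y => exact ⟨x⟩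
  obtain ⟨T, hTJ, -, hT⟩ := (SimpleGraph.connected_top (V := V)).exists_isTree_le_of_le_of_isAcyclic
    (le_top : SimpleGraph.fromEdgeSet J ≤ ⊤) hJ
  have hJTe : J ⊆ T.edgeSet := by
    have := SimpleGraph.edgeSet_mono hTJ
    rwa [edges J hJd] at this
  set K : Set (Sym2 V) := T.edgeSet \ J with hK
  have hKd : ∀ e ∈ K, ¬ e.IsDiag := fun e he ↦ T.not_isDiag_of_mem_edgeSet he.1
  have hIKd : ∀ e ∈ I ∪ K, ¬ e.IsDiag := fun e he ↦ he.elim (hId e) (hKd e)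
  have hconn : (SimpleGraph.fromEdgeSet (I ∪ K)).Connected := by
    have hadj : ∀ x y, T.Adj x y → (SimpleGraph.fromEdgeSet (I ∪ K)).Reachable x y := by
      intro x y hxy
      by_cases hj : s(x, y) ∈ J
      · exact (hreach x y hj).mono (SimpleGraph.fromEdgeSet_mono Set.subset_union_left)
      · exact SimpleGraph.Adj.reachable
          ((SimpleGraph.fromEdgeSet_adj _).2 ⟨Or.inr ⟨hxy, hj⟩, hxy.ne⟩)
    have hwalk : ∀ x y, T.Walk x y → (SimpleGraph.fromEdgeSet (I ∪ K)).Reachable x y := by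
      intro x y w
      induction w with
      | nil => exact SimpleGraph.Reachable.refl _
      | cons h _ ih => exact (hadj _ _ h).trans ih
    have := hT.connected.nonempty
    exact SimpleGraph.Connected.mk fun x y ↦ by
      obtain ⟨w⟩ := hT.connected.preconnected x y
      exact hwalk x y w
  have h1 := hconn.card_vert_le_card_edgeSet_add_one
  rw [edges _ hIKd] at h1
  have h2 := (SimpleGraph.isTree_iff_connected_and_card.1 hT).2
  have h3 : (I ∪ K).ncard ≤ I.ncard + K.ncard := Set.ncard_union_le _ _
  have h4 : K.ncard + J.ncard = T.edgeSet.ncard :=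
    Set.ncard_sdiff_add_ncard_of_subset hJTe (Set.toFinite _)
  rw [Nat.card_coe_set_eq] at h1 h2
  omega

/-- The cycle matroid `M(G)` of a finite simple graph: its elements are the edges of `G`, and a
set of edges is independent if it is the edge set of a forest. -/
def cycleMatroid {V : Type*} [Finite V] (G : SimpleGraph V) : Matroid (Sym2 V) :=
  (IndepMatroid.ofFinite (E := G.edgeSet) (Set.toFinite _)
    (fun I ↦ I ⊆ G.edgeSet ∧ (SimpleGraph.fromEdgeSet I).IsAcyclic)
    ⟨Set.empty_subset _, by
      rw [SimpleGraph.fromEdgeSet_empty]; exact SimpleGraph.isAcyclic_bot⟩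
    (fun I J hJ hIJ ↦ ⟨hIJ.trans hJ.1, hJ.2.anti (SimpleGraph.fromEdgeSet_mono hIJ)⟩)
    (fun I J hI hJ hlt ↦ by
      obtain ⟨e, heJ, heI, h⟩ := forest_augment
        (fun e he ↦ G.not_isDiag_of_mem_edgeSet (hI.1 he))
        (fun e he ↦ G.not_isDiag_of_mem_edgeSet (hJ.1 he)) hI.2 hJ.2 hlt
      exact ⟨e, heJ, heI, Set.insert_subset (hJ.1 heJ) hI.1, h⟩)
    (fun I hI ↦ hI.1)).matroid

/-! ### Parallel connections -/

/-- Independence in the parallel connection of `M` and `N` with basepoints `p` and `q`, where the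
basepoint of the parallel connection is called `p`. -/
def ParallelIndep {α β : Type*} (M : Matroid α) (N : Matroid β) (p : α) (q : β)
    (I : Set (α ⊕ β)) : Prop :=
  q ∉ Sum.inr ⁻¹' I ∧
    ((M.Indep (Sum.inl ⁻¹' I) ∧ N.Indep (insert q (Sum.inr ⁻¹' I))) ∨
      (p ∉ Sum.inl ⁻¹' I ∧ M.Indep (insert p (Sum.inl ⁻¹' I)) ∧ N.Indep (Sum.inr ⁻¹' I)))

theorem indep_augment {α : Type*} {M : Matroid α} [M.Finite] {I J : Set α} (hI : M.Indep I)
    (hJ : M.Indep J) (hlt : I.ncard < J.ncard) : ∃ x ∈ J, x ∉ I ∧ M.Indep (insert x I) := by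
  have hIf : I.Finite := M.ground_finite.subset hI.subset_ground
  have hJf : J.Finite := M.ground_finite.subset hJ.subset_ground
  obtain ⟨x, hx, h⟩ := hI.augment hJ (by
    rw [← hIf.cast_ncard_eq, ← hJf.cast_ncard_eq]; exact_mod_cast hlt)
  exact ⟨x, hx.1, hx.2, h⟩

theorem ncard_sum {α β : Type*} {I : Set (α ⊕ β)} (hA : (Sum.inl ⁻¹' I).Finite)
    (hB : (Sum.inr ⁻¹' I).Finite) :
    I.ncard = (Sum.inl ⁻¹' I).ncard + (Sum.inr ⁻¹' I).ncard := by
  conv_lhs => rw [← Set.image_preimage_inl_union_image_preimage_inr I]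
  rw [Set.ncard_union_eq _ (hA.image _) (hB.image _),
    Set.ncard_image_of_injective _ Sum.inl_injective,
    Set.ncard_image_of_injective _ Sum.inr_injective]
  exact Set.disjoint_left.2 (by rintro _ ⟨a, -, rfl⟩ ⟨b, -, h⟩; cases h)

/-- The augmentation property of parallel connections. -/
theorem parallelIndep_augment {α β : Type*} {M : Matroid α} {N : Matroid β} [M.Finite] [N.Finite]
    {p : α} {q : β} {I J : Set (α ⊕ β)} (hI : ParallelIndep M N p q I)
    (hJ : ParallelIndep M N p q J) (hlt : I.ncard < J.ncard) :
    ∃ e ∈ J, e ∉ I ∧ ParallelIndep M N p q (insert e I) := by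
  have hfin : ∀ K : Set (α ⊕ β), ParallelIndep M N p q K →
      (Sum.inl ⁻¹' K).Finite ∧ (Sum.inr ⁻¹' K).Finite := by
    rintro K ⟨-, h | h⟩
    · exact ⟨M.ground_finite.subset h.1.subset_ground,
        N.ground_finite.subset ((Set.subset_insert _ _).trans h.2.subset_ground)⟩
    · exact ⟨M.ground_finite.subset ((Set.subset_insert _ _).trans h.2.1.subset_ground),
        N.ground_finite.subset h.2.2.subset_ground⟩
  obtain ⟨hAf, hBf⟩ := hfin I hI
  obtain ⟨hCf, hDf⟩ := hfin J hJ
  rw [ncard_sum hAf hBf, ncard_sum hCf hDf] at hlt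
  have il : ∀ x, Sum.inl ⁻¹' (insert (Sum.inl x) I) = insert x (Sum.inl ⁻¹' I) := by
    intro x; ext; simp
  have il' : ∀ x : α, Sum.inr ⁻¹' (insert (Sum.inl x) I) = Sum.inr ⁻¹' I := by
    intro x; ext; simp
  have ir : ∀ y, Sum.inr ⁻¹' (insert (Sum.inr y) I) = insert y (Sum.inr ⁻¹' I) := by
    intro y; ext; simp
  have ir' : ∀ y : β, Sum.inl ⁻¹' (insert (Sum.inr y) I) = Sum.inl ⁻¹' I := by
    intro y; ext; simp
  suffices H : (∃ x, Sum.inl x ∈ J ∧ Sum.inl x ∉ I ∧ ParallelIndep M N p q (insert (Sum.inl x) I)) ∨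
      (∃ y, Sum.inr y ∈ J ∧ Sum.inr y ∉ I ∧ ParallelIndep M N p q (insert (Sum.inr y) I)) by
    rcases H with ⟨x, h⟩ | ⟨y, h⟩
    · exact ⟨_, h⟩
    · exact ⟨_, h⟩
  simp only [ParallelIndep, il, il', ir, ir'] at hI hJ ⊢
  change (∃ x, x ∈ Sum.inl ⁻¹' J ∧ x ∉ Sum.inl ⁻¹' I ∧ _) ∨
    (∃ y, y ∈ Sum.inr ⁻¹' J ∧ y ∉ Sum.inr ⁻¹' I ∧ _)
  generalize Sum.inl ⁻¹' I = A at *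
  generalize Sum.inr ⁻¹' I = B at *
  generalize Sum.inl ⁻¹' J = C at *
  generalize Sum.inr ⁻¹' J = D at *
  obtain ⟨hqB, hI⟩ := hI
  obtain ⟨hqD, hJ⟩ := hJ
  have cB := Set.ncard_insert_of_notMem hqB hBf
  have cD := Set.ncard_insert_of_notMem hqD hDf
  have subA := fun h : M.Indep (insert p A) ↦ h.subset (Set.subset_insert _ _)
  have subB := fun h : N.Indep (insert q B) ↦ h.subset (Set.subset_insert _ _)
  have hC : M.Indep C := by
    rcases hJ with h | h
    · exact h.1
    · exact h.2.1.subset (Set.subset_insert _ _)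
  have hD : N.Indep D := by
    rcases hJ with h | h
    · exact h.2.subset (Set.subset_insert _ _)
    · exact h.2.2
  by_contra hG
  obtain ⟨hl, hr⟩ := not_or.1 hG
  -- the four ways to add an element
  have t1M : M.Indep A → N.Indep (insert q B) → A.ncard < C.ncard → False := fun hA hB hlt ↦ by
    obtain ⟨x, hx, hxA, h⟩ := indep_augment hA hC hlt
    exact hl ⟨x, hx, hxA, hqB, Or.inl ⟨h, hB⟩⟩
  have t2N : p ∉ A → M.Indep (insert p A) → N.Indep B → B.ncard < D.ncard → False :=
    fun hp hA hB hlt ↦ by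
    obtain ⟨y, hy, hyB, h⟩ := indep_augment hB hD hlt
    have hqy : q ∉ insert y B := by
      rintro (rfl | h')
      · exact hqD hy
      · exact hqB h'
    exact hr ⟨y, hy, hyB, hqy, Or.inr ⟨hp, hA, h⟩⟩
  have t1N : M.Indep A → ∀ y, y ∈ D → y ∉ insert q B → N.Indep (insert y (insert q B)) → False :=
    fun hA y hy hyB h ↦ by
    have hqy : q ∉ insert y B := by
      rintro (rfl | h')
      · exact hqD hy
      · exact hqB h'
    exact hr ⟨y, hy, fun h' ↦ hyB (Set.mem_insert_of_mem _ h'), hqy,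
        Or.inl ⟨hA, by rwa [Set.insert_comm]⟩⟩
  have t2M : p ∉ A → N.Indep B → ∀ x, x ∈ C → x ∉ insert p A →
      M.Indep (insert x (insert p A)) → False :=
    fun hp hB x hx hxA h ↦ hl ⟨x, hx, fun h' ↦ hxA (Set.mem_insert_of_mem _ h'), hqB,
        Or.inr ⟨by
          rintro (rfl | h')
          · exact hxA (Set.mem_insert _ _)
          · exact hp h', by rwa [Set.insert_comm], hB⟩⟩
  rcases hI with ⟨hA, hB⟩ | ⟨hpA, hA, hB⟩
  · by_cases hAC : A.ncard < C.ncard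
    · exact t1M hA hB hAC
    rcases hJ with ⟨-, hD'⟩ | ⟨hpC, hC', -⟩
    · obtain ⟨y, hy, hyB, h⟩ := indep_augment hB hD' (by omega)
      refine t1N hA y ?_ hyB h
      rcases hy with rfl | hy
      · exact absurd (Set.mem_insert _ _) hyB
      · exact hy
    · by_cases hBD : B.ncard + 1 < D.ncard
      · obtain ⟨y, hy, hyB, h⟩ := indep_augment hB hD (by omega)
        exact t1N hA y hy hyB h
      · have cC := Set.ncard_insert_of_notMem hpC hCf
        obtain ⟨x, hx, hxA, h⟩ := indep_augment hA hC' (by omega)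
        rcases hx with rfl | hx
        · exact t2N hxA h (subB hB) (by omega)
        · exact hl ⟨x, hx, hxA, hqB, Or.inl ⟨h, hB⟩⟩
  · by_cases hBD : B.ncard < D.ncard
    · exact t2N hpA hA hB hBD
    have cA := Set.ncard_insert_of_notMem hpA hAf
    rcases hJ with ⟨-, hD'⟩ | ⟨hpC, hC', -⟩
    · by_cases hAC : A.ncard + 1 < C.ncard
      · obtain ⟨x, hx, hxA, h⟩ := indep_augment hA hC (by omega)
        exact t2M hpA hB x hx hxA h
      · obtain ⟨y, hy, hyB, h⟩ := indep_augment hB hD' (by omega)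
        rcases hy with rfl | hy
        · exact t1M (subA hA) h (by omega)
        · refine hr ⟨y, hy, hyB, ?_, Or.inr ⟨hpA, hA, h⟩⟩
          rintro (rfl | h')
          · exact hqD hy
          · exact hqB h'
    · have cC := Set.ncard_insert_of_notMem hpC hCf
      obtain ⟨x, hx, hxA, h⟩ := indep_augment hA hC' (by omega)
      refine t2M hpA hB x ?_ hxA h
      rcases hx with rfl | hx
      · exact absurd (Set.mem_insert _ _) hxA
      · exact hx

/-- The parallel connection of two finite matroids `M` and `N` with respect to basepoints `p` and
`q` that are not loops: `p` and `q` are identified to one element (called `p`), and the circuits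
are the circuits of `M`, the circuits of `N`, and the sets `(C \ {p}) ∪ (D \ {q})` for circuits
`C ∋ p` of `M` and `D ∋ q` of `N`. In terms of independent sets: a set is independent if its
traces on `M` and `N` are independent and, should it not contain the basepoint, the basepoint
can be added to at least one of the two traces so that it stays independent. -/
def parallelConnection {α β : Type*} (M : Matroid α) (N : Matroid β) [M.Finite] [N.Finite]
    (p : α) (q : β) (_hp : M.IsNonloop p) (hq : N.IsNonloop q) : Matroid (α ⊕ β) :=
  (IndepMatroid.ofFinite (E := Sum.inl '' M.E ∪ Sum.inr '' (N.E \ {q}))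
    ((M.ground_finite.image _).union ((N.ground_finite.sdiff).image _))
    (ParallelIndep M N p q)
    (by simp [ParallelIndep, hq])
    (fun I J hJ hIJ ↦ by
      have hA : Sum.inl ⁻¹' I ⊆ Sum.inl ⁻¹' J := Set.preimage_mono hIJ
      have hB : Sum.inr ⁻¹' I ⊆ Sum.inr ⁻¹' J := Set.preimage_mono hIJ
      obtain ⟨h0, h | h⟩ := hJ
      · exact ⟨fun h' ↦ h0 (hB h'), Or.inl ⟨h.1.subset hA, h.2.subset (Set.insert_subset_insert hB)⟩⟩
      · exact ⟨fun h' ↦ h0 (hB h'), Or.inr ⟨fun h' ↦ h.1 (hA h'),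
          h.2.1.subset (Set.insert_subset_insert hA), h.2.2.subset hB⟩⟩)
    (fun I J hI hJ hlt ↦ parallelIndep_augment hI hJ hlt)
    (fun I hI ↦ by
      rintro (x | x) hx
      · left
        refine ⟨x, ?_, rfl⟩
        obtain ⟨-, h | h⟩ := hI
        · exact h.1.subset_ground hx
        · exact h.2.1.subset_ground (Set.mem_insert_of_mem _ hx)
      · right
        refine ⟨x, ⟨?_, fun hxq ↦ hI.1 (hxq ▸ hx)⟩, rfl⟩
        obtain ⟨-, h | h⟩ := hI
        · exact h.2.subset_ground (Set.mem_insert_of_mem _ hx)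
        · exact h.2.2.subset_ground hx)).matroid

/-! ### The ten matroids -/

instance {r n : ℕ} : (uniform r n).Finite := ⟨Set.toFinite _⟩

instance {V : Type*} [Finite V] {G : SimpleGraph V} : (cycleMatroid G).Finite :=
  ⟨Set.toFinite _⟩

/-- The uniform matroid `U_{2,4}`. -/
abbrev u24 : Matroid (Fin 4) := uniform 2 4

/-- The cycle matroid `M(K₄)`. -/
abbrev mk4 : Matroid (Sym2 (Fin 4)) := cycleMatroid (⊤ : SimpleGraph (Fin 4))

theorem u24_isNonloop : u24.IsNonloop 0 := by
  rw [← Matroid.indep_singleton]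
  change ({0} : Set (Fin 4)).ncard ≤ 2
  simp

theorem mk4_isNonloop : mk4.IsNonloop s(0, 1) := by
  rw [← Matroid.indep_singleton]
  refine ⟨by simp, ?_⟩
  have h := (SimpleGraph.isAcyclic_bot (V := Fin 4)).sup_edge_of_not_reachable
    (u := 0) (v := 1) (by simp [SimpleGraph.reachable_bot])
  rwa [bot_sup_eq] at h

/-- The ten matroids, each with the type that contains its ground set. In the parallel
connections, the choice of basepoints is immaterial up to isomorphism, because the automorphism
groups of `U_{2,4}` and `M(K₄)` are transitive. -/
def tenMatroids : List (Σ α : Type, Matroid α) :=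
  [ -- `U_{2,5}`
    ⟨_, uniform 2 5⟩,
    -- `P(U_{2,4}, U_{2,4})`
    ⟨_, parallelConnection u24 u24 0 0 u24_isNonloop u24_isNonloop⟩,
    ⟨_, o7⟩,
    ⟨_, p7⟩,
    ⟨_, nonFano⟩,
    ⟨_, fano⟩,
    -- `P(U_{2,4}, M(K₄))`
    ⟨_, parallelConnection u24 mk4 0 s(0, 1) u24_isNonloop mk4_isNonloop⟩,
    -- `M(K₅ \ e)`
    ⟨_, cycleMatroid ((⊤ : SimpleGraph (Fin 5)).deleteEdges {s(0, 1)})⟩,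
    -- `M*(K_{3,3})`
    ⟨_, (cycleMatroid (completeBipartiteGraph (Fin 3) (Fin 3)))✶⟩,
    -- `P(M(K₄), M(K₄))`
    ⟨_, parallelConnection mk4 mk4 s(0, 1) s(0, 1) mk4_isNonloop mk4_isNonloop⟩ ]

end MatroidCover

/-!
Write `|X|` for the number of elements of a set. Both properties in question are equivalent to
`IsCritical`: the matroid is simple, has more than twice as many elements as its rank, and no simple
proper minor does. For coverings this follows from Edmonds' covering theorem (`IsRank.exists_cover`,
`coverable_two_iff`): a simple matroid that cannot be covered has a restriction with more than twice
as many elements as its rank. For densities one passes to simplifications (`exists_simplification`).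
The classification is carried out for rank functions `r` on a finite type, where the condition is
called `IsCrit`; deleting an element gives `|E| = 2 r(E) + 1` (`IsCrit.card_univ`), and contracting
a nonempty flat `F` with `|E \ F| > 2 (r(E) - r(F))` makes two elements parallel
(`IsCrit.exists_parallel`).

Call a flat `F` *tight* if `|F| = 2 r(F)`. Suppose first that some nonempty proper flat is tight. A
maximal tight proper flat is a hyperplane (`IsCrit.exists_tight_hyperplane`), so its complement has
three elements, and these can only be attached to the hyperplane as a `U_{2,4}` at a point
(`PointEnd`) or as an `M(K₄)` along three collinear points (`TriEnd`); this is `IsCrit.exists_end`.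
In rank three the second kind is `O₇`. Otherwise the end spans a tight proper flat, and extending
this to a tight hyperplane yields a second end, disjoint from the first. If the matroid were larger
than the union of the two ends with their points or lines of attachment, then, by a form of Tutte's
linking theorem (`IsRank.linking`), one could contract a set that brings the attachments together,
and the two ends would give a proper minor with too many elements (`IsCrit.link`). What remains is
`P(U_{2,4}, U_{2,4})`, `P(U_{2,4}, M(K₄))`, `M(K₅ \ e)` and `P(M(K₄), M(K₄))`
(`IsCrit.hasCode_of_tight`).

Suppose now that no nonempty proper flat is tight. In rank two the matroid is `U_{2,5}`. In rank
three there are seven points, all lines have at most three points, and every point is on at least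
two three-point lines; counting incidences modulo three gives a point on three of them, which leaves
`P₇`, `F₇⁻` and `F₇` (`IsCrit.hasCode_of_rk_three`). In higher rank a maximal proper flat with
`|F| = 2 r(F) - 1` is a hyperplane whose complement consists of four points
(`IsCrit.exists_almost_tight_hyperplane`). As planes have at most five points, no three of these
four points are collinear, and, each of them being on two three-point lines, they can be ordered in
a cycle whose four sides meet the hyperplane (`QuadCycle`). This configuration spans the
matroid, there is exactly one further point, and the nine points form the `3 × 3` grid of `M*(K_{3,3})`
(`QuadCycle.hasCode`).

For the converse, each of the ten matroids is described by a list of flats with their ranks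
(`tenCodes`): a set is independent if it meets no flat of the list in more elements than the rank
permits. Criticality of these matroids is a finite computation, done with bit masks
(`isCrit_of_code`, `maskCheck`), where only contractions by independent sets and one representative
from each parallel class need to be considered. The matroids of the theorem are matched with the
lists in `forall₂_hasCode`, and they are told apart by the number of four-element sets all of whose
three-element subsets are independent (`numArcs`).
-/

namespace MatroidCover

open Finset

/-! ### Rank functions on a finite type -/

/-- `r` is the rank function of a matroid whose ground set is the whole type `β`. -/
structure IsRank {β : Type*} [DecidableEq β] (r : Finset β → ℕ) : Prop where
  empty : r ∅ = 0
  mono : ∀ ⦃S T : Finset β⦄, S ⊆ T → r S ≤ r T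
  insert_le : ∀ (x : β) (S : Finset β), r (insert x S) ≤ r S + 1
  submod : ∀ S T : Finset β, r (S ∪ T) + r (S ∩ T) ≤ r S + r T

section

variable {β : Type*} [DecidableEq β] {r : Finset β → ℕ} {S T X : Finset β}

namespace IsRank

theorem le_insert (hr : IsRank r) (x : β) (S : Finset β) : r S ≤ r (insert x S) :=
  hr.mono (subset_insert x S)

theorem union_le (hr : IsRank r) (S T : Finset β) : r (S ∪ T) ≤ r S + r T :=
  (Nat.le_add_right _ _).trans (hr.submod S T)

theorem rk_le_card (hr : IsRank r) (S : Finset β) : r S ≤ S.card := by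
  induction S using Finset.induction_on with
  | empty => simp [hr.empty]
  | insert a T ha ih =>
    rw [card_insert_of_notMem ha]
    exact (hr.insert_le a T).trans (by omega)

theorem subset_of_indep (hr : IsRank r) (h : S ⊆ T) (hT : r T = T.card) : r S = S.card := by
  have h1 := hr.union_le S (T \ S)
  have h2 := hr.rk_le_card S
  have h3 := hr.rk_le_card (T \ S)
  have h4 := card_sdiff_add_card_eq_card h
  rw [union_sdiff_of_subset h] at h1
  omega

/-- If `T` stays of the same rank after contracting `X`, so do all its subsets. -/
theorem skew_subset (hr : IsRank r) (h : r (X ∪ T) = r X + r T) (hS : S ⊆ T) :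
    r (X ∪ S) = r X + r S := by
  have h1 := hr.submod (X ∪ S) T
  have h2 : X ∪ S ∪ T = X ∪ T := by rw [union_assoc, union_eq_right.2 hS]
  have h3 := hr.mono (subset_inter (subset_union_right (s₁ := X) (s₂ := S)) hS)
  have h4 := hr.union_le X S
  rw [h2] at h1
  omega

end IsRank

end

/-- The closure operator of a rank function. -/
def cl {β : Type*} [DecidableEq β] [Fintype β] (r : Finset β → ℕ) (S : Finset β) : Finset β :=
  univ.filter fun x ↦ r (insert x S) = r S

section rank

variable {β : Type*} [DecidableEq β] [Fintype β] {r : Finset β → ℕ} {S T X : Finset β} {x y z : β}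

theorem mem_cl : x ∈ cl r S ↔ r (insert x S) = r S := by simp [cl]

theorem subset_cl : S ⊆ cl r S := fun x hx ↦ by rw [mem_cl, insert_eq_self.2 hx]

namespace IsRank

theorem rk_insert (hr : IsRank r) (hx : x ∉ cl r S) : r (insert x S) = r S + 1 := by
  have h1 := hr.le_insert x S
  have h2 := hr.insert_le x S
  rw [mem_cl] at hx
  omega

theorem cl_mono (hr : IsRank r) (h : S ⊆ T) : cl r S ⊆ cl r T := by
  intro x hx
  rw [mem_cl] at hx ⊢
  have h1 := hr.submod (insert x S) T
  have h2 : insert x S ∪ T = insert x T := by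
    rw [insert_union, union_eq_right.2 h]
  have h3 := hr.mono (subset_inter (subset_insert x S) h)
  rw [h2] at h1
  have := hr.le_insert x T
  omega

theorem rk_union_of_subset_cl (hr : IsRank r) (h : T ⊆ cl r S) : r (S ∪ T) = r S := by
  induction T using Finset.induction_on with
  | empty => simp
  | insert a T _ ih =>
    have h1 := ih ((subset_insert a T).trans h)
    have h2 := mem_cl.1 (hr.cl_mono subset_union_left (h (mem_insert_self a T)) :
      a ∈ cl r (S ∪ T))
    rw [union_insert, h2, h1]

theorem rk_le_of_subset_cl (hr : IsRank r) (h : T ⊆ cl r S) : r T ≤ r S :=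
  (hr.mono subset_union_right).trans (hr.rk_union_of_subset_cl h).le

theorem rk_cl (hr : IsRank r) (S : Finset β) : r (cl r S) = r S :=
  le_antisymm (hr.rk_le_of_subset_cl subset_rfl) (hr.mono subset_cl)

theorem cl_subset (hr : IsRank r) (h : T ⊆ cl r S) : cl r T ⊆ cl r S := by
  intro x hx
  have h1 := mem_cl.1 (hr.cl_mono (subset_union_right (s₁ := S)) hx)
  have h2 := hr.rk_union_of_subset_cl h
  have h3 := hr.mono (insert_subset_insert x (subset_union_left (s₁ := S) (s₂ := T)))
  have h4 := hr.le_insert x S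
  rw [mem_cl]
  omega

theorem cl_cl (hr : IsRank r) (S : Finset β) : cl r (cl r S) = cl r S :=
  (hr.cl_subset subset_rfl).antisymm subset_cl

theorem cl_eq (hr : IsRank r) (h : S ⊆ cl r T) (h' : T ⊆ cl r S) : cl r S = cl r T :=
  (hr.cl_subset h).antisymm (hr.cl_subset h')

theorem rk_eq (hr : IsRank r) (h : S ⊆ cl r T) (h' : T ⊆ cl r S) : r S = r T :=
  (hr.rk_le_of_subset_cl h).antisymm (hr.rk_le_of_subset_cl h')

theorem exchange (hr : IsRank r) (h : y ∈ cl r (insert x S)) (h' : y ∉ cl r S) :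
    x ∈ cl r (insert y S) := by
  have h1 := hr.rk_insert h'
  have h2 := hr.insert_le x S
  have h3 := hr.le_insert x (insert y S)
  rw [mem_cl] at h ⊢
  rw [Finset.insert_comm] at h
  omega

/-- A set of full rank inside `S` spans it. -/
theorem subset_cl_of_le (hr : IsRank r) (h : T ⊆ S) (h' : r S ≤ r T) : S ⊆ cl r T := by
  intro x hx
  have := hr.mono (insert_subset hx h)
  have := hr.le_insert x T
  rw [mem_cl]
  omega

theorem exists_basis (hr : IsRank r) (S : Finset β) :
    ∃ B ⊆ S, r B = B.card ∧ r B = r S := by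
  induction S using Finset.induction_on with
  | empty => exact ⟨∅, subset_rfl, by simp [hr.empty], rfl⟩
  | insert a S _ ih =>
    obtain ⟨B, hBS, hB, hr'⟩ := ih
    have hS : S ⊆ cl r B := hr.subset_cl_of_le hBS hr'.ge
    by_cases ha : a ∈ cl r B
    · refine ⟨B, hBS.trans (subset_insert _ _), hB, ?_⟩
      exact le_antisymm (hr.mono (hBS.trans (subset_insert _ _)))
        (hr.rk_le_of_subset_cl (insert_subset ha hS))
    · have haB : a ∉ B := fun h ↦ ha (subset_cl h)
      have h1 := hr.rk_insert ha
      refine ⟨insert a B, insert_subset_insert a hBS, by rw [h1, hB, card_insert_of_notMem haB], ?_⟩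
      refine le_antisymm (hr.mono (insert_subset_insert a hBS)) (hr.rk_le_of_subset_cl ?_)
      exact insert_subset (subset_cl (mem_insert_self _ _))
        (hS.trans (hr.cl_mono (subset_insert _ _)))

end IsRank

end rank

/-- The rank-function form of strict `2`-density-criticality: a simple matroid with more than twice
as many elements as its rank, such that proper restrictions (`restr`) and simple restrictions `T` of
contractions by nonempty sets `X` (`contr`) have at most twice as many elements as their rank. -/
structure IsCrit {β : Type*} [DecidableEq β] [Fintype β] (r : Finset β → ℕ) : Prop where
  rank : IsRank r
  simple : ∀ x y, r {x, y} = ({x, y} : Finset β).card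
  dense : 2 * r univ < Fintype.card β
  restr : ∀ T : Finset β, T ≠ univ → T.card ≤ 2 * r T
  contr : ∀ X T : Finset β, X.Nonempty → (∀ x ∈ T, r (insert x X) = r X + 1) →
    (∀ x ∈ T, ∀ y ∈ T, x ≠ y → r (insert x (insert y X)) = r X + 2) →
    T.card + 2 * r X ≤ 2 * r (T ∪ X)

section crit

variable {β : Type*} [DecidableEq β] [Fintype β] {r : Finset β → ℕ} {S T F : Finset β}
  {a b c d x y z : β}

namespace IsCrit

theorem rk_singleton (h : IsCrit r) (x : β) : r {x} = 1 := by simpa using h.simple x x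

theorem rk_pair (h : IsCrit r) (hxy : x ≠ y) : r {x, y} = 2 := by
  rw [h.simple, card_pair hxy]

theorem card_univ (h : IsCrit r) : Fintype.card β = 2 * r univ + 1 := by
  have h1 := h.dense
  have : Nonempty β := Fintype.card_pos_iff.1 (by omega)
  obtain ⟨x⟩ := this
  have h2 := h.restr (univ.erase x) (by simp)
  have h3 := h.rank.mono (subset_univ (univ.erase x))
  rw [card_erase_of_mem (mem_univ x), Finset.card_univ] at h2
  omega

/-- Outside a small enough flat `F` two elements become parallel when `F` is contracted. -/
theorem exists_parallel (h : IsCrit r) (hF : F.Nonempty) (hT : ∀ x ∈ T, x ∉ cl r F)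
    (hc : 2 * r univ < T.card + 2 * r F) :
    ∃ x ∈ T, ∃ y ∈ T, x ≠ y ∧ y ∈ cl r (insert x F) := by
  by_contra! hcon
  have h1 := h.contr F T hF (fun x hx ↦ h.rank.rk_insert (hT x hx)) fun x hx y hy hxy ↦ by
    rw [h.rank.rk_insert (hcon y hy x hx hxy.symm), h.rank.rk_insert (hT y hy)]
  have h2 := h.rank.mono (subset_univ (T ∪ F))
  omega

theorem notMem_cl_singleton (h : IsCrit r) (hxy : x ≠ y) : x ∉ cl r {y} := by
  rw [mem_cl, h.rk_pair hxy, h.rk_singleton]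
  omega

/-- Each element lies on two lines with at least three points, or on a line with at least four. -/
theorem exists_two_triangles (h : IsCrit r) (e : β) :
    ∃ a b c d, a ≠ b ∧ c ≠ d ∧ a ≠ e ∧ b ≠ e ∧ c ≠ e ∧ d ≠ e ∧ b ≠ c ∧ b ≠ d ∧
      b ∈ cl r {a, e} ∧ d ∈ cl r {c, e} := by
  have hr1 := h.rk_singleton e
  have hc := h.card_univ
  obtain ⟨a, ha, b, hb, hab, h1⟩ := h.exists_parallel (F := {e}) (T := univ.erase e) (by simp)
    (fun x hx ↦ h.notMem_cl_singleton (ne_of_mem_erase hx)) (by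
      rw [card_erase_of_mem (mem_univ _), Finset.card_univ]; omega)
  obtain ⟨c, hc, d, hd, hcd, h2⟩ := h.exists_parallel (F := {e}) (T := (univ.erase e).erase b)
    (by simp) (fun x hx ↦ h.notMem_cl_singleton (ne_of_mem_erase (mem_of_mem_erase hx))) (by
      rw [card_erase_of_mem hb, card_erase_of_mem (mem_univ _), Finset.card_univ]; omega)
  simp only [mem_erase, mem_univ, and_true] at ha hb hc hd
  exact ⟨a, b, c, d, hab, hcd, ha, hb, hc.2, hd.2, hc.1.symm, hd.1.symm, h1, h2⟩

/-- On a line, any two points span any third. -/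
theorem cl_pair_eq (h : IsCrit r) (hcd : c ≠ d) (hc : c ∈ cl r {a, b}) (hd : d ∈ cl r {a, b}) :
    cl r {c, d} = cl r {a, b} := by
  have hs : ({c, d} : Finset β) ⊆ cl r {a, b} := by
    intro x hx
    simp only [mem_insert, mem_singleton] at hx
    rcases hx with rfl | rfl <;> assumption
  have h2 : r (cl r {a, b}) ≤ r {c, d} := by
    rw [h.rank.rk_cl, h.rk_pair hcd, h.simple]
    exact card_le_two
  exact h.rank.cl_eq hs (subset_cl.trans (h.rank.subset_cl_of_le hs h2))

theorem mem_cl_pair (h : IsCrit r) (hcd : c ≠ d) (hc : c ∈ cl r {a, b}) (hd : d ∈ cl r {a, b})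
    (hx : x ∈ cl r {a, b}) : x ∈ cl r {c, d} := by
  rwa [h.cl_pair_eq hcd hc hd]

end IsCrit

theorem left_mem_cl : a ∈ cl r {a, b} := subset_cl (by simp)

theorem right_mem_cl : b ∈ cl r {a, b} := subset_cl (by simp)

end crit

/-! ### Ends: cocircuits of size three -/

/-- The complement of `{x, y, z}` is a hyperplane, and `x, y, z` lie on a line that meets this
hyperplane in `h`: a copy of `U_{2,4}` is attached to the hyperplane at `h`. -/
structure PointEnd {β : Type*} [DecidableEq β] [Fintype β] (r : Finset β → ℕ) (x y z h : β) :
    Prop where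
  ne : x ≠ y ∧ x ≠ z ∧ y ≠ z
  notMem : x ∉ cl r ({x, y, z} : Finset β)ᶜ ∧ y ∉ cl r ({x, y, z} : Finset β)ᶜ ∧
    z ∉ cl r ({x, y, z} : Finset β)ᶜ
  out : h ≠ x ∧ h ≠ y ∧ h ≠ z
  line : z ∈ cl r {x, y} ∧ h ∈ cl r {x, y}

/-- The complement of `{x, y, z}` is a hyperplane, and the three lines spanned by pairs from the
noncollinear points `x, y, z` meet this hyperplane in `a` (opposite `x`), `b` (opposite `y`) and
`c` (opposite `z`): a copy of `M(K₄)` is attached to the hyperplane along the line `a, b, c`. -/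
structure TriEnd {β : Type*} [DecidableEq β] [Fintype β] (r : Finset β → ℕ) (x y z a b c : β) :
    Prop where
  ne : x ≠ y ∧ x ≠ z ∧ y ≠ z
  notMem : x ∉ cl r ({x, y, z} : Finset β)ᶜ ∧ y ∉ cl r ({x, y, z} : Finset β)ᶜ ∧
    z ∉ cl r ({x, y, z} : Finset β)ᶜ
  out : (a ≠ x ∧ a ≠ y ∧ a ≠ z) ∧ (b ≠ x ∧ b ≠ y ∧ b ≠ z) ∧ (c ≠ x ∧ c ≠ y ∧ c ≠ z)
  line : a ∈ cl r {y, z} ∧ b ∈ cl r {x, z} ∧ c ∈ cl r {x, y}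
  plane : z ∉ cl r {x, y}

section

variable {β : Type*} [DecidableEq β] [Fintype β] {r : Finset β → ℕ} {F H : Finset β}
  {u v w x y z a b c h : β}

/-- A maximal tight proper flat is a hyperplane: contracting a tight flat of corank at least two
makes two elements parallel, and these extend it to a larger tight flat. -/
theorem IsCrit.exists_tight_hyperplane (hr : IsCrit r) (hF : F.Nonempty) (hcl : cl r F = F)
    (hne : F ≠ univ) (ht : F.card = 2 * r F) :
    ∃ H, F ⊆ H ∧ cl r H = H ∧ H ≠ univ ∧ H.card = 2 * r H ∧ r H + 1 = r univ := by
  obtain ⟨H, hH, hmax⟩ := (univ.filter fun H : Finset β ↦ F ⊆ H ∧ cl r H = H ∧ H ≠ univ ∧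
    H.card = 2 * r H).exists_max_image Finset.card ⟨F, by simp [hcl, hne, ht]⟩
  simp only [mem_filter, mem_univ, true_and] at hH hmax
  obtain ⟨hFH, hHcl, hHne, hHt⟩ := hH
  refine ⟨H, hFH, hHcl, hHne, hHt, ?_⟩
  have hc := hr.card_univ
  have hcc := card_add_card_compl H
  obtain ⟨x, hx, y, hy, hxy, hyx⟩ := hr.exists_parallel (T := Hᶜ) (hF.mono hFH)
    (fun x hx ↦ by rw [hHcl]; simpa using hx) (by omega)
  rw [mem_compl] at hx hy
  have hrx := hr.rank.rk_insert (r := r) (S := H) (x := x) (by rwa [hHcl])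
  have hsub : insert y (insert x H) ⊆ cl r (insert x H) := insert_subset hyx subset_cl
  have hcard : (insert y (insert x H)).card = H.card + 2 := by
    rw [card_insert_of_notMem (by simp [hy, hxy.symm]), card_insert_of_notMem hx]
  have hle := card_le_card hsub
  by_cases hG : cl r (insert x H) = univ
  · rw [← hG, hr.rank.rk_cl, hrx]
  · exfalso
    have h1 := hr.restr _ hG
    rw [hr.rank.rk_cl, hrx] at h1
    have h2 := hmax (cl r (insert x H)) ⟨hFH.trans ((subset_insert _ _).trans subset_cl),
      hr.rank.cl_cl _, hG, by rw [hr.rank.rk_cl, hrx]; omega⟩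
    omega

/-- A line through a point `u` off a flat `H` has at most one point in `H`. -/
theorem IsCrit.not_both_mem (hr : IsCrit r) (hcl : cl r H = H) (hu : u ∉ H) (hab : a ≠ b)
    (hb : b ∈ cl r {a, u}) : ¬ (a ∈ H ∧ b ∈ H) := by
  rintro ⟨ha, hb'⟩
  refine hu (hcl ▸ hr.rank.cl_mono (S := {a, b}) ?_ (hr.mem_cl_pair hab left_mem_cl hb
    right_mem_cl))
  intro t ht
  simp only [mem_insert, mem_singleton] at ht
  rcases ht with rfl | rfl <;> assumption

theorem IsCrit.exists_mem_line (hr : IsCrit r) (hcl : cl r H = H)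
    (hmem : ∀ t, t ∉ H ↔ t = u ∨ t = v ∨ t = w) :
    ∃ p, (p = v ∨ p = w) ∧ ∃ h ∈ H, h ∈ cl r {p, u} := by
  have hu : u ∉ H := (hmem u).2 (Or.inl rfl)
  obtain ⟨a, b, c, d, hab, hcd, hau, hbu, hcu, hdu, hbc, hbd, h1, h2⟩ := hr.exists_two_triangles u
  have h1' : a ∈ cl r {b, u} := hr.mem_cl_pair hbu h1 right_mem_cl left_mem_cl
  have h2' : c ∈ cl r {d, u} := hr.mem_cl_pair hdu h2 right_mem_cl left_mem_cl
  have n1 := hr.not_both_mem hcl hu hab h1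
  have n2 := hr.not_both_mem hcl hu hcd h2
  have off : ∀ t, t ∉ H → t ≠ u → t = v ∨ t = w := fun t ht htu ↦
    ((hmem t).1 ht).resolve_left htu
  by_cases ha : a ∈ H
  · exact ⟨b, off b (fun hb ↦ n1 ⟨ha, hb⟩) hbu, a, ha, h1'⟩
  by_cases hb : b ∈ H
  · exact ⟨a, off a ha hau, b, hb, h1⟩
  by_cases hc : c ∈ H
  · exact ⟨d, off d (fun hd ↦ n2 ⟨hc, hd⟩) hdu, c, hc, h2'⟩
  by_cases hd : d ∈ H
  · exact ⟨c, off c hc hcu, d, hd, h2⟩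
  -- otherwise `a, b` and `c, d` are the same two elements
  exfalso
  have oa := off a ha hau
  have ob := off b hb hbu
  have oc := off c hc hcu
  have od := off d hd hdu
  clear off hmem n1 n2 h1 h2 h1' h2'
  grind

theorem IsCrit.exists_mem_line_of_noncollinear (hr : IsCrit r) (hcl : cl r H = H)
    (hmem : ∀ t, t ∉ H ↔ t = u ∨ t = v ∨ t = w) (huv : u ≠ v) (huw : u ≠ w)
    (hw : w ∉ cl r {u, v}) :
    (∃ h ∈ H, h ∈ cl r {v, u}) ∧ ∃ h ∈ H, h ∈ cl r {w, u} := by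
  have hu : u ∉ H := (hmem u).2 (Or.inl rfl)
  have hv : v ∉ H := (hmem v).2 (Or.inr (Or.inl rfl))
  have hwH : w ∉ H := (hmem w).2 (Or.inr (Or.inr rfl))
  have hvw : v ≠ w := fun h ↦ hw (h ▸ right_mem_cl)
  have hw' : w ∉ cl r {v, u} := by rwa [pair_comm]
  have hv' : v ∉ cl r {w, u} := fun h ↦ hw' (hr.mem_cl_pair huv.symm h right_mem_cl left_mem_cl)
  -- each triangle through `u` has exactly one point in `H`
  have key : ∀ a b, a ≠ b → a ≠ u → b ≠ u → b ∈ cl r {a, u} → a ∈ cl r {b, u} →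
      (a = v ∧ b ∈ H) ∨ (a = w ∧ b ∈ H) ∨ (b = v ∧ a ∈ H) ∨ (b = w ∧ a ∈ H) := by
    intro a b hab hau hbu h1 h1'
    have n1 := hr.not_both_mem hcl hu hab h1
    have ma := hmem a
    have mb := hmem b
    have m1 : ¬ (a = v ∧ b = w) := by rintro ⟨rfl, rfl⟩; exact hw' h1
    have m2 : ¬ (a = w ∧ b = v) := by rintro ⟨rfl, rfl⟩; exact hv' h1
    grind
  -- a line through `u` meets `H` in at most one point
  have uniq : ∀ p h h', h ∈ H → h' ∈ H → h ∈ cl r {p, u} → h' ∈ cl r {p, u} → h = h' := by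
    intro p h h' hh hh' h1 h2
    by_contra hne
    refine hr.not_both_mem hcl hu hne ?_ ⟨hh, hh'⟩
    exact hr.mem_cl_pair (fun h ↦ hu (h ▸ hh)) h1 right_mem_cl h2
  obtain ⟨a, b, c, d, hab, hcd, hau, hbu, hcu, hdu, hbc, hbd, h1, h2⟩ := hr.exists_two_triangles u
  have h1' : a ∈ cl r {b, u} := hr.mem_cl_pair hbu h1 right_mem_cl left_mem_cl
  have h2' : c ∈ cl r {d, u} := hr.mem_cl_pair hdu h2 right_mem_cl left_mem_cl
  have k1 := key a b hab hau hbu h1 h1'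
  have k2 := key c d hcd hcu hdu h2 h2'
  rcases k1 with ⟨rfl, k⟩ | ⟨rfl, k⟩ | ⟨rfl, k⟩ | ⟨rfl, k⟩ <;>
  rcases k2 with ⟨rfl, k'⟩ | ⟨rfl, k'⟩ | ⟨rfl, k'⟩ | ⟨rfl, k'⟩ <;>
  first
  | exact ⟨⟨_, k, by assumption⟩, ⟨_, k', by assumption⟩⟩
  | exact ⟨⟨_, k', by assumption⟩, ⟨_, k, by assumption⟩⟩
  | (have := uniq _ _ _ k k' (by assumption) (by assumption); grind)

/-- The cocircuit that is the complement of a tight hyperplane is one of the two kinds of ends. -/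
theorem IsCrit.exists_end (hr : IsCrit r) (hcl : cl r H = H) (ht : H.card = 2 * r H)
    (hH : r H + 1 = r univ) :
    ∃ x y z, Hᶜ = {x, y, z} ∧
      ((∃ h, PointEnd r x y z h) ∨ ∃ a b c, TriEnd r x y z a b c) := by
  have hc := hr.card_univ
  have hcc := card_add_card_compl H
  obtain ⟨x, y, z, hxy, hxz, hyz, hset⟩ := card_eq_three.1 (show Hᶜ.card = 3 by omega)
  refine ⟨x, y, z, hset, ?_⟩
  have hmem : ∀ t, t ∉ H ↔ t = x ∨ t = y ∨ t = z := by
    intro t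
    rw [← mem_compl, hset]
    simp
  have hco : ({x, y, z} : Finset β)ᶜ = H := by rw [← hset, compl_compl]
  have hnot : x ∉ cl r ({x, y, z} : Finset β)ᶜ ∧ y ∉ cl r ({x, y, z} : Finset β)ᶜ ∧
      z ∉ cl r ({x, y, z} : Finset β)ᶜ := by
    rw [hco, hcl, hmem, hmem, hmem]
    simp
  have hout : ∀ t ∈ H, t ≠ x ∧ t ≠ y ∧ t ≠ z := by
    intro t ht
    have := hmem t
    tauto
  by_cases hz : z ∈ cl r {x, y}
  · left
    obtain ⟨p, hp, h, hh, hhp⟩ := hr.exists_mem_line hcl hmem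
    have hpl : p ∈ cl r {x, y} := by rcases hp with rfl | rfl <;> [exact right_mem_cl; exact hz]
    have hpx : p ≠ x := by rcases hp with rfl | rfl <;> [exact hxy.symm; exact hxz.symm]
    exact ⟨h, ⟨hxy, hxz, hyz⟩, hnot, hout h hh, hz,
      by rwa [← hr.cl_pair_eq hpx hpl left_mem_cl]⟩
  · right
    obtain ⟨⟨c, hcH, hc'⟩, ⟨b, hbH, hb'⟩⟩ :=
      hr.exists_mem_line_of_noncollinear hcl hmem hxy hxz hz
    obtain ⟨⟨a, haH, ha'⟩, -⟩ := hr.exists_mem_line_of_noncollinear (u := y) (v := z) (w := x) hcl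
      (fun t ↦ by rw [hmem]; tauto) hyz hxy.symm
      (fun h ↦ hz (hr.mem_cl_pair hxy h left_mem_cl right_mem_cl))
    exact ⟨a, b, c, ⟨hxy, hxz, hyz⟩, hnot, ⟨hout a haH, hout b hbH, hout c hcH⟩,
      ⟨by rwa [pair_comm], by rwa [pair_comm], by rwa [pair_comm]⟩, hz⟩

end

/-! ### Linking two ends -/

section

variable {β : Type*} [DecidableEq β] [Fintype β] {r : Finset β → ℕ}

/-- A form of Tutte's linking theorem. If no partition of the free elements `Z` separates `S` from
`T` after contracting `Y`, then one can contract a set `X` so that `S` and `T` both keep their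
rank, but are no longer skew to each other. -/
theorem IsRank.linking (hr : IsRank r) (S T Z : Finset β) :
    ∀ Y : Finset β, r (Y ∪ S) = r Y + r S → r (Y ∪ T) = r Y + r T →
    (∀ A ⊆ Z, r (Y ∪ S ∪ T ∪ Z) + r Y + 1 ≤ r (Y ∪ S ∪ A) + r (Y ∪ T ∪ (Z \ A))) →
    ∃ X ⊆ Y ∪ Z, r (X ∪ S) = r X + r S ∧ r (X ∪ T) = r X + r T ∧
      r (X ∪ (S ∪ T)) + 1 ≤ r X + r S + r T := by
  induction Z using Finset.induction_on with
  | empty =>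
    intro Y hS hT h
    have := h ∅ subset_rfl
    simp only [union_empty, sdiff_empty, union_assoc] at this
    exact ⟨Y, by simp, hS, hT, by omega⟩
  | insert g Z hg ih =>
    intro Y hS hT h
    by_cases hdel : ∀ A ⊆ Z,
        r (Y ∪ S ∪ T ∪ Z) + r Y + 1 ≤ r (Y ∪ S ∪ A) + r (Y ∪ T ∪ (Z \ A))
    · obtain ⟨X, hX, h'⟩ := ih Y hS hT hdel
      exact ⟨X, hX.trans (union_subset_union_right (subset_insert _ _)), h'⟩
    push Not at hdel
    obtain ⟨A, hAZ, hA⟩ := hdel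
    have hgA : g ∉ A := fun h ↦ hg (hAZ h)
    have hE := hr.mono (show Y ∪ S ∪ T ∪ Z ⊆ Y ∪ S ∪ T ∪ insert g Z from
      union_subset_union_right (subset_insert _ _))
    -- `g` is spanned by neither side of the separation of the deletion
    have hgS : g ∉ cl r (Y ∪ S ∪ A) := by
      intro hc
      have h1 := h (insert g A) (insert_subset_insert g hAZ)
      rw [mem_cl] at hc
      rw [show Y ∪ S ∪ insert g A = insert g (Y ∪ S ∪ A) from union_insert _ _ _, hc,
        show insert g Z \ insert g A = Z \ A by clear * - hg; grind] at h1
      omega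
    have hgT : g ∉ cl r (Y ∪ T ∪ (Z \ A)) := by
      intro hc
      have h1 := h A (hAZ.trans (subset_insert _ _))
      rw [mem_cl] at hc
      rw [show Y ∪ T ∪ (insert g Z \ A) = insert g (Y ∪ T ∪ (Z \ A)) by clear * - hgA; grind, hc] at h1
      omega
    have hgY : r (insert g Y) = r Y + 1 := hr.rk_insert fun hc ↦ hgS
      (hr.cl_mono (by rw [union_assoc]; exact subset_union_left) hc)
    have hgYS : r (insert g Y ∪ S) = r (insert g Y) + r S := by
      rw [insert_union, hr.rk_insert fun hc ↦ hgS (hr.cl_mono subset_union_left hc)]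
      omega
    have hgYT : r (insert g Y ∪ T) = r (insert g Y) + r T := by
      rw [insert_union, hr.rk_insert fun hc ↦ hgT (hr.cl_mono subset_union_left hc)]
      omega
    have hEq : insert g Y ∪ S ∪ T ∪ Z = Y ∪ S ∪ T ∪ insert g Z := by clear * -; grind
    by_cases hcon : ∀ A ⊆ Z, r (insert g Y ∪ S ∪ T ∪ Z) + r (insert g Y) + 1 ≤
        r (insert g Y ∪ S ∪ A) + r (insert g Y ∪ T ∪ (Z \ A))
    · obtain ⟨X, hX, h'⟩ := ih (insert g Y) hgYS hgYT hcon
      exact ⟨X, hX.trans (by clear * -; grind), h'⟩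
    push Not at hcon
    obtain ⟨B, hBZ, hB⟩ := hcon
    have hgB : g ∉ B := fun h ↦ hg (hBZ h)
    exfalso
    -- uncross the two separations
    have s1 := hr.submod (Y ∪ S ∪ A) (insert g Y ∪ S ∪ B)
    have s2 := hr.submod (Y ∪ T ∪ (Z \ A)) (insert g Y ∪ T ∪ (Z \ B))
    have m1 := hr.mono (show Y ∪ S ∪ (A ∩ B) ⊆ (Y ∪ S ∪ A) ∩ (insert g Y ∪ S ∪ B) by
      clear * -; grind)
    have m2 := hr.mono (show Y ∪ T ∪ (insert g Z \ insert g (A ∪ B)) ⊆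
      (Y ∪ T ∪ (Z \ A)) ∩ (insert g Y ∪ T ∪ (Z \ B)) by clear * -; grind)
    have l1 := h (insert g (A ∪ B)) (insert_subset_insert g (union_subset hAZ hBZ))
    have l2 := h (A ∩ B) (inter_subset_left.trans (hAZ.trans (subset_insert _ _)))
    rw [show Y ∪ S ∪ A ∪ (insert g Y ∪ S ∪ B) = Y ∪ S ∪ insert g (A ∪ B) by
      clear * -; grind] at s1
    rw [show Y ∪ T ∪ (Z \ A) ∪ (insert g Y ∪ T ∪ (Z \ B)) =
      Y ∪ T ∪ (insert g Z \ (A ∩ B)) by clear * - hgA; grind] at s2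
    rw [hEq] at hB
    omega

/-- The common features of both kinds of ends: the complement of the three-element set `C` is a
hyperplane, to which `C` is attached along the point or three-point line `T`. -/
structure IsEnd (r : Finset β → ℕ) (C T : Finset β) : Prop where
  card : C.card = 3
  disj : Disjoint C T
  notMem : ∀ x ∈ C, x ∉ cl r Cᶜ
  span : ∀ x ∈ C, C ⊆ cl r (insert x T)
  pair : ∀ x ∈ C, ∀ y ∈ C, x ≠ y → ∃ h ∈ T, h ∈ cl r {x, y}
  size : (r T = 1 ∧ T.card = 1) ∨ (r T = 2 ∧ T.card = 3)

namespace IsEnd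

variable {C D S T X : Finset β} {x y : β}

theorem rk_insert (hr : IsRank r) (h : IsEnd r C T) (hx : x ∈ C) (hS : Disjoint C S) :
    r (insert x S) = r S + 1 :=
  hr.rk_insert fun hc ↦ h.notMem x hx
    (hr.cl_mono (subset_compl_iff_disjoint_left.2 hS) hc)

theorem rk_union (hr : IsRank r) (h : IsEnd r C T) (hS : Disjoint C S) (hT : T ⊆ S) :
    r (S ∪ C) = r S + 1 := by
  obtain ⟨x, hx⟩ : C.Nonempty := card_pos.1 (by rw [h.card]; omega)
  rw [← h.rk_insert hr hx hS]
  refine hr.rk_eq (union_subset ((subset_insert x S).trans subset_cl) ?_)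
    ((insert_subset (mem_union_right _ hx) subset_union_left).trans subset_cl)
  exact (h.span x hx).trans (hr.cl_mono (insert_subset_insert x hT))

theorem notMem_cl_insert (hr : IsRank r) (h : IsEnd r C T) (hX : Disjoint C X)
    (hT : ∀ t ∈ T, t ∉ cl r X) (hx : x ∈ C) (hxy : x ≠ y) (hy : y ∉ cl r X) :
    y ∉ cl r (insert x X) := by
  intro hc
  have key : ∀ z ∉ C, z ∉ cl r X → z ∉ cl r (insert x X) := by
    intro z hz hzX hzc
    refine h.notMem x hx (hr.cl_mono ?_ (hr.exchange hzc hzX))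
    rw [subset_compl_iff_disjoint_left, disjoint_insert_right]
    exact ⟨hz, hX⟩
  by_cases hyC : y ∈ C
  · obtain ⟨t, ht, htc⟩ := h.pair x hx y hyC hxy
    refine key t (fun h' ↦ disjoint_left.1 h.disj h' ht) (hT t ht) (hr.cl_subset ?_ htc)
    intro w hw
    simp only [mem_insert, mem_singleton] at hw
    rcases hw with rfl | rfl
    · exact subset_cl (mem_insert_self _ _)
    · exact hc
  · exact key y hyC hy hc

end IsEnd

variable {C D S T X : Finset β} {x y : β}

theorem IsCrit.rk_skew_singleton (hr : IsCrit r) (hs : r (X ∪ S) = r X + r S) (hx : x ∈ S) :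
    r (insert x X) = r X + 1 := by
  have := hr.rank.skew_subset hs (singleton_subset_iff.2 hx)
  rw [hr.rk_singleton] at this
  rw [← this, union_comm, singleton_union]

theorem IsCrit.rk_skew_pair (hr : IsCrit r) (hs : r (X ∪ S) = r X + r S) (hx : x ∈ S) (hy : y ∈ S)
    (hxy : x ≠ y) : r (insert x (insert y X)) = r X + 2 := by
  have := hr.rank.skew_subset hs (insert_subset hx (singleton_subset_iff.2 hy))
  rw [hr.rk_pair hxy] at this
  rw [← this, union_comm, insert_union, singleton_union]

/-- Representatives, in the contraction by `X`, of the parallel classes of a union of two points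
or three-point lines that are skew to `X`, but not to each other in the contraction. -/
theorem IsCrit.exists_transversal (hr : IsCrit r)
    (h1 : (r S = 1 ∧ S.card = 1) ∨ (r S = 2 ∧ S.card = 3))
    (h2 : (r T = 1 ∧ T.card = 1) ∨ (r T = 2 ∧ T.card = 3))
    (hS : r (X ∪ S) = r X + r S) (hT : r (X ∪ T) = r X + r T)
    (h : r (X ∪ (S ∪ T)) + 1 ≤ r X + r S + r T) :
    ∃ U ⊆ S ∪ T, 2 * r (X ∪ (S ∪ T)) ≤ U.card + 2 * r X + 1 ∧
      (∀ x ∈ U, r (insert x X) = r X + 1) ∧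
      ∀ x ∈ U, ∀ y ∈ U, x ≠ y → r (insert x (insert y X)) = r X + 2 := by
  by_cases hS1 : r (X ∪ (S ∪ T)) ≤ r X + r S
  · exact ⟨S, subset_union_left, by omega, fun x hx ↦ hr.rk_skew_singleton hS hx,
      fun x hx y hy hxy ↦ hr.rk_skew_pair hS hx hy hxy⟩
  by_cases hT1 : r (X ∪ (S ∪ T)) ≤ r X + r T
  · exact ⟨T, subset_union_right, by omega, fun x hx ↦ hr.rk_skew_singleton hT hx,
      fun x hx y hy hxy ↦ hr.rk_skew_pair hT hx hy hxy⟩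
  obtain ⟨hrS, hcS⟩ : r S = 2 ∧ S.card = 3 := by omega
  obtain ⟨hrT, hcT⟩ : r T = 2 ∧ T.card = 3 := by omega
  -- two distinct lines in the contraction: at most one point of `T` lies on the line of `S`
  have hone : ∀ x ∈ T, ∀ y ∈ T, x ∈ cl r (X ∪ S) → y ∈ cl r (X ∪ S) → x = y := by
    intro x hx y hy hxS hyS
    by_contra hxy
    have h3 := hr.rk_skew_pair hT hx hy hxy
    have h4 : insert x (insert y X) ⊆ X ∪ T := by
      refine insert_subset (mem_union_right _ hx) (insert_subset (mem_union_right _ hy) ?_)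
      exact subset_union_left
    have h5 : X ∪ T ⊆ cl r (X ∪ S) := by
      refine (hr.rank.subset_cl_of_le h4 (by omega)).trans (hr.rank.cl_subset ?_)
      exact insert_subset hxS (insert_subset hyS (subset_union_left.trans subset_cl))
    have h6 := hr.rank.rk_union_of_subset_cl h5
    rw [show X ∪ S ∪ (X ∪ T) = X ∪ (S ∪ T) by clear * -; grind] at h6
    omega
  have hcard : (T.filter (· ∈ cl r (X ∪ S))).card ≤ 1 := by
    rw [card_le_one]
    intro x hx y hy
    rw [mem_filter] at hx hy
    exact hone x hx.1 y hy.1 hx.2 hy.2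
  have hsum := card_filter_add_card_filter_not (s := T) (· ∈ cl r (X ∪ S))
  have hdis : Disjoint S (T.filter fun t ↦ t ∉ cl r (X ∪ S)) := by
    rw [disjoint_left]
    intro x hx hx'
    exact (mem_filter.1 hx').2 (subset_cl (mem_union_right _ hx))
  have hmix : ∀ x ∈ S, ∀ y ∈ T, y ∉ cl r (X ∪ S) → r (insert x (insert y X)) = r X + 2 := by
    intro x hx y hy hyS
    rw [insert_comm, hr.rank.rk_insert, hr.rk_skew_singleton hS hx]
    intro hc
    exact hyS (hr.rank.cl_mono (insert_subset (mem_union_right _ hx) subset_union_left) hc)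
  refine ⟨S ∪ T.filter fun t ↦ t ∉ cl r (X ∪ S),
    union_subset_union_right (filter_subset _ _), ?_, ?_, ?_⟩
  · rw [card_union_of_disjoint hdis]
    omega
  · intro x hx
    rcases mem_union.1 hx with hx | hx
    · exact hr.rk_skew_singleton hS hx
    · exact hr.rk_skew_singleton hT (mem_filter.1 hx).1
  · intro x hx y hy hxy
    rcases mem_union.1 hx with hx | hx <;> rcases mem_union.1 hy with hy | hy
    · exact hr.rk_skew_pair hS hx hy hxy
    · exact hmix x hx y (mem_filter.1 hy).1 (mem_filter.1 hy).2
    · rw [insert_comm]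
      exact hmix y hy x (mem_filter.1 hx).1 (mem_filter.1 hx).2
    · exact hr.rk_skew_pair hT (mem_filter.1 hx).1 (mem_filter.1 hy).1 hxy

/-- A critical matroid with two disjoint ends consists only of these ends and of the points and
lines to which they are attached: otherwise one could contract a set linking them. -/
theorem IsCrit.link (hr : IsCrit r) (h1 : IsEnd r C S) (h2 : IsEnd r D T) (hCD : Disjoint C D)
    (hCT : Disjoint C T) (hDS : Disjoint D S) :
    C ∪ D ∪ (S ∪ T) = univ ∧ r (S ∪ T) + 1 ≤ r S + r T ∧ r univ = r (S ∪ T) + 2 ∧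
      (S ∪ T).card + 1 = 2 * r (S ∪ T) := by
  have hu := hr.card_univ
  -- the rank of the union of both ends with a set that contains their attachments
  have hboth : ∀ A, S ∪ T ⊆ A → Disjoint C A → Disjoint D A → r (C ∪ D ∪ A) = r A + 2 := by
    intro A hA hCA hDA
    rw [show C ∪ D ∪ A = A ∪ C ∪ D by clear * -; grind,
      h2.rk_union hr.rank (disjoint_union_right.2 ⟨hDA, hCD.symm⟩)
        ((subset_union_right.trans hA).trans subset_union_left),
      h1.rk_union hr.rank hCA (subset_union_left.trans hA)]
  set R := (C ∪ D)ᶜ with hR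
  have hCR : Disjoint C R := disjoint_compl_right.mono_left subset_union_left
  have hDR : Disjoint D R := disjoint_compl_right.mono_left subset_union_right
  have hSTC : Disjoint C (S ∪ T) := disjoint_union_right.2 ⟨h1.disj, hCT⟩
  have hSTD : Disjoint D (S ∪ T) := disjoint_union_right.2 ⟨hDS, h2.disj⟩
  have hSTR : S ∪ T ⊆ R := by
    rw [hR, subset_compl_iff_disjoint_left]
    exact disjoint_union_left.2 ⟨hSTC, hSTD⟩
  have hrR : r univ = r R + 2 := by
    rw [← hboth R hSTR hCR hDR, hR, union_compl]
  have hcardCD : (C ∪ D).card = 6 := by rw [card_union_of_disjoint hCD, h1.card, h2.card]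
  obtain ⟨c, hc⟩ : C.Nonempty := card_pos.1 (by rw [h1.card]; omega)
  obtain ⟨d, hd⟩ : D.Nonempty := card_pos.1 (by rw [h2.card]; omega)
  obtain ⟨X, hXR, hXS, hXT, hX⟩ := hr.rank.linking S T R ∅ (by simp [hr.rank.empty])
    (by simp [hr.rank.empty]) (by
      -- a separation of `S` from `T` would split the matroid into two proper restrictions that
      -- together have too many elements
      intro A hA
      simp only [empty_union, hr.rank.empty]
      by_contra! hcon
      have e1 := h1.rk_union hr.rank (S := S ∪ A)
        (disjoint_union_right.2 ⟨h1.disj, hCR.mono_right hA⟩) subset_union_left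
      have e2 := h2.rk_union hr.rank (S := T ∪ R \ A)
        (disjoint_union_right.2 ⟨h2.disj, hDR.mono_right sdiff_subset⟩) subset_union_left
      have n1 := hr.restr (S ∪ A ∪ C) (fun h ↦ by
        have hd' : d ∈ S ∪ A ∪ C := h ▸ mem_univ d
        have := hDR.mono_right hA
        rw [disjoint_left] at this hDS hCD
        grind)
      have n2 := hr.restr (T ∪ R \ A ∪ D) (fun h ↦ by
        have hc' : c ∈ T ∪ R \ A ∪ D := h ▸ mem_univ c
        rw [disjoint_left] at hCT hCD hCR
        grind)
      have n3 : (S ∪ A ∪ C) ∪ (T ∪ R \ A ∪ D) = univ := by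
        ext t
        simp only [hR, mem_union, mem_sdiff, mem_compl, mem_univ, iff_true]
        tauto
      have n4 := card_union_le (S ∪ A ∪ C) (T ∪ R \ A ∪ D)
      rw [n3, Finset.card_univ] at n4
      rw [union_eq_right.2 hSTR] at hcon
      omega)
  rw [empty_union] at hXR
  have hCX := hCR.mono_right hXR
  have hDX := hDR.mono_right hXR
  obtain ⟨U, hU, hUc, hU1, hU2⟩ := hr.exists_transversal h1.size h2.size hXS hXT hX
  have hUdis : Disjoint (C ∪ D) U :=
    disjoint_union_left.2 ⟨hSTC.mono_right hU, hSTD.mono_right hU⟩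
  have hcard : (C ∪ D ∪ U).card = 6 + U.card := by
    rw [card_union_of_disjoint hUdis, hcardCD]
  have hrank : r (C ∪ D ∪ U ∪ X) ≤ r (X ∪ (S ∪ T)) + 2 := by
    rw [← hboth (X ∪ (S ∪ T)) subset_union_right (disjoint_union_right.2 ⟨hCX, hSTC⟩)
      (disjoint_union_right.2 ⟨hDX, hSTD⟩)]
    exact hr.rank.mono (by clear * - hU; grind)
  have hnl : ∀ x ∈ C ∪ D ∪ U, r (insert x X) = r X + 1 := by
    intro x hx
    simp only [mem_union] at hx
    rcases hx with (hx | hx) | hx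
    · exact h1.rk_insert hr.rank hx hCX
    · exact h2.rk_insert hr.rank hx hDX
    · exact hU1 x hx
  have hnl' : ∀ x ∈ C ∪ D ∪ U, x ∉ cl r X := by
    intro x hx hc
    have := hnl x hx
    rw [mem_cl] at hc
    omega
  have hSX : ∀ t ∈ S, t ∉ cl r X := fun t ht hc ↦ by
    have := hr.rk_skew_singleton hXS ht
    rw [mem_cl] at hc
    omega
  have hTX : ∀ t ∈ T, t ∉ cl r X := fun t ht hc ↦ by
    have := hr.rk_skew_singleton hXT ht
    rw [mem_cl] at hc
    omega
  have hCD' : ∀ x ∈ C ∪ D, ∀ y ∈ C ∪ D ∪ U, x ≠ y → r (insert y (insert x X)) = r X + 2 := by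
    intro x hx y hy hxy
    rw [hr.rank.rk_insert, hnl x (mem_union_left _ hx)]
    rcases mem_union.1 hx with hx | hx
    · exact h1.notMem_cl_insert hr.rank hCX hSX hx hxy (hnl' y hy)
    · exact h2.notMem_cl_insert hr.rank hDX hTX hx hxy (hnl' y hy)
  have hpar : ∀ x ∈ C ∪ D ∪ U, ∀ y ∈ C ∪ D ∪ U, x ≠ y →
      r (insert x (insert y X)) = r X + 2 := by
    intro x hx y hy hxy
    by_cases hx' : x ∈ C ∪ D
    · rw [insert_comm]
      exact hCD' x hx' y hy hxy
    by_cases hy' : y ∈ C ∪ D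
    · exact hCD' y hy' x hx hxy.symm
    exact hU2 x ((mem_union.1 hx).resolve_left hx') y ((mem_union.1 hy).resolve_left hy') hxy
  -- the set `C ∪ D ∪ U` becomes simple when `X` is contracted, and it has too many elements for
  -- a proper minor
  rcases X.eq_empty_or_nonempty with rfl | hne
  · simp only [empty_union, hr.rank.empty, union_empty] at *
    have huniv : C ∪ D ∪ U = univ := by
      by_contra hne
      have := hr.restr _ hne
      omega
    have huniv' : C ∪ D ∪ (S ∪ T) = univ := by
      rw [← univ_subset_iff, ← huniv]
      exact union_subset_union_right hU
    have h3 := hboth (S ∪ T) subset_rfl hSTC hSTD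
    rw [huniv'] at h3
    refine ⟨huniv', by omega, h3, ?_⟩
    have h4 : (C ∪ D ∪ (S ∪ T)).card = 6 + (S ∪ T).card := by
      rw [card_union_of_disjoint (disjoint_union_left.2 ⟨hSTC, hSTD⟩), hcardCD]
    rw [huniv', Finset.card_univ] at h4
    omega
  · have := hr.contr X (C ∪ D ∪ U) hne hnl hpar
    omega

end

/-! ### Geometry of the two kinds of ends -/

section

variable {β : Type*} [DecidableEq β] [Fintype β] {r : Finset β → ℕ} {S : Finset β}
  {u v w x y z a b c h p : β}

theorem IsRank.cl_pair_mono (hr : IsRank r) (hx : x ∈ cl r S) (hy : y ∈ cl r S)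
    (hz : z ∈ cl r {x, y}) : z ∈ cl r S := by
  refine hr.cl_subset ?_ hz
  intro w hw
  simp only [mem_insert, mem_singleton] at hw
  rcases hw with rfl | rfl <;> assumption

/-- Two lines through `w` that meet in a second point coincide. -/
theorem IsCrit.mem_cl_of_meet (hr : IsCrit r) (hpw : p ≠ w) (huv : u ≠ v) (h1 : p ∈ cl r {u, w})
    (h2 : p ∈ cl r {v, w}) : w ∈ cl r {u, v} := by
  have hu : u ∈ cl r {p, w} := hr.mem_cl_pair hpw h1 right_mem_cl left_mem_cl
  have hv : v ∈ cl r {p, w} := hr.mem_cl_pair hpw h2 right_mem_cl left_mem_cl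
  exact hr.mem_cl_pair huv hu hv right_mem_cl

theorem IsCrit.swap_mem_cl (hr : IsCrit r) (hpx : p ≠ x) (h : p ∈ cl r {x, y}) :
    y ∈ cl r {x, p} :=
  hr.mem_cl_pair hpx.symm left_mem_cl h right_mem_cl

namespace TriEnd

/-- Cyclic symmetry. -/
theorem rotate (hr : IsCrit r) (h : TriEnd r x y z a b c) : TriEnd r y z x b c a := by
  obtain ⟨⟨hxy, hxz, hyz⟩, hn, ho, ⟨ha, hb, hc⟩, hp⟩ := h
  have hset : ({y, z, x} : Finset β) = {x, y, z} := by
    ext; simp only [mem_insert, mem_singleton]; tauto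
  refine ⟨⟨hyz, hxy.symm, hxz.symm⟩, ?_, by tauto, ⟨?_, ?_, ?_⟩, ?_⟩
  · rw [hset]; tauto
  · rwa [pair_comm]
  · rwa [pair_comm]
  · exact ha
  · exact fun h ↦ hp (hr.mem_cl_pair hxy h left_mem_cl right_mem_cl)

/-- Symmetry under a transposition. -/
theorem swap (hr : IsCrit r) (h : TriEnd r x y z a b c) : TriEnd r x z y a c b := by
  obtain ⟨⟨hxy, hxz, hyz⟩, hn, ho, ⟨ha, hb, hc⟩, hp⟩ := h
  have hset : ({x, z, y} : Finset β) = {x, y, z} := by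
    ext; simp only [mem_insert, mem_singleton]; tauto
  refine ⟨⟨hxz, hxy, hyz.symm⟩, ?_, by tauto, ⟨?_, hc, hb⟩, ?_⟩
  · rw [hset]; tauto
  · rwa [pair_comm]
  · exact fun h ↦ hp (hr.mem_cl_pair hxy left_mem_cl h right_mem_cl)

theorem foot_ne (hr : IsCrit r) (h : TriEnd r x y z a b c) : a ≠ b ∧ a ≠ c ∧ b ≠ c := by
  have key : ∀ {x y z a b c : β}, TriEnd r x y z a b c → a ≠ b := by
    rintro x y z a b c ⟨⟨hxy, hxz, hyz⟩, hn, ho, ⟨ha, hb, hc⟩, hp⟩ rfl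
    exact hp (hr.mem_cl_of_meet ho.1.2.2 hxy hb ha)
  exact ⟨key h, (key ((h.rotate hr).rotate hr)).symm, key (h.rotate hr)⟩

theorem isEnd (hr : IsCrit r) (h : TriEnd r x y z a b c) : IsEnd r {x, y, z} {a, b, c} := by
  have hne := h.foot_ne hr
  obtain ⟨⟨hxy, hxz, hyz⟩, hn, ho, ⟨ha, hb, hc⟩, hp⟩ := h
  have hdis : Disjoint ({x, y, z} : Finset β) {a, b, c} := by
    rw [disjoint_left]
    intro t ht
    simp only [mem_insert, mem_singleton] at ht ⊢
    rcases ht with rfl | rfl | rfl <;> (clear * - ho; tauto)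
  have hT : ({a, b, c} : Finset β) ⊆ ({x, y, z} : Finset β)ᶜ :=
    subset_compl_iff_disjoint_left.2 hdis
  refine ⟨card_eq_three.2 ⟨x, y, z, hxy, hxz, hyz, rfl⟩, hdis, ?_, ?_, ?_, ?_⟩
  · intro t ht
    simp only [mem_insert, mem_singleton] at ht
    rcases ht with rfl | rfl | rfl
    exacts [hn.1, hn.2.1, hn.2.2]
  · have ma : ∀ t, a ∈ cl r (insert t {a, b, c}) := fun t ↦ subset_cl (by simp)
    have mb : ∀ t, b ∈ cl r (insert t {a, b, c}) := fun t ↦ subset_cl (by simp)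
    have mc : ∀ t, c ∈ cl r (insert t {a, b, c}) := fun t ↦ subset_cl (by simp)
    have mt : ∀ t, t ∈ cl r (insert t {a, b, c}) := fun t ↦ subset_cl (by simp)
    have go : ∀ {t s q : β}, q ≠ t → q ∈ cl r {t, s} → q ∈ cl r (insert t {a, b, c}) →
        s ∈ cl r (insert t {a, b, c}) := fun hqt hq hq' ↦
      hr.rank.cl_pair_mono (mt _) hq' (hr.swap_mem_cl hqt hq)
    intro t ht s hs
    simp only [mem_insert, mem_singleton] at ht hs
    rcases ht with rfl | rfl | rfl <;> rcases hs with rfl | rfl | rfl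
    · exact mt _
    · exact go ho.2.2.1 hc (mc _)
    · exact go ho.2.1.1 hb (mb _)
    · exact go ho.2.2.2.1 (by rwa [pair_comm]) (mc _)
    · exact mt _
    · exact go ho.1.2.1 ha (ma _)
    · exact go ho.2.1.2.2 (by rwa [pair_comm]) (mb _)
    · exact go ho.1.2.2 (by rwa [pair_comm]) (ma _)
    · exact mt _
  · intro t ht s hs hts
    simp only [mem_insert, mem_singleton] at ht hs
    rcases ht with rfl | rfl | rfl <;> rcases hs with rfl | rfl | rfl
    · exact absurd rfl hts
    · exact ⟨c, by simp, hc⟩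
    · exact ⟨b, by simp, hb⟩
    · exact ⟨c, by simp, by rwa [pair_comm]⟩
    · exact absurd rfl hts
    · exact ⟨a, by simp, ha⟩
    · exact ⟨b, by simp, by rwa [pair_comm]⟩
    · exact ⟨a, by simp, by rwa [pair_comm]⟩
    · exact absurd rfl hts
  · right
    have hcard : ({a, b, c} : Finset β).card = 3 :=
      card_eq_three.2 ⟨a, b, c, hne.1, hne.2.1, hne.2.2, rfl⟩
    refine ⟨le_antisymm ?_ ?_, hcard⟩
    · by_contra! hcon
      have mx : x ∈ cl r {x, y, z} := subset_cl (by simp)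
      have my : y ∈ cl r {x, y, z} := subset_cl (by simp)
      have mz : z ∈ cl r {x, y, z} := subset_cl (by simp)
      have hsub : ({a, b, c} : Finset β) ⊆ cl r {x, y, z} := by
        intro t ht
        simp only [mem_insert, mem_singleton] at ht
        rcases ht with rfl | rfl | rfl
        · exact hr.rank.cl_pair_mono my mz ha
        · exact hr.rank.cl_pair_mono mx mz hb
        · exact hr.rank.cl_pair_mono mx my hc
      have h3 := hr.rank.rk_le_card {x, y, z}
      have h4 : ({x, y, z} : Finset β).card ≤ 3 := card_le_three
      have h5 := hr.rank.subset_cl_of_le hsub (by rw [hr.rank.rk_cl]; omega)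
      exact hn.1 (hr.rank.cl_mono hT (h5 mx))
    · rw [← hr.rk_pair hne.1]
      exact hr.rank.mono (by intro t; simp only [mem_insert, mem_singleton]; tauto)

theorem rk_foot (hr : IsCrit r) (h : TriEnd r x y z a b c) : r {a, b, c} = 2 := by
  have hne := h.foot_ne hr
  have hs := (h.isEnd hr).size
  rw [card_eq_three.2 ⟨a, b, c, hne.1, hne.2.1, hne.2.2, rfl⟩] at hs
  omega

end TriEnd

theorem PointEnd.isEnd (hr : IsCrit r) (hP : PointEnd r x y z h) : IsEnd r {x, y, z} {h} := by
  obtain ⟨⟨hxy, hxz, hyz⟩, hn, ho, hz, hh⟩ := hP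
  have hall : ∀ t ∈ ({x, y, z} : Finset β), t ∈ cl r {x, y} := by
    intro t ht
    simp only [mem_insert, mem_singleton] at ht
    rcases ht with rfl | rfl | rfl
    exacts [left_mem_cl, right_mem_cl, hz]
  have hne : ∀ t ∈ ({x, y, z} : Finset β), t ≠ h := by
    intro t ht
    simp only [mem_insert, mem_singleton] at ht
    rcases ht with rfl | rfl | rfl <;> tauto
  refine ⟨card_eq_three.2 ⟨x, y, z, hxy, hxz, hyz, rfl⟩, ?_, ?_, ?_, ?_, ?_⟩
  · rw [disjoint_singleton_right]
    exact fun h' ↦ hne _ h' rfl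
  · intro t ht
    simp only [mem_insert, mem_singleton] at ht
    rcases ht with rfl | rfl | rfl
    exacts [hn.1, hn.2.1, hn.2.2]
  · intro t ht s hs
    exact hr.mem_cl_pair (hne t ht) (hall t ht) hh (hall s hs)
  · intro t ht s hs hts
    exact ⟨h, by simp, hr.mem_cl_pair hts (hall t ht) (hall s hs) hh⟩
  · exact Or.inl ⟨hr.rk_singleton h, card_singleton h⟩

end

/-! ### The rank function of a matroid with an end -/

/-- The rank function, in terms of the rank function `ρ` of the complement of `{x, y, z}`, of a
matroid in which `x, y, z` are attached along the line `a, b, c` as in `TriEnd`. -/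
def triRank {β : Type*} [DecidableEq β] (ρ : Finset β → ℕ) (x y z a b c : β) (S : Finset β) : ℕ :=
  let J := S \ {x, y, z}
  if x ∈ S then
    if y ∈ S then if z ∈ S then ρ (insert b (insert c J)) + 1 else ρ (insert c J) + 1
    else if z ∈ S then ρ (insert b J) + 1 else ρ J + 1
  else if y ∈ S then if z ∈ S then ρ (insert a J) + 1 else ρ J + 1
  else if z ∈ S then ρ J + 1 else ρ J

/-- The rank function, in terms of the rank function `ρ` of the complement of `{x, y, z}`, of a
matroid in which `x, y, z` are attached at the point `h` as in `PointEnd`. -/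
def pointRank {β : Type*} [DecidableEq β] (ρ : Finset β → ℕ) (x y z h : β) (S : Finset β) : ℕ :=
  let J := S \ {x, y, z}
  if (S ∩ {x, y, z}).card ≤ 1 then ρ J + (S ∩ {x, y, z}).card else ρ (insert h J) + 1

section

variable {β : Type*} [DecidableEq β] {ρ ρ' : Finset β → ℕ} {S : Finset β} {x y z a b c h : β}

theorem triRank_congr (hρ : ∀ J ⊆ S \ {x, y, z} ∪ {a, b, c}, ρ J = ρ' J) :
    triRank ρ x y z a b c S = triRank ρ' x y z a b c S := by
  have h0 := hρ (S \ {x, y, z}) subset_union_left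
  have h1 := hρ (insert a (S \ {x, y, z})) (insert_subset (by simp) subset_union_left)
  have h2 := hρ (insert b (S \ {x, y, z})) (insert_subset (by simp) subset_union_left)
  have h3 := hρ (insert c (S \ {x, y, z})) (insert_subset (by simp) subset_union_left)
  have h4 := hρ (insert b (insert c (S \ {x, y, z})))
    (insert_subset (by simp) (insert_subset (by simp) subset_union_left))
  simp only [triRank, h0, h1, h2, h3, h4]

theorem pointRank_congr (hρ : ∀ J ⊆ S \ {x, y, z} ∪ {h}, ρ J = ρ' J) :
    pointRank ρ x y z h S = pointRank ρ' x y z h S := by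
  have h0 := hρ (S \ {x, y, z}) subset_union_left
  have h1 := hρ (insert h (S \ {x, y, z})) (insert_subset (by simp) subset_union_left)
  simp only [pointRank, h0, h1]

theorem eq_pieces (S : Finset β) (x y z : β) :
    S = (if x ∈ S then {x} else ∅) ∪ ((if y ∈ S then {y} else ∅) ∪
      ((if z ∈ S then {z} else ∅) ∪ S \ {x, y, z})) := by
  ext t
  simp only [mem_union, mem_sdiff, mem_insert, mem_singleton]
  split_ifs <;> simp only [mem_singleton, notMem_empty] <;> grind

theorem triRank_map {γ : Type*} [DecidableEq γ] (f : β ↪ γ) (σ : Finset γ → ℕ) :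
    triRank σ (f x) (f y) (f z) (f a) (f b) (f c) (S.map f) =
      triRank (fun J ↦ σ (J.map f)) x y z a b c S := by
  have : S.map f \ {f x, f y, f z} = (S \ {x, y, z}).map f := by
    ext t; simp; grind [f.injective]
  simp only [triRank, this, mem_map', ← map_insert]

theorem pointRank_map {γ : Type*} [DecidableEq γ] (f : β ↪ γ) (σ : Finset γ → ℕ) :
    pointRank σ (f x) (f y) (f z) (f h) (S.map f) =
      pointRank (fun J ↦ σ (J.map f)) x y z h S := by
  have h1 : S.map f \ {f x, f y, f z} = (S \ {x, y, z}).map f := by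
    ext t; simp; grind [f.injective]
  have h2 : S.map f ∩ {f x, f y, f z} = (S ∩ {x, y, z}).map f := by
    rw [map_inter]; simp
  simp only [pointRank, h1, h2, card_map, ← map_insert]

end

section

variable {β : Type*} [DecidableEq β] [Fintype β] {r : Finset β → ℕ} {S J : Finset β}
  {x y z a b c h : β}

/-- A matroid with an end `x, y, z` is determined by the complement of the end: two of these points
span the same set as one of them and the point where their line meets the complement. -/
theorem TriEnd.rk_eq (hr : IsCrit r) (hT : TriEnd r x y z a b c) (S : Finset β) :
    r S = triRank r x y z a b c S := by
  have hE := hT.isEnd hr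
  have hE' := hE.disj
  obtain ⟨⟨hxy, hxz, hyz⟩, hn, ho, ⟨ha, hb, hc⟩, hp⟩ := hT
  set J := S \ {x, y, z} with hJ
  have hdJ : Disjoint {x, y, z} J := disjoint_sdiff
  simp only [disjoint_insert_right, disjoint_singleton_right] at hE'
  have hda : Disjoint {x, y, z} (insert a J) := disjoint_insert_right.2 ⟨hE'.1, hdJ⟩
  have hdb : Disjoint {x, y, z} (insert b J) := disjoint_insert_right.2 ⟨hE'.2.1, hdJ⟩
  have hdc : Disjoint {x, y, z} (insert c J) := disjoint_insert_right.2 ⟨hE'.2.2, hdJ⟩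
  have hdbc : Disjoint {x, y, z} (insert b (insert c J)) :=
    disjoint_insert_right.2 ⟨hE'.2.1, hdc⟩
  have rx := fun {K} (hK : Disjoint {x, y, z} K) ↦ hE.rk_insert hr.rank (x := x) (by simp) hK
  have ry := fun {K} (hK : Disjoint {x, y, z} K) ↦ hE.rk_insert hr.rank (x := y) (by simp) hK
  have rz := fun {K} (hK : Disjoint {x, y, z} K) ↦ hE.rk_insert hr.rank (x := z) (by simp) hK
  -- replacing a second point of a line by the foot of the line does not change the span
  have two : ∀ {t s q : β} (K : Finset β), q ≠ t → q ∈ cl r {t, s} →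
      r (insert t (insert s K)) = r (insert t (insert q K)) := by
    intro t s q K hqt hq
    have hs := hr.swap_mem_cl hqt hq
    have e : ∀ w, K ⊆ cl r (insert t (insert w K)) := fun w ↦
      ((subset_insert _ _).trans (subset_insert _ _)).trans subset_cl
    have mt : ∀ w, t ∈ cl r (insert t (insert w K)) := fun w ↦ subset_cl (by simp)
    have mw : ∀ w, w ∈ cl r (insert t (insert w K)) := fun w ↦ subset_cl (by simp)
    exact hr.rank.rk_eq
      (insert_subset (mt _) (insert_subset (hr.rank.cl_pair_mono (mt _) (mw _) hs) (e _)))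
      (insert_subset (mt _) (insert_subset (hr.rank.cl_pair_mono (mt _) (mw _) hq) (e _)))
  have hS := eq_pieces S x y z
  rw [← hJ] at hS
  unfold triRank
  simp only [← hJ]
  clear_value J
  by_cases hxS : x ∈ S <;> by_cases hyS : y ∈ S <;> by_cases hzS : z ∈ S <;>
    simp only [hxS, hyS, hzS, if_true, if_false, empty_union, singleton_union] at hS ⊢ <;> rw [hS]
  · rw [two _ ho.2.2.1 hc, insert_comm c z, two _ ho.2.1.1 hb, rx hdbc]
  · rw [two _ ho.2.2.1 hc, rx hdc]
  · rw [two _ ho.2.1.1 hb, rx hdb]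
  · rw [rx hdJ]
  · rw [two _ ho.1.2.1 ha, ry hda]
  · rw [ry hdJ]
  · rw [rz hdJ]

/-- The analogue of `TriEnd.rk_eq` for the other kind of ends. -/
theorem PointEnd.rk_eq (hr : IsCrit r) (hP : PointEnd r x y z h) (S : Finset β) :
    r S = pointRank r x y z h S := by
  have hE := hP.isEnd hr
  have hdJ : Disjoint {x, y, z} (S \ {x, y, z}) := disjoint_sdiff
  have hSJ : S = S \ {x, y, z} ∪ (S ∩ {x, y, z}) := (sdiff_union_inter S {x, y, z}).symm
  have hdh : Disjoint {x, y, z} (insert h (S \ {x, y, z})) :=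
    disjoint_insert_right.2 ⟨disjoint_singleton_right.1 hE.disj, hdJ⟩
  unfold pointRank
  simp only
  split_ifs with hc
  · rcases Nat.le_one_iff_eq_zero_or_eq_one.1 hc with h0 | h1
    · rw [h0, add_zero]
      rw [card_eq_zero] at h0
      conv_lhs => rw [hSJ, h0, union_empty]
    · obtain ⟨t, ht⟩ := card_eq_one.1 h1
      have htC : t ∈ ({x, y, z} : Finset β) := by
        have : t ∈ S ∩ {x, y, z} := by simp [ht]
        exact (mem_inter.1 this).2
      rw [h1, ← hE.rk_insert hr.rank htC hdJ]
      conv_lhs => rw [hSJ, ht, union_comm]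
      rfl
  · obtain ⟨t, ht, s, hs, hts⟩ := one_lt_card.1 (not_le.1 hc)
    rw [mem_inter] at ht hs
    rw [← hE.rk_insert hr.rank ht.2 hdh]
    obtain ⟨q, hq, hqc⟩ := hE.pair t ht.2 s hs.2 hts
    rw [mem_singleton] at hq
    subst hq
    refine hr.rank.rk_eq ?_ ?_
    · intro w hw
      by_cases hwC : w ∈ ({x, y, z} : Finset β)
      · refine hr.rank.cl_mono ?_ (hE.span t ht.2 hwC)
        intro; simp only [mem_insert, mem_singleton]; tauto
      · exact subset_cl (mem_insert_of_mem (mem_insert_of_mem (mem_sdiff.2 ⟨hw, hwC⟩)))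
    · refine insert_subset (subset_cl ht.1) (insert_subset ?_ (sdiff_subset.trans subset_cl))
      exact hr.rank.cl_pair_mono (subset_cl ht.1) (subset_cl hs.1) hqc

end

/-! ### Matroids given by lists of flats -/

/-- The independent sets of the matroid on `Fin n` described by a list of pairs `(F, k)`: a set is
independent if it has at most `k` elements in `F`, for each pair `(F, k)` of the list. For a simple
matroid it suffices to list the connected flats `F` of rank `k` at least two, together with the
ground set. -/
def CodeIndep {n : ℕ} (L : List (Finset (Fin n) × ℕ)) (S : Finset (Fin n)) : Prop :=
  ∀ q ∈ L, (S ∩ q.1).card ≤ q.2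

instance {n : ℕ} (L : List (Finset (Fin n) × ℕ)) : DecidablePred (CodeIndep L) :=
  fun S ↦ inferInstanceAs (Decidable (∀ q ∈ L, (S ∩ q.1).card ≤ q.2))

/-- The ground set of the matroid with rank function `r` can be labelled by `Fin n` so that its
independent sets are those described by the list `L`. -/
def HasCode {β : Type*} (r : Finset β → ℕ) {n : ℕ} (L : List (Finset (Fin n) × ℕ)) : Prop :=
  ∃ v : Fin n ≃ β, ∀ S : Finset (Fin n), r (S.map v.toEmbedding) = S.card ↔ CodeIndep L S

/-- The connected flats of `U_{2,5}`. -/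
def codeU25 : List (Finset (Fin 5) × ℕ) := [(univ, 2)]

/-- The connected flats of `P(U_{2,4}, U_{2,4})`, with basepoint `6`. -/
def codePUU : List (Finset (Fin 7) × ℕ) := [({0, 1, 2, 6}, 2), ({3, 4, 5, 6}, 2), (univ, 3)]

/-- The connected flats of `O₇`. -/
def codeO7 : List (Finset (Fin 7) × ℕ) :=
  [({0, 1, 2, 3}, 2), ({0, 4, 5}, 2), ({1, 5, 6}, 2), ({2, 4, 6}, 2), (univ, 3)]

/-- The connected flats of `P₇`. -/
def codeP7 : List (Finset (Fin 7) × ℕ) :=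
  [({0, 1, 2}, 2), ({3, 4, 5}, 2), ({6, 0, 3}, 2), ({6, 1, 4}, 2), ({6, 2, 5}, 2), (univ, 3)]

/-- The connected flats of the non-Fano matroid. -/
def codeNonFano : List (Finset (Fin 7) × ℕ) :=
  [({0, 1, 2}, 2), ({2, 3, 4}, 2), ({0, 4, 5}, 2), ({0, 3, 6}, 2), ({1, 4, 6}, 2), ({2, 5, 6}, 2),
    (univ, 3)]

/-- The connected flats of the Fano matroid. -/
def codeFano : List (Finset (Fin 7) × ℕ) :=
  [({0, 1, 2}, 2), ({2, 3, 4}, 2), ({0, 4, 5}, 2), ({0, 3, 6}, 2), ({1, 4, 6}, 2), ({2, 5, 6}, 2),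
    ({1, 3, 5}, 2), (univ, 3)]

/-- The connected flats of `P(U_{2,4}, M(K₄))`: the basepoint is `6`, and `M(K₄)` consists of the
triad `3, 4, 5` and the line `6, 7, 8`. -/
def codePUK : List (Finset (Fin 9) × ℕ) :=
  [({0, 1, 2, 6}, 2), ({4, 5, 6}, 2), ({3, 5, 7}, 2), ({3, 4, 8}, 2), ({6, 7, 8}, 2),
    ({3, 4, 5, 6, 7, 8}, 3), ({0, 1, 2, 6, 4, 5}, 3), ({0, 1, 2, 6, 7, 8}, 3), (univ, 4)]

/-- The connected flats of `M(K₅ \ e)`: the stars of the two vertices of degree three are `0, 1, 2`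
and `3, 4, 5`, and `6, 7, 8` is the triangle on the other vertices. -/
def codeK5e : List (Finset (Fin 9) × ℕ) :=
  [({1, 2, 6}, 2), ({0, 2, 7}, 2), ({0, 1, 8}, 2), ({4, 5, 6}, 2), ({3, 5, 7}, 2), ({3, 4, 8}, 2),
    ({6, 7, 8}, 2), ({0, 1, 2, 6, 7, 8}, 3), ({3, 4, 5, 6, 7, 8}, 3), ({1, 2, 4, 5, 6}, 3),
    ({0, 2, 3, 5, 7}, 3), ({0, 1, 3, 4, 8}, 3), (univ, 4)]

/-- The connected flats of `M*(K_{3,3})`, whose elements form a `3 × 3` grid: the lines are the rows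
and columns, and the connected planes are the unions of a row and a column. -/
def codeK33 : List (Finset (Fin 9) × ℕ) :=
  [({0, 1, 2}, 2), ({3, 4, 5}, 2), ({6, 7, 8}, 2), ({0, 3, 6}, 2), ({1, 4, 7}, 2), ({2, 5, 8}, 2),
    ({0, 1, 2, 3, 6}, 3), ({0, 1, 2, 4, 7}, 3), ({0, 1, 2, 5, 8}, 3),
    ({3, 4, 5, 0, 6}, 3), ({3, 4, 5, 1, 7}, 3), ({3, 4, 5, 2, 8}, 3),
    ({6, 7, 8, 0, 3}, 3), ({6, 7, 8, 1, 4}, 3), ({6, 7, 8, 2, 5}, 3), (univ, 4)]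

/-- The connected flats of `P(M(K₄), M(K₄))`: the basepoint is `6`, and the two copies of `M(K₄)`
consist of the triad `0, 1, 2` and the line `6, 7, 8`, and of `3, 4, 5` and `6, 9, 10`. -/
def codePKK : List (Finset (Fin 11) × ℕ) :=
  [({1, 2, 6}, 2), ({0, 2, 7}, 2), ({0, 1, 8}, 2), ({6, 7, 8}, 2),
    ({4, 5, 6}, 2), ({3, 5, 9}, 2), ({3, 4, 10}, 2), ({6, 9, 10}, 2),
    ({0, 1, 2, 6, 7, 8}, 3), ({3, 4, 5, 6, 9, 10}, 3), ({1, 2, 6, 4, 5}, 3), ({1, 2, 6, 9, 10}, 3),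
    ({6, 7, 8, 4, 5}, 3), ({6, 7, 8, 9, 10}, 3), ({0, 1, 2, 6, 7, 8, 4, 5}, 4),
    ({0, 1, 2, 6, 7, 8, 9, 10}, 4), ({3, 4, 5, 6, 9, 10, 1, 2}, 4),
    ({3, 4, 5, 6, 9, 10, 7, 8}, 4), (univ, 5)]

/-- The descriptions of the ten matroids, in the order of `tenMatroids`. -/
def tenCodes : List (Σ n : ℕ, List (Finset (Fin n) × ℕ)) :=
  [⟨_, codeU25⟩, ⟨_, codePUU⟩, ⟨_, codeO7⟩, ⟨_, codeP7⟩, ⟨_, codeNonFano⟩, ⟨_, codeFano⟩,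
    ⟨_, codePUK⟩, ⟨_, codeK5e⟩, ⟨_, codeK33⟩, ⟨_, codePKK⟩]

/-! ### Critical matroids with ends -/

section

variable {β : Type*} [DecidableEq β] [Fintype β] {r : Finset β → ℕ} {S T : Finset β}

/-- A surjective labelling by the right number of labels is a bijection. -/
theorem exists_equiv {n : ℕ} (v : Fin n → β) (hv : univ.image v = univ)
    (hc : Fintype.card β = n) : ∃ e : Fin n ≃ β, ∀ i, e i = v i := by
  have hs : Function.Surjective v := fun b ↦ by
    have : b ∈ univ.image v := hv ▸ mem_univ b
    simpa using this
  exact ⟨Equiv.ofBijective v ((Fintype.bijective_iff_surjective_and_card v).2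
    ⟨hs, by simp [hc]⟩), fun _ ↦ rfl⟩

theorem IsCrit.rk_of_card_le_two (hr : IsCrit r) (hS : S.card ≤ 2) : r S = S.card := by
  have h : S.card = 0 ∨ S.card = 1 ∨ S.card = 2 := by omega
  rcases h with h | h | h
  · rw [h, card_eq_zero.1 h, hr.rank.empty]
  · obtain ⟨x, rfl⟩ := card_eq_one.1 h
    rw [hr.rk_singleton, card_singleton]
  · obtain ⟨x, y, hxy, rfl⟩ := card_eq_two.1 h
    rw [hr.rk_pair hxy, h]

theorem IsCrit.rk_of_subset_line (hr : IsCrit r) (hT : r T = 2) (hS : S ⊆ T) :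
    r S = min S.card 2 := by
  by_cases h : S.card ≤ 2
  · rw [hr.rk_of_card_le_two h, min_eq_left h]
  · obtain ⟨U, hU, hUc⟩ := exists_subset_card_eq (show 2 ≤ S.card by omega)
    have h1 := hr.rk_of_card_le_two hUc.le
    have h2 := hr.rank.mono hU
    have h3 := hr.rank.mono hS
    omega

theorem IsCrit.mem_cl_of_rk_eq_two {x y z : β} (hr : IsCrit r) (hT : r T = 2) (hx : x ∈ T)
    (hy : y ∈ T) (hz : z ∈ T) (hxy : x ≠ y) : z ∈ cl r {x, y} :=
  hr.rank.subset_cl_of_le (insert_subset hx (singleton_subset_iff.2 hy))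
    (by rw [hT, hr.rk_pair hxy]) hz

/-- Passing from `S` to the sets that occur in the rank formulas of two ends `C, T` and `D, U`. -/
theorem subset_of_pieces {n : ℕ} {C T D U R J K S : Finset (Fin n)}
    (hR : ((univ \ C ∪ T) \ D ∪ U) ⊆ R) (hJ : J ⊆ S \ C ∪ T) (hK : K ⊆ J \ D ∪ U) : K ⊆ R :=
  (hK.trans (union_subset_union_left (sdiff_subset_sdiff (hJ.trans (union_subset_union_left
    (sdiff_subset_sdiff (subset_univ S) subset_rfl))) subset_rfl))).trans hR

/-- The rank formula for ends, used twice, reduces the ranks of all sets to those of sets of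
attachments, so that the identification with the list is a finite computation. -/
theorem hasCode_puu {x y z x' y' z' h : β} (hr : IsCrit r) (h1 : PointEnd r x y z h)
    (h2 : PointEnd r x' y' z' h)
    (hu : {x, y, z} ∪ {x', y', z'} ∪ {h} = (univ : Finset β))
    (hc : r univ = 3) : HasCode r codePUU := by
  obtain ⟨e, he⟩ := exists_equiv ![x, y, z, x', y', z', h] (by
    rw [← hu]
    ext t
    simp [Fin.exists_fin_succ, eq_comm]
    try tauto) (by rw [hr.card_univ, hc])
  set ρ : Finset (Fin 7) → ℕ := fun J ↦ r (J.map e.toEmbedding) with hρ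
  have e1 : ∀ S, ρ S = pointRank ρ 0 1 2 6 S := fun S ↦ by
    rw [hρ, ← pointRank_map]
    simp only [Equiv.coe_toEmbedding, he]
    exact h1.rk_eq hr _
  have e2 : ∀ S, ρ S = pointRank ρ 3 4 5 6 S := fun S ↦ by
    rw [hρ, ← pointRank_map]
    simp only [Equiv.coe_toEmbedding, he]
    exact h2.rk_eq hr _
  have e0 : ∀ J ⊆ ({6} : Finset (Fin 7)), ρ J = J.card := fun J hJ ↦ by
    have : J.card ≤ 1 := card_le_card hJ
    rw [← card_map e.toEmbedding]
    exact hr.rk_of_card_le_two (by rw [card_map]; omega)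
  have key : ∀ S, ρ S = pointRank (pointRank card 3 4 5 6) 0 1 2 6 S := fun S ↦ by
    rw [e1]
    refine pointRank_congr fun J hJ ↦ ?_
    rw [e2]
    exact pointRank_congr fun K hK ↦ e0 K (subset_of_pieces (by decide) hJ hK)
  refine ⟨e, fun S ↦ ?_⟩
  change ρ S = _ ↔ _
  rw [key]
  revert S
  decide +kernel

theorem hasCode_puk {x y z x' y' z' a b c : β} (hr : IsCrit r) (h1 : PointEnd r x y z a)
    (h2 : TriEnd r x' y' z' a b c)
    (hu : {x, y, z} ∪ {x', y', z'} ∪ {a, b, c} = (univ : Finset β))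
    (hc : r univ = 4) : HasCode r codePUK := by
  obtain ⟨e, he⟩ := exists_equiv ![x, y, z, x', y', z', a, b, c] (by
    rw [← hu]
    ext t
    simp [Fin.exists_fin_succ, eq_comm]
    try tauto) (by rw [hr.card_univ, hc])
  set ρ : Finset (Fin 9) → ℕ := fun J ↦ r (J.map e.toEmbedding) with hρ
  have e1 : ∀ S, ρ S = pointRank ρ 0 1 2 6 S := fun S ↦ by
    rw [hρ, ← pointRank_map]
    simp only [Equiv.coe_toEmbedding, he]
    exact h1.rk_eq hr _
  have e2 : ∀ S, ρ S = triRank ρ 3 4 5 6 7 8 S := fun S ↦ by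
    rw [hρ, ← triRank_map]
    simp only [Equiv.coe_toEmbedding, he]
    exact h2.rk_eq hr _
  have hline : r ((({6, 7, 8} : Finset (Fin 9))).map e.toEmbedding) = 2 := by
    simp only [map_insert, map_singleton, Equiv.coe_toEmbedding, he]
    exact h2.rk_foot hr
  have e0 : ∀ J ⊆ ({6, 7, 8} : Finset (Fin 9)), ρ J = min J.card 2 := fun J hJ ↦ by
    rw [← card_map e.toEmbedding]
    exact hr.rk_of_subset_line hline (map_subset_map.2 hJ)
  have key : ∀ S, ρ S = pointRank (triRank (fun J ↦ min J.card 2) 3 4 5 6 7 8) 0 1 2 6 S := fun S ↦ by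
    rw [e1]
    refine pointRank_congr fun J hJ ↦ ?_
    rw [e2]
    exact triRank_congr fun K hK ↦ e0 K (subset_of_pieces (by decide) hJ hK)
  refine ⟨e, fun S ↦ ?_⟩
  change ρ S = _ ↔ _
  rw [key]
  revert S
  decide +kernel

theorem hasCode_k5e {x y z x' y' z' a b c : β} (hr : IsCrit r) (h1 : TriEnd r x y z a b c)
    (h2 : TriEnd r x' y' z' a b c)
    (hu : {x, y, z} ∪ {x', y', z'} ∪ {a, b, c} = (univ : Finset β))
    (hc : r univ = 4) : HasCode r codeK5e := by
  obtain ⟨e, he⟩ := exists_equiv ![x, y, z, x', y', z', a, b, c] (by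
    rw [← hu]
    ext t
    simp [Fin.exists_fin_succ, eq_comm]
    try tauto) (by rw [hr.card_univ, hc])
  set ρ : Finset (Fin 9) → ℕ := fun J ↦ r (J.map e.toEmbedding) with hρ
  have e1 : ∀ S, ρ S = triRank ρ 0 1 2 6 7 8 S := fun S ↦ by
    rw [hρ, ← triRank_map]
    simp only [Equiv.coe_toEmbedding, he]
    exact h1.rk_eq hr _
  have e2 : ∀ S, ρ S = triRank ρ 3 4 5 6 7 8 S := fun S ↦ by
    rw [hρ, ← triRank_map]
    simp only [Equiv.coe_toEmbedding, he]
    exact h2.rk_eq hr _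
  have hline : r ((({6, 7, 8} : Finset (Fin 9))).map e.toEmbedding) = 2 := by
    simp only [map_insert, map_singleton, Equiv.coe_toEmbedding, he]
    exact h2.rk_foot hr
  have e0 : ∀ J ⊆ ({6, 7, 8} : Finset (Fin 9)), ρ J = min J.card 2 := fun J hJ ↦ by
    rw [← card_map e.toEmbedding]
    exact hr.rk_of_subset_line hline (map_subset_map.2 hJ)
  have key : ∀ S, ρ S = triRank (triRank (fun J ↦ min J.card 2) 3 4 5 6 7 8) 0 1 2 6 7 8 S := fun S ↦ by
    rw [e1]
    refine triRank_congr fun J hJ ↦ ?_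
    rw [e2]
    exact triRank_congr fun K hK ↦ e0 K (subset_of_pieces (by decide) hJ hK)
  refine ⟨e, fun S ↦ ?_⟩
  change ρ S = _ ↔ _
  rw [key]
  revert S
  decide +kernel

/-- The rank function of two three-point lines `{6, 7, 8}` and `{6, 9, 10}` that share a point. -/
def twoLinesRank (J : Finset (Fin 11)) : ℕ :=
  if J ⊆ {6, 7, 8} ∨ J ⊆ {6, 9, 10} then min J.card 2 else min J.card 3

theorem hasCode_pkk {x y z x' y' z' a b c b' c' : β} (hr : IsCrit r) (h1 : TriEnd r x y z a b c)
    (h2 : TriEnd r x' y' z' a b' c')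
    (hu : {x, y, z} ∪ {x', y', z'} ∪ {a, b, c, b', c'} = (univ : Finset β))
    (h3 : r {a, b, c, b', c'} = 3) (hc : r univ = 5) : HasCode r codePKK := by
  obtain ⟨e, he⟩ := exists_equiv ![x, y, z, x', y', z', a, b, c, b', c'] (by
    rw [← hu]
    ext t
    simp [Fin.exists_fin_succ, eq_comm]
    try tauto) (by rw [hr.card_univ, hc])
  set ρ : Finset (Fin 11) → ℕ := fun J ↦ r (J.map e.toEmbedding) with hρ
  have e1 : ∀ S, ρ S = triRank ρ 0 1 2 6 7 8 S := fun S ↦ by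
    rw [hρ, ← triRank_map]
    simp only [Equiv.coe_toEmbedding, he]
    exact h1.rk_eq hr _
  have e2 : ∀ S, ρ S = triRank ρ 3 4 5 6 9 10 S := fun S ↦ by
    rw [hρ, ← triRank_map]
    simp only [Equiv.coe_toEmbedding, he]
    exact h2.rk_eq hr _
  have hl1 : r ((({6, 7, 8} : Finset (Fin 11))).map e.toEmbedding) = 2 := by
    simp only [map_insert, map_singleton, Equiv.coe_toEmbedding, he]
    exact h1.rk_foot hr
  have hl2 : r ((({6, 9, 10} : Finset (Fin 11))).map e.toEmbedding) = 2 := by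
    simp only [map_insert, map_singleton, Equiv.coe_toEmbedding, he]
    exact h2.rk_foot hr
  have hl3 : r ((({6, 7, 8, 9, 10} : Finset (Fin 11))).map e.toEmbedding) = 3 := by
    simp only [map_insert, map_singleton, Equiv.coe_toEmbedding, he]
    exact h3
  have e0 : ∀ J ⊆ ({6, 7, 8, 9, 10} : Finset (Fin 11)), ρ J = twoLinesRank J := fun J hJ ↦ by
    unfold twoLinesRank
    split_ifs with hJl
    · rw [← card_map e.toEmbedding]
      rcases hJl with hJ | hJ
      · exact hr.rk_of_subset_line hl1 (map_subset_map.2 hJ)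
      · exact hr.rk_of_subset_line hl2 (map_subset_map.2 hJ)
    · rw [← card_map e.toEmbedding]
      by_cases hJ2 : J.card ≤ 2
      · rw [min_eq_left (by rw [card_map]; omega)]
        exact hr.rk_of_card_le_two (by rwa [card_map])
      · rw [min_eq_right (by rw [card_map]; omega)]
        refine le_antisymm (hl3 ▸ hr.rank.mono (map_subset_map.2 hJ)) ?_
        -- two points of one line and one of the other line span everything
        by_contra! hlt
        rw [← hl3] at hlt
        refine absurd (hr.rank.rk_le_of_subset_cl (S := J.map e.toEmbedding)
          (T := (({6, 7, 8, 9, 10} : Finset (Fin 11))).map e.toEmbedding) ?_) (not_le.2 hlt)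
        have fill : ∀ L : Finset (Fin 11), r (L.map e.toEmbedding) = 2 → ∀ i ∈ L, ∀ j ∈ L, i ≠ j →
            e i ∈ cl r (J.map e.toEmbedding) → e j ∈ cl r (J.map e.toEmbedding) →
            ∀ k ∈ L, e k ∈ cl r (J.map e.toEmbedding) := fun L hL i hi j hj hij hi' hj' k hk ↦
          hr.rank.cl_pair_mono hi' hj' (hr.mem_cl_of_rk_eq_two hL (mem_map_of_mem _ hi)
            (mem_map_of_mem _ hj) (mem_map_of_mem _ hk) (fun h ↦ hij (e.injective h)))
        have hmem : ∀ i ∈ J, e i ∈ cl r (J.map e.toEmbedding) :=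
          fun i hi ↦ subset_cl (mem_map_of_mem e.toEmbedding hi)
        have hcases : (∃ i ∈ J ∩ {6, 7, 8}, ∃ j ∈ J ∩ {6, 7, 8}, i ≠ j ∧ ∃ k ∈ J, k ∈ ({9, 10} : Finset (Fin 11))) ∨
            (∃ i ∈ J ∩ {6, 9, 10}, ∃ j ∈ J ∩ {6, 9, 10}, i ≠ j ∧ ∃ k ∈ J, k ∈ ({7, 8} : Finset (Fin 11))) := by
          rw [← mem_powerset] at hJ
          clear * - hJ hJ2 hJl
          revert J
          decide +kernel
        have h678 : (∀ k ∈ ({6, 7, 8} : Finset (Fin 11)), e k ∈ cl r (J.map e.toEmbedding)) ∧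
            ∀ k ∈ ({6, 9, 10} : Finset (Fin 11)), e k ∈ cl r (J.map e.toEmbedding) := by
          rcases hcases with ⟨i, hi, j, hj, hij, k, hk, hk'⟩ | ⟨i, hi, j, hj, hij, k, hk, hk'⟩
          · rw [mem_inter] at hi hj
            have hA := fill _ hl1 i hi.2 j hj.2 hij (hmem _ hi.1) (hmem _ hj.1)
            refine ⟨hA, fill _ hl2 6 (by simp) k (by simp at hk' ⊢; tauto) ?_ (hA 6 (by simp))
              (hmem k hk)⟩
            rintro rfl; simp at hk'
          · rw [mem_inter] at hi hj
            have hA := fill _ hl2 i hi.2 j hj.2 hij (hmem _ hi.1) (hmem _ hj.1)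
            refine ⟨fill _ hl1 6 (by simp) k (by simp at hk' ⊢; tauto) ?_ (hA 6 (by simp))
              (hmem k hk), hA⟩
            rintro rfl; simp at hk'
        intro t ht
        obtain ⟨k, hk, rfl⟩ := mem_map.1 ht
        rw [show ({6, 7, 8, 9, 10} : Finset (Fin 11)) = {6, 7, 8} ∪ {6, 9, 10} by decide,
          mem_union] at hk
        exact hk.elim (h678.1 k) (h678.2 k)
  have key : ∀ S, ρ S = triRank (triRank twoLinesRank 3 4 5 6 9 10) 0 1 2 6 7 8 S := fun S ↦ by
    rw [e1]
    refine triRank_congr fun J hJ ↦ ?_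
    rw [e2]
    exact triRank_congr fun K hK ↦ e0 K (subset_of_pieces (by decide) hJ hK)
  refine ⟨e, fun S ↦ ?_⟩
  change ρ S = _ ↔ _
  rw [key]
  revert S
  decide +kernel

theorem hasCode_o7 {x y z a b c g : β} (hr : IsCrit r) (h1 : TriEnd r x y z a b c)
    (hu : {x, y, z} ∪ {a, b, c, g} = (univ : Finset β)) (h2 : r {a, b, c, g} = 2)
    (hc : r univ = 3) : HasCode r codeO7 := by
  obtain ⟨e, he⟩ := exists_equiv ![c, a, b, g, x, y, z] (by
    rw [← hu]
    ext t
    simp [Fin.exists_fin_succ, eq_comm]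
    try tauto) (by rw [hr.card_univ, hc])
  set ρ : Finset (Fin 7) → ℕ := fun J ↦ r (J.map e.toEmbedding) with hρ
  have e1 : ∀ S, ρ S = triRank ρ 4 5 6 1 2 0 S := fun S ↦ by
    rw [hρ, ← triRank_map]
    simp only [Equiv.coe_toEmbedding, he]
    exact h1.rk_eq hr _
  have hline : r ((({1, 2, 0, 3} : Finset (Fin 7))).map e.toEmbedding) = 2 := by
    simp only [map_insert, map_singleton, Equiv.coe_toEmbedding, he]
    exact h2
  have e0 : ∀ J ⊆ ({1, 2, 0, 3} : Finset (Fin 7)), ρ J = min J.card 2 := fun J hJ ↦ by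
    rw [← card_map e.toEmbedding]
    exact hr.rk_of_subset_line hline (map_subset_map.2 hJ)
  have key : ∀ S, ρ S = triRank (fun J ↦ min J.card 2) 4 5 6 1 2 0 S := fun S ↦ by
    rw [e1]
    refine triRank_congr fun J hJ ↦ e0 J (hJ.trans ((union_subset_union_left
      (sdiff_subset_sdiff (subset_univ S) subset_rfl)).trans (by decide)))
  refine ⟨e, fun S ↦ ?_⟩
  change ρ S = _ ↔ _
  rw [key]
  revert S
  decide +kernel

end

/-! ### Critical matroids with a tight flat -/

section

variable {β : Type*} [DecidableEq β] [Fintype β] {r : Finset β → ℕ} {C D T U F : Finset β}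
  {x y z x' y' z' a b c a' b' c' h h' w : β}

theorem TriEnd.exists_rotate (hr : IsCrit r) (hT : TriEnd r x y z a b c)
    (hw : w ∈ ({a, b, c} : Finset β)) :
    ∃ x' y' z' b' c', ({x', y', z'} : Finset β) = {x, y, z} ∧
      ({w, b', c'} : Finset β) = {a, b, c} ∧ TriEnd r x' y' z' w b' c' := by
  simp only [mem_insert, mem_singleton] at hw
  rcases hw with rfl | rfl | rfl
  · exact ⟨x, y, z, b, c, rfl, rfl, hT⟩
  · refine ⟨y, z, x, c, a, ?_, ?_, hT.rotate hr⟩ <;>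
      (ext; simp only [mem_insert, mem_singleton]; tauto)
  · refine ⟨z, x, y, a, b, ?_, ?_, (hT.rotate hr).rotate hr⟩ <;>
      (ext; simp only [mem_insert, mem_singleton]; tauto)

/-- In rank three an end attached along a line leaves one further point, on this line. -/
theorem TriEnd.hasCode_o7 (hr : IsCrit r) (hT : TriEnd r x y z a b c) (hu : r univ = 3) :
    HasCode r codeO7 := by
  have hE := hT.isEnd hr
  have hc := hr.card_univ
  have hcc := card_add_card_compl ({x, y, z} : Finset β)
  rw [hE.card] at hcc
  have hne := hT.foot_ne hr
  have hTc : ({a, b, c} : Finset β).card = 3 :=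
    card_eq_three.2 ⟨a, b, c, hne.1, hne.2.1, hne.2.2, rfl⟩
  have hsub : ({a, b, c} : Finset β) ⊆ ({x, y, z} : Finset β)ᶜ :=
    subset_compl_iff_disjoint_left.2 hE.disj
  obtain ⟨g, hg⟩ := card_eq_one.1 (show (({x, y, z} : Finset β)ᶜ \ {a, b, c}).card = 1 by
    rw [card_sdiff_of_subset hsub]; omega)
  have hset : ({x, y, z} : Finset β)ᶜ = {a, b, c, g} := by
    rw [← sdiff_union_of_subset hsub, hg]
    ext; simp only [mem_union, mem_insert, mem_singleton]; tauto
  refine MatroidCover.hasCode_o7 (g := g) hr hT (by rw [← hset, union_compl]) ?_ hu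
  have h1 := hE.rk_insert hr.rank (x := x) (by simp) (S := ({x, y, z} : Finset β)ᶜ)
    disjoint_compl_right
  have h2 := hr.rank.mono (subset_univ (insert x ({x, y, z} : Finset β)ᶜ))
  have h3 := hr.rank.mono (show ({a, b, c} : Finset β) ⊆ ({x, y, z} : Finset β)ᶜ from hsub)
  rw [hT.rk_foot hr] at h3
  rw [← hset]
  omega

/-- The set `C` is the complement of a tight hyperplane, and it is attached to this hyperplane
along `T`, as in `PointEnd` or `TriEnd`. -/
def HasEnd (r : Finset β → ℕ) (C T : Finset β) : Prop :=
  (∃ x y z h, C = {x, y, z} ∧ T = {h} ∧ PointEnd r x y z h) ∨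
    ∃ x y z a b c, C = {x, y, z} ∧ T = {a, b, c} ∧ TriEnd r x y z a b c

theorem HasEnd.isEnd (hr : IsCrit r) (h : HasEnd r C T) : IsEnd r C T := by
  rcases h with ⟨x, y, z, h, rfl, rfl, h'⟩ | ⟨x, y, z, a, b, c, rfl, rfl, h'⟩
  · exact h'.isEnd hr
  · exact h'.isEnd hr

theorem HasEnd.foot_subset_cl (hr : IsRank r) (h : HasEnd r C T) : T ⊆ cl r C := by
  rcases h with ⟨x, y, z, h, rfl, rfl, h'⟩ | ⟨x, y, z, a, b, c, rfl, rfl, h'⟩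
  · rw [singleton_subset_iff]
    exact hr.cl_pair_mono (subset_cl (by simp)) (subset_cl (by simp)) h'.line.2
  · have mx : x ∈ cl r {x, y, z} := subset_cl (by simp)
    have my : y ∈ cl r {x, y, z} := subset_cl (by simp)
    have mz : z ∈ cl r {x, y, z} := subset_cl (by simp)
    exact insert_subset (hr.cl_pair_mono my mz h'.line.1) (insert_subset
      (hr.cl_pair_mono mx mz h'.line.2.1) (singleton_subset_iff.2
        (hr.cl_pair_mono mx my h'.line.2.2)))

theorem hasCode_of_pointEnd_triEnd (hr : IsCrit r) (h1 : PointEnd r x y z h)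
    (h2 : TriEnd r x' y' z' a b c)
    (hu : {x, y, z} ∪ {x', y', z'} ∪ ({h} ∪ {a, b, c}) = (univ : Finset β))
    (hle : r ({h} ∪ {a, b, c}) + 1 ≤ r {h} + r {a, b, c}) (hc : r univ = r ({h} ∪ {a, b, c}) + 2)
    (hcard : ({h} ∪ {a, b, c} : Finset β).card + 1 = 2 * r ({h} ∪ {a, b, c})) :
    HasCode r codePUK := by
  have hne := h2.foot_ne hr
  have hTc : ({a, b, c} : Finset β).card = 3 :=
    card_eq_three.2 ⟨a, b, c, hne.1, hne.2.1, hne.2.2, rfl⟩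
  have h3 := h2.rk_foot hr
  rw [hr.rk_singleton, h3] at hle
  have h4 : ({a, b, c} : Finset β) = {h} ∪ {a, b, c} :=
    eq_of_subset_of_card_le subset_union_right (by omega)
  rw [← h4] at hu hc
  obtain ⟨x₁, y₁, z₁, b₁, c₁, e1, e2, h2'⟩ := h2.exists_rotate hr
    (w := h) (by rw [h4]; simp)
  rw [← e1, ← e2] at hu
  exact hasCode_puk hr h1 h2' hu (by omega)

theorem hasCode_of_pointEnd_pointEnd (hr : IsCrit r) (h1 : PointEnd r x y z h)
    (h2 : PointEnd r x' y' z' h')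
    (hu : {x, y, z} ∪ {x', y', z'} ∪ ({h} ∪ {h'}) = (univ : Finset β))
    (hle : r ({h} ∪ {h'}) + 1 ≤ r {h} + r {h'}) (hc : r univ = r ({h} ∪ {h'}) + 2) :
    HasCode r codePUU := by
  rw [hr.rk_singleton, hr.rk_singleton] at hle
  have hh : h = h' := by
    by_contra hne
    have := hr.rk_pair hne
    rw [singleton_union] at hle
    omega
  subst hh
  rw [union_self] at hu hc
  exact hasCode_puu hr h1 h2 hu (by rw [hc, hr.rk_singleton])

theorem hasCode_of_triEnd_triEnd (hr : IsCrit r) (h1 : TriEnd r x y z a b c)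
    (h2 : TriEnd r x' y' z' a' b' c')
    (hu : {x, y, z} ∪ {x', y', z'} ∪ ({a, b, c} ∪ {a', b', c'}) = (univ : Finset β))
    (hle : r ({a, b, c} ∪ {a', b', c'}) + 1 ≤ r {a, b, c} + r {a', b', c'})
    (hc : r univ = r ({a, b, c} ∪ {a', b', c'}) + 2)
    (hcard : ({a, b, c} ∪ {a', b', c'} : Finset β).card + 1 =
      2 * r ({a, b, c} ∪ {a', b', c'})) :
    HasCode r codeK5e ∨ HasCode r codePKK := by
  have r1 := h1.rk_foot hr
  have r2 := h2.rk_foot hr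
  have hne := h1.foot_ne hr
  have hne' := h2.foot_ne hr
  have c1 : ({a, b, c} : Finset β).card = 3 :=
    card_eq_three.2 ⟨a, b, c, hne.1, hne.2.1, hne.2.2, rfl⟩
  have c2 : ({a', b', c'} : Finset β).card = 3 :=
    card_eq_three.2 ⟨a', b', c', hne'.1, hne'.2.1, hne'.2.2, rfl⟩
  have h3 := hr.rank.mono (show ({a, b, c} : Finset β) ⊆ {a, b, c} ∪ {a', b', c'} from
    subset_union_left)
  have hcases : r ({a, b, c} ∪ {a', b', c'}) = 2 ∨ r ({a, b, c} ∪ {a', b', c'}) = 3 := by omega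
  rcases hcases with hU | hU
  · left
    have e1 : ({a, b, c} : Finset β) = {a, b, c} ∪ {a', b', c'} :=
      eq_of_subset_of_card_le subset_union_left (by omega)
    have e2 : ({a', b', c'} : Finset β) = {a, b, c} ∪ {a', b', c'} :=
      eq_of_subset_of_card_le subset_union_right (by omega)
    rw [← e1] at hu
    obtain ⟨x₁, y₁, z₁, b₁, c₁, s1, s2, h2'⟩ := h2.exists_rotate hr
      (w := a) (by rw [e2, ← e1]; simp)
    rw [← s1] at hu
    have s3 : ({a, b₁, c₁} : Finset β) = {a, b, c} := by rw [s2, e2, ← e1]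
    have hne'' := h2'.foot_ne hr
    have hb : b ∈ ({a, b₁, c₁} : Finset β) := by rw [s3]; simp
    have hcc : c ∈ ({a, b₁, c₁} : Finset β) := by rw [s3]; simp
    have hbc : (b₁ = b ∧ c₁ = c) ∨ (b₁ = c ∧ c₁ = b) := by
      simp only [mem_insert, mem_singleton] at hb hcc
      clear * - hb hcc hne hne''
      grind
    rcases hbc with ⟨rfl, rfl⟩ | ⟨rfl, rfl⟩
    · exact hasCode_k5e hr h1 h2' hu (by omega)
    · refine hasCode_k5e hr h1 (h2'.swap hr) ?_ (by omega)
      rw [← hu]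
      congr 2
      ext; simp only [mem_insert, mem_singleton]; tauto
  · right
    have hci := card_union_add_card_inter ({a, b, c} : Finset β) {a', b', c'}
    obtain ⟨w, hw⟩ : ({a, b, c} ∩ {a', b', c'} : Finset β).Nonempty := card_pos.1 (by omega)
    rw [mem_inter] at hw
    obtain ⟨x₁, y₁, z₁, b₁, c₁, s1, s2, h1'⟩ := h1.exists_rotate hr hw.1
    obtain ⟨x₂, y₂, z₂, b₂, c₂, s3, s4, h2'⟩ := h2.exists_rotate hr hw.2
    have e : ({w, b₁, c₁, b₂, c₂} : Finset β) = {a, b, c} ∪ {a', b', c'} := by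
      rw [← s2, ← s4]
      ext; simp only [mem_union, mem_insert, mem_singleton]; tauto
    refine hasCode_pkk hr h1' h2' ?_ (by rw [e, hU]) (by omega)
    rw [s1, s3, e, hu]

/-- Two disjoint ends determine a critical matroid. -/
theorem IsCrit.hasCode_of_ends (hr : IsCrit r) (h1 : HasEnd r C T) (h2 : HasEnd r D U)
    (hCD : Disjoint C D) (hCU : Disjoint C U) (hDT : Disjoint D T) :
    ∃ c ∈ tenCodes, HasCode r c.2 := by
  obtain ⟨hu, hle, hc, hcard⟩ := hr.link (h1.isEnd hr) (h2.isEnd hr) hCD hCU hDT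
  rcases h1 with ⟨x, y, z, h, rfl, rfl, h1⟩ | ⟨x, y, z, a, b, c, rfl, rfl, h1⟩ <;>
    rcases h2 with ⟨x', y', z', h', rfl, rfl, h2⟩ | ⟨x', y', z', a', b', c', rfl, rfl, h2⟩
  · exact ⟨⟨_, codePUU⟩, by simp [tenCodes], hasCode_of_pointEnd_pointEnd hr h1 h2 hu hle hc⟩
  · exact ⟨⟨_, codePUK⟩, by simp [tenCodes],
      hasCode_of_pointEnd_triEnd hr h1 h2 hu hle hc hcard⟩
  · rw [union_comm {a, b, c}] at hle hc hcard hu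
    rw [union_comm {x, y, z}] at hu
    rw [add_comm (r {a, b, c})] at hle
    exact ⟨⟨_, codePUK⟩, by simp [tenCodes],
      hasCode_of_pointEnd_triEnd hr h2 h1 hu hle hc hcard⟩
  · rcases hasCode_of_triEnd_triEnd hr h1 h2 hu hle hc hcard with h | h
    · exact ⟨⟨_, codeK5e⟩, by simp [tenCodes], h⟩
    · exact ⟨⟨_, codePKK⟩, by simp [tenCodes], h⟩

/-- A tight flat that contains an end lies in a tight hyperplane, whose complement is a second
end. -/
theorem IsCrit.hasCode_of_end (hr : IsCrit r) (h1 : HasEnd r C T) (hF : C ∪ T ⊆ F)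
    (hcl : cl r F = F) (hne : F ≠ univ) (ht : F.card = 2 * r F) :
    ∃ c ∈ tenCodes, HasCode r c.2 := by
  have hE := h1.isEnd hr
  obtain ⟨p, hp⟩ : C.Nonempty := card_pos.1 (by rw [hE.card]; omega)
  obtain ⟨H, hFH, hHcl, hHne, hHt, hHr⟩ := hr.exists_tight_hyperplane
    ⟨p, hF (mem_union_left _ hp)⟩ hcl hne ht
  obtain ⟨x, y, z, hset, hend⟩ := hr.exists_end hHcl hHt hHr
  have h2 : ∃ U, HasEnd r Hᶜ U := by
    rcases hend with ⟨h, h2⟩ | ⟨a, b, c, h2⟩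
    · exact ⟨{h}, Or.inl ⟨x, y, z, h, hset, rfl, h2⟩⟩
    · exact ⟨{a, b, c}, Or.inr ⟨x, y, z, a, b, c, hset, rfl, h2⟩⟩
  obtain ⟨U, h2⟩ := h2
  have hCH : C ⊆ H := (subset_union_left.trans hF).trans hFH
  have hTH : T ⊆ H := (subset_union_right.trans hF).trans hFH
  refine hr.hasCode_of_ends h1 h2 (disjoint_compl_right.mono_left hCH) ?_
    (disjoint_compl_left.mono_right hTH)
  rw [disjoint_left]
  exact fun t ht htU ↦ hE.notMem t ht
    (hr.rank.cl_mono (compl_subset_compl.2 hCH) (h2.foot_subset_cl hr.rank htU))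

/-- A critical matroid with a tight proper flat is one of the ten matroids. -/
theorem IsCrit.hasCode_of_tight (hr : IsCrit r) (hF : F.Nonempty) (hcl : cl r F = F)
    (hne : F ≠ univ) (ht : F.card = 2 * r F) : ∃ c ∈ tenCodes, HasCode r c.2 := by
  obtain ⟨H, hFH, hHcl, hHne, hHt, hHr⟩ := hr.exists_tight_hyperplane hF hcl hne ht
  obtain ⟨x, y, z, hset, hend⟩ := hr.exists_end hHcl hHt hHr
  have hHpos := card_pos.2 (hF.mono hFH)
  rcases hend with ⟨h, h1⟩ | ⟨a, b, c, h1⟩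
  · have h3 : 3 ≤ r univ := by
      by_contra! hcon
      have := hr.rk_of_card_le_two (S := H) (by omega)
      omega
    have hrK : r (cl r {x, y}) = 2 := by rw [hr.rank.rk_cl, hr.rk_pair h1.ne.1]
    have hsub : {x, y, z} ∪ {h} ⊆ cl r {x, y} := by
      intro t ht
      simp only [mem_union, mem_insert, mem_singleton] at ht
      rcases ht with (rfl | rfl | rfl) | rfl
      exacts [left_mem_cl, right_mem_cl, h1.line.1, h1.line.2]
    have hE := h1.isEnd hr
    have hne' : cl r {x, y} ≠ univ := fun h ↦ by rw [h] at hrK; omega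
    have hcard := card_le_card hsub
    rw [card_union_of_disjoint hE.disj, hE.card, card_singleton] at hcard
    have := hr.restr _ hne'
    exact hr.hasCode_of_end (Or.inl ⟨x, y, z, h, rfl, rfl, h1⟩) hsub (hr.rank.cl_cl _) hne' (by omega)
  · by_cases h3 : r univ = 3
    · exact ⟨⟨_, codeO7⟩, by simp [tenCodes], h1.hasCode_o7 hr h3⟩
    have h4 : r {z, x, y} = 3 := by
      rw [hr.rank.rk_insert h1.plane, hr.rk_pair h1.ne.1]
    have hxyz : ({z, x, y} : Finset β) = {x, y, z} := by
      ext; simp only [mem_insert, mem_singleton]; tauto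
    rw [hxyz] at h4
    have h5 := hr.rank.mono (subset_univ ({x, y, z} : Finset β))
    have hrK : r (cl r {x, y, z}) = 3 := by rw [hr.rank.rk_cl, h4]
    have hsub : {x, y, z} ∪ {a, b, c} ⊆ cl r {x, y, z} :=
      union_subset subset_cl ((HasEnd.foot_subset_cl hr.rank (Or.inr ⟨x, y, z, a, b, c, rfl, rfl, h1⟩)))
    have hE := h1.isEnd hr
    have hfoot := h1.foot_ne hr
    have hne' : cl r {x, y, z} ≠ univ := fun h ↦ by rw [h] at hrK; omega
    have hcard := card_le_card hsub
    rw [card_union_of_disjoint hE.disj, hE.card,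
      card_eq_three.2 ⟨a, b, c, hfoot.1, hfoot.2.1, hfoot.2.2, rfl⟩] at hcard
    have := hr.restr _ hne'
    exact hr.hasCode_of_end (Or.inr ⟨x, y, z, a, b, c, rfl, rfl, h1⟩) hsub (hr.rank.cl_cl _) hne'
      (by omega)

end

/-! ### Critical matroids without tight flats, of rank at most three -/

section

variable {β : Type*} [DecidableEq β] [Fintype β] {r : Finset β → ℕ} {S T F : Finset β}

theorem IsCrit.hasCode_u25 (hr : IsCrit r) (hu : r univ = 2) : HasCode r codeU25 := by
  have hc := hr.card_univ
  obtain ⟨e⟩ := Fintype.card_eq.1 (show Fintype.card (Fin 5) = Fintype.card β by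
    rw [hc, hu]; rfl)
  refine ⟨e, fun S ↦ ?_⟩
  have hS : CodeIndep codeU25 S ↔ S.card ≤ 2 := by simp [CodeIndep, codeU25]
  rw [hS]
  refine ⟨fun h ↦ ?_, fun h ↦ ?_⟩
  · rw [← h, ← hu]
    exact hr.rank.mono (subset_univ _)
  · rw [hr.rk_of_card_le_two (by rwa [card_map]), card_map]

theorem IsCrit.two_le_rk (hr : IsCrit r) : 2 ≤ r univ := by
  have hc := hr.card_univ
  by_contra! hcon
  obtain ⟨x⟩ : Nonempty β := Fintype.card_pos_iff.1 (by omega)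
  have h1 := hr.rank.mono (subset_univ {x})
  rw [hr.rk_singleton] at h1
  have : Nontrivial β := Fintype.one_lt_card_iff_nontrivial.1 (by omega)
  obtain ⟨y, hy⟩ := exists_ne x
  have h2 := hr.rank.mono (subset_univ {y, x})
  rw [hr.rk_pair hy] at h2
  omega

/-- If there are no tight flats, then sets of less than full rank are not tight. -/
theorem IsCrit.card_lt (hr : IsCrit r)
    (hnt : ∀ F, F.Nonempty → cl r F = F → F ≠ univ → F.card ≠ 2 * r F) (hT : T.Nonempty)
    (h : r T < r univ) : T.card < 2 * r T := by
  have h0 := hr.rank.rk_cl (S := T)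
  have hne : cl r T ≠ univ := fun h' ↦ by rw [h'] at h0; omega
  have h1 := hnt (cl r T) (hT.mono subset_cl) (hr.rank.cl_cl T) hne
  have h2 := hr.restr _ hne
  have h3 := card_le_card (subset_cl (r := r) (S := T))
  omega

/-- Two three-point lines with two common points coincide. -/
theorem IsCrit.line_eq (hr : IsCrit r) (hl : ∀ T, r T = 2 → T.card ≤ 3) (hS : S.card = 3)
    (hS2 : r S = 2) (hT : T.card = 3) (hT2 : r T = 2) (h : 2 ≤ (S ∩ T).card) : S = T := by
  have h1 := hr.rank.submod S T
  have h2 := hr.rk_of_subset_line hS2 (inter_subset_left : S ∩ T ⊆ S)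
  have h3 := hr.rank.mono (subset_union_left : S ⊆ S ∪ T)
  have h4 := hl (S ∪ T) (by omega)
  have h5 : S = S ∪ T := eq_of_subset_of_card_le subset_union_left (by omega)
  have h6 : T = S ∪ T := eq_of_subset_of_card_le subset_union_right (by omega)
  rw [h5, ← h6]

/-- A matroid of rank three with seven points all of whose lines have at most three points is
described by a list of three-point lines if every further triple of points meets one of these in two
points or is independent. -/
theorem IsCrit.hasCode_of_lines (hr : IsCrit r) (hl : ∀ T, r T = 2 → T.card ≤ 3)
    (hu : r univ = 3) (e : Fin 7 ≃ β) {L : List (Finset (Fin 7))}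
    (hL : ∀ l ∈ L, l.card = 3 ∧ r (l.map e.toEmbedding) = 2)
    (hcov : ∀ S : Finset (Fin 7), S.card = 3 → S ∉ L → (∃ l ∈ L, 2 ≤ (S ∩ l).card) ∨
      r (S.map e.toEmbedding) ≠ 2) :
    HasCode r (L.map (fun l ↦ (l, 2)) ++ [(univ, 3)]) := by
  refine ⟨e, fun S ↦ ?_⟩
  have hS : CodeIndep (L.map (fun l ↦ (l, 2)) ++ [(univ, 3)]) S ↔
      (∀ l ∈ L, (S ∩ l).card ≤ 2) ∧ S.card ≤ 3 := by
    simp only [CodeIndep, List.mem_append, List.mem_map, List.mem_singleton]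
    constructor
    · intro h
      exact ⟨fun l hl ↦ h (l, 2) (Or.inl ⟨l, hl, rfl⟩), by simpa using h (univ, 3) (Or.inr rfl)⟩
    · rintro ⟨h, h'⟩ q (⟨l, hl, rfl⟩ | rfl)
      · exact h l hl
      · simpa using h'
  rw [hS]
  constructor
  · intro h
    refine ⟨fun l hlL ↦ ?_, ?_⟩
    · have h1 : (S ∩ l).map e.toEmbedding ⊆ S.map e.toEmbedding := map_subset_map.2 inter_subset_left
      have h2 := hr.rank.subset_of_indep h1 (by rw [h, card_map])
      have h3 := hr.rank.mono ((map_subset_map (f := e.toEmbedding)).2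
        (inter_subset_right : S ∩ l ⊆ l))
      rw [card_map] at h2
      have := (hL l hlL).2
      omega
    · rw [← h, ← hu]
      exact hr.rank.mono (subset_univ _)
  · rintro ⟨h, h'⟩
    by_cases hc : S.card ≤ 2
    · rw [hr.rk_of_card_le_two (by rwa [card_map]), card_map]
    have hSL : S ∉ L := fun hmem ↦ by
      have := h S hmem
      rw [inter_self] at this
      omega
    have h2 : r (S.map e.toEmbedding) ≠ 2 := by
      rcases hcov S (by omega) hSL with ⟨l, hlL, h1⟩ | h1
      · intro h2
        have h3 := hr.line_eq hl (by rw [card_map]; omega) h2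
          (by rw [card_map, (hL l hlL).1]) (hL l hlL).2 (by rw [← map_inter, card_map]; exact h1)
        rw [map_inj] at h3
        exact hSL (h3 ▸ hlL)
      · exact h1
    obtain ⟨U, hU, hUc⟩ := exists_subset_card_eq (show 2 ≤ S.card by omega)
    have h4 := hr.rk_of_card_le_two (S := U.map e.toEmbedding) (by rw [card_map, hUc])
    have h5 := hr.rank.mono ((map_subset_map (f := e.toEmbedding)).2 hU)
    have h6 := hr.rank.rk_le_card (S.map e.toEmbedding)
    rw [card_map] at h4 h6
    omega

/-- The three-point lines through the point `6` in the standard labelling. -/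
def Spokes (r : Finset β → ℕ) (e : Fin 7 ≃ β) : Prop :=
  r (({6, 0, 3} : Finset (Fin 7)).map e.toEmbedding) = 2 ∧
    r (({6, 1, 4} : Finset (Fin 7)).map e.toEmbedding) = 2 ∧
    r (({6, 2, 5} : Finset (Fin 7)).map e.toEmbedding) = 2

/-- Two disjoint lines that avoid the point `6`. -/
theorem hasCode_p7 {e : Fin 7 ≃ β} (hr : IsCrit r) (hl : ∀ T, r T = 2 → T.card ≤ 3)
    (hu : r univ = 3) (he : Spokes r e)
    (h1 : r (({0, 1, 2} : Finset (Fin 7)).map e.toEmbedding) = 2)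
    (h2 : r (({3, 4, 5} : Finset (Fin 7)).map e.toEmbedding) = 2) : HasCode r codeP7 := by
  refine hr.hasCode_of_lines hl hu e
    (L := [{0, 1, 2}, {3, 4, 5}, {6, 0, 3}, {6, 1, 4}, {6, 2, 5}]) ?_ ?_
  · simp only [List.forall_mem_cons, List.not_mem_nil, false_imp_iff, implies_true,
      and_true, h1, h2, he.1, he.2.1, he.2.2]
    decide
  · exact fun S hS hSL ↦ Or.inl (by revert S; decide +kernel)

/-- The two matroids differ in whether the points `1, 3, 5` are collinear. -/
theorem hasCode_fano_or_nonFano {e : Fin 7 ≃ β} (hr : IsCrit r)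
    (hl : ∀ T, r T = 2 → T.card ≤ 3) (hu : r univ = 3) (he : Spokes r e)
    (h1 : r (({0, 1, 2} : Finset (Fin 7)).map e.toEmbedding) = 2)
    (h2 : r (({2, 3, 4} : Finset (Fin 7)).map e.toEmbedding) = 2)
    (h3 : r (({0, 4, 5} : Finset (Fin 7)).map e.toEmbedding) = 2) :
    HasCode r codeFano ∨ HasCode r codeNonFano := by
  by_cases h4 : r (({1, 3, 5} : Finset (Fin 7)).map e.toEmbedding) = 2
  · left
    refine hr.hasCode_of_lines hl hu e
      (L := [{0, 1, 2}, {2, 3, 4}, {0, 4, 5}, {0, 3, 6}, {1, 4, 6}, {2, 5, 6}, {1, 3, 5}]) ?_ ?_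
    · rw [show ({0, 3, 6} : Finset (Fin 7)) = {6, 0, 3} by decide,
        show ({1, 4, 6} : Finset (Fin 7)) = {6, 1, 4} by decide,
        show ({2, 5, 6} : Finset (Fin 7)) = {6, 2, 5} by decide]
      simp only [List.forall_mem_cons, List.not_mem_nil, false_imp_iff, implies_true,
      and_true, h1, h2, h3, h4, he.1, he.2.1, he.2.2]
      decide
    · exact fun S hS hSL ↦ Or.inl (by revert S; decide +kernel)
  · right
    refine hr.hasCode_of_lines hl hu e
      (L := [{0, 1, 2}, {2, 3, 4}, {0, 4, 5}, {0, 3, 6}, {1, 4, 6}, {2, 5, 6}]) ?_ ?_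
    · rw [show ({0, 3, 6} : Finset (Fin 7)) = {6, 0, 3} by decide,
        show ({1, 4, 6} : Finset (Fin 7)) = {6, 1, 4} by decide,
        show ({2, 5, 6} : Finset (Fin 7)) = {6, 2, 5} by decide]
      simp only [List.forall_mem_cons, List.not_mem_nil, false_imp_iff, implies_true,
      and_true, h1, h2, h3, he.1, he.2.1, he.2.2]
      decide
    · intro S hS hSL
      by_cases hS' : S = {1, 3, 5}
      · exact Or.inr (hS' ▸ h4)
      · exact Or.inl (by revert S; decide +kernel)

theorem IsCrit.exists_two_lines (hr : IsCrit r) (x : β) :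
    2 ≤ (univ.filter fun l : Finset β ↦ (l.card = 3 ∧ r l = 2) ∧ x ∈ l).card := by
  obtain ⟨a, b, c, d, hab, hcd, ha, hb, hc, hd, hbc, hbd, h1, h2⟩ := hr.exists_two_triangles x
  refine one_lt_card.2 ⟨{b, a, x}, ?_, {d, c, x}, ?_, fun h ↦ ?_⟩
  · rw [mem_cl, hr.rk_pair ha] at h1
    simp [h1, card_eq_three.2 ⟨b, a, x, hab.symm, hb, ha, rfl⟩]
  · rw [mem_cl, hr.rk_pair hc] at h2
    simp [h2, card_eq_three.2 ⟨d, c, x, hcd.symm, hd, hc, rfl⟩]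
  · have : b ∈ ({d, c, x} : Finset β) := h ▸ mem_insert_self _ _
    simp only [mem_insert, mem_singleton] at this
    tauto

/-- Seven points, each on at least two three-point lines: some point is on at least three lines,
since the number of incidences is divisible by three. -/
theorem IsCrit.exists_three_lines (hr : IsCrit r) (hu : r univ = 3) :
    ∃ x, 2 < (univ.filter fun l : Finset β ↦ (l.card = 3 ∧ r l = 2) ∧ x ∈ l).card := by
  by_contra! hcon
  have hc := hr.card_univ
  have h1 : ∀ x : β, (univ.filter fun l : Finset β ↦ (l.card = 3 ∧ r l = 2) ∧ x ∈ l).card = 2 :=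
    fun x ↦ le_antisymm (hcon x) (hr.exists_two_lines x)
  have h2 := sum_card_bipartiteAbove_eq_sum_card_bipartiteBelow (fun (x : β) (l : Finset β) ↦ x ∈ l)
    (s := univ) (t := univ.filter fun l : Finset β ↦ l.card = 3 ∧ r l = 2)
  have h3 : ∑ l ∈ univ.filter (fun l : Finset β ↦ l.card = 3 ∧ r l = 2), l.card =
      ∑ l ∈ univ.filter (fun l : Finset β ↦ l.card = 3 ∧ r l = 2), 3 :=
    sum_congr rfl fun l hl ↦ (mem_filter.1 hl).2.1
  simp only [bipartiteAbove, bipartiteBelow, filter_filter, h1, filter_univ_mem] at h2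
  rw [h3] at h2
  simp only [sum_const, smul_eq_mul, Finset.card_univ, hc, hu] at h2
  omega

/-- A point on three three-point lines can be labelled by `6` in the standard way. -/
theorem IsCrit.exists_spokes (hr : IsCrit r) (hl : ∀ T, r T = 2 → T.card ≤ 3) (hu : r univ = 3) :
    ∃ e, Spokes r e := by
  obtain ⟨p, hp⟩ := hr.exists_three_lines hu
  obtain ⟨l, hlm, m, hm, n, hn, hlm', hln, hmn⟩ := two_lt_card.1 hp
  simp only [mem_filter, mem_univ, true_and] at hlm hm hn
  have disj : ∀ s t : Finset β, (s.card = 3 ∧ r s = 2) ∧ p ∈ s → (t.card = 3 ∧ r t = 2) ∧ p ∈ t →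
      s ≠ t → ∀ x ∈ s.erase p, x ∉ t.erase p := by
    intro s t hs ht hst x hx hx'
    rw [mem_erase] at hx hx'
    refine hst (hr.line_eq hl hs.1.1 hs.1.2 ht.1.1 ht.1.2 (one_lt_card.2
      ⟨p, mem_inter.2 ⟨hs.2, ht.2⟩, x, mem_inter.2 ⟨hx.2, hx'.2⟩, hx.1.symm⟩))
  have two : ∀ s : Finset β, (s.card = 3 ∧ r s = 2) ∧ p ∈ s → ∃ u v, u ≠ v ∧ s.erase p = {u, v} :=
    fun s hs ↦ card_eq_two.1 (by rw [card_erase_of_mem hs.2, hs.1.1])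
  have dlm := disj l m hlm hm hlm'
  have dln := disj l n hlm hn hln
  have dmn := disj m n hm hn hmn
  obtain ⟨u, v, huv, hl'⟩ := two l hlm
  obtain ⟨u', v', huv', hm'⟩ := two m hm
  obtain ⟨u'', v'', huv'', hn'⟩ := two n hn
  have pl := insert_erase hlm.2
  have pm := insert_erase hm.2
  have pn := insert_erase hn.2
  have npl := notMem_erase p l
  have npm := notMem_erase p m
  have npn := notMem_erase p n
  rw [hl'] at pl dlm dln npl
  rw [hm'] at pm dlm dmn npm
  rw [hn'] at pn dln dmn npn
  have hnd : [u, u', u'', v, v', v'', p].Nodup := by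
    simp only [mem_insert, mem_singleton, forall_eq_or_imp, forall_eq] at *
    simp only [List.nodup_cons, List.mem_cons, List.not_mem_nil, or_false, not_false_eq_true,
      List.nodup_nil]
    clear * - dlm dln dmn huv huv' huv'' npl npm npn
    grind
  have hc := hr.card_univ
  have hset : univ.image ![u, u', u'', v, v', v'', p] = (univ : Finset β) := by
    refine eq_univ_of_card _ ?_
    rw [card_image_of_injective _ ((List.nodup_ofFn (f := ![u, u', u'', v, v', v'', p])).1 hnd), hc, hu]
    rfl
  obtain ⟨e, he⟩ := exists_equiv _ hset (by rw [hc, hu])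
  refine ⟨e, ?_⟩
  simp only [Spokes, map_insert, map_singleton, Equiv.coe_toEmbedding, he]
  exact ⟨by rw [← hlm.1.2, ← pl]; rfl, by rw [← hm.1.2, ← pm]; rfl, by rw [← hn.1.2, ← pn]; rfl⟩

theorem IsCrit.exists_line_off (hr : IsCrit r) (hl : ∀ T, r T = 2 → T.card ≤ 3) {x y : β}
    (hxy : x ≠ y) : ∃ l : Finset β, l.card = 3 ∧ r l = 2 ∧ x ∈ l ∧ y ∉ l := by
  obtain ⟨l, hlm, m, hm, hlm'⟩ := one_lt_card.1 (hr.exists_two_lines x)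
  simp only [mem_filter, mem_univ, true_and] at hlm hm
  by_contra! hcon
  exact hlm' (hr.line_eq hl hlm.1.1 hlm.1.2 hm.1.1 hm.1.2 (one_lt_card.2
    ⟨x, mem_inter.2 ⟨hlm.2, hm.2⟩, y, mem_inter.2 ⟨hcon l hlm.1.1 hlm.1.2 hlm.2,
      hcon m hm.1.1 hm.1.2 hm.2⟩, hxy⟩))

/-- Each of the points `0, …, 5` is on a line that meets all three lines through `6`. -/
theorem Spokes.exists_transversal {e : Fin 7 ≃ β} (hr : IsCrit r)
    (hl : ∀ T, r T = 2 → T.card ≤ 3) (he : Spokes r e) (i : Fin 7) (hi : i ≠ 6) :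
    ∃ S : Finset (Fin 7), S.card = 3 ∧ i ∈ S ∧ (S ∩ {6, 0, 3}).card ≤ 1 ∧
      (S ∩ {6, 1, 4}).card ≤ 1 ∧ (S ∩ {6, 2, 5}).card ≤ 1 ∧ 6 ∉ S ∧
      r (S.map e.toEmbedding) = 2 := by
  obtain ⟨l, hlc, hl2, hil, h6⟩ := hr.exists_line_off hl (e.injective.ne hi)
  have hmap : (l.map e.symm.toEmbedding).map e.toEmbedding = l := by
    ext; simp
  have h6' : 6 ∉ l.map e.symm.toEmbedding := by simpa using h6
  have key : ∀ T : Finset (Fin 7), T.card = 3 → 6 ∈ T → r (T.map e.toEmbedding) = 2 →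
      (l.map e.symm.toEmbedding ∩ T).card ≤ 1 := by
    intro T hT h6T hT2
    by_contra! hcon
    have := hr.line_eq hl hlc hl2 (by rw [card_map, hT]) hT2
      (by rw [← hmap, ← map_inter, card_map]; exact hcon)
    rw [← hmap, map_inj] at this
    exact h6' (this ▸ h6T)
  exact ⟨l.map e.symm.toEmbedding, by rw [card_map, hlc], by simpa using hil,
    key _ (by decide) (by decide) he.1, key _ (by decide) (by decide) he.2.1,
    key _ (by decide) (by decide) he.2.2, h6', by rw [hmap, hl2]⟩

/-- If `{3, 4, 5}` is not a line, then each of `3, 4, 5` is on one of the lines `{2, 3, 4}`,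
`{0, 4, 5}` and `{1, 3, 5}`. So at least two of these three are lines, and by symmetry it does not
matter which. -/
theorem IsCrit.hasCode_of_spokes_line {e : Fin 7 ≃ β} (hr : IsCrit r)
    (hl : ∀ T, r T = 2 → T.card ≤ 3) (hu : r univ = 3) (he : Spokes r e)
    (h1 : r (({0, 1, 2} : Finset (Fin 7)).map e.toEmbedding) = 2) :
    HasCode r codeP7 ∨ HasCode r codeFano ∨ HasCode r codeNonFano := by
  by_cases hE : r (({3, 4, 5} : Finset (Fin 7)).map e.toEmbedding) = 2
  · exact Or.inl (hasCode_p7 hr hl hu he h1 hE)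
  right
  have key : ∀ i : Fin 7, i ∈ ({3, 4, 5} : Finset (Fin 7)) → ∃ S : Finset (Fin 7),
      S ∈ [({2, 3, 4} : Finset (Fin 7)), {0, 4, 5}, {1, 3, 5}] ∧ i ∈ S ∧
      r (S.map e.toEmbedding) = 2 := by
    intro i hi
    obtain ⟨S, hS, hiS, s1, s2, s3, h6, h2⟩ := he.exists_transversal hr hl i
      (by rintro rfl; revert hi; decide)
    refine ⟨S, ?_, hiS, h2⟩
    have h345 : S ≠ {3, 4, 5} := by rintro rfl; exact hE h2
    have h012 : (S ∩ {0, 1, 2}).card ≤ 1 := by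
      by_contra! hcon
      have := hr.line_eq hl (by rw [card_map, hS]) h2 (T := ({0, 1, 2} : Finset (Fin 7)).map
        e.toEmbedding) (by rw [card_map]; rfl) h1 (by rw [← map_inter, card_map]; exact hcon)
      rw [map_inj] at this
      subst this
      revert i
      decide
    clear * - hS hiS hi s1 s2 s3 h6 h345 h012
    revert i S
    decide +kernel
  have relabel : ∀ (σ : Equiv.Perm (Fin 7)) (S T : Finset (Fin 7)), S.map σ.toEmbedding = T →
      r (S.map (σ.trans e).toEmbedding) = r (T.map e.toEmbedding) := by
    rintro σ S T rfl
    rw [map_map]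
    rfl
  by_cases hA : r (({2, 3, 4} : Finset (Fin 7)).map e.toEmbedding) = 2
  · by_cases hB : r (({0, 4, 5} : Finset (Fin 7)).map e.toEmbedding) = 2
    · exact hasCode_fano_or_nonFano hr hl hu he h1 hA hB
    · have hC : r (({1, 3, 5} : Finset (Fin 7)).map e.toEmbedding) = 2 := by
        obtain ⟨S, hS, h5, h2⟩ := key 5 (by decide)
        simp only [List.mem_cons, List.not_mem_nil, or_false] at hS
        rcases hS with rfl | rfl | rfl
        · exact absurd h5 (by decide)
        · exact absurd h2 hB
        · exact h2
      refine hasCode_fano_or_nonFano (e := (Equiv.swap 0 1 * Equiv.swap 3 4 : Equiv.Perm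
        (Fin 7)).trans e) hr hl hu ⟨?_, ?_, ?_⟩ ?_ ?_ ?_
      · rw [relabel _ _ {6, 1, 4} (by decide)]; exact he.2.1
      · rw [relabel _ _ {6, 0, 3} (by decide)]; exact he.1
      · rw [relabel _ _ {6, 2, 5} (by decide)]; exact he.2.2
      · rw [relabel _ _ {0, 1, 2} (by decide)]; exact h1
      · rw [relabel _ _ {2, 3, 4} (by decide)]; exact hA
      · rw [relabel _ _ {1, 3, 5} (by decide)]; exact hC
  · have hB : r (({0, 4, 5} : Finset (Fin 7)).map e.toEmbedding) = 2 := by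
      obtain ⟨S, hS, h5, h2⟩ := key 4 (by decide)
      simp only [List.mem_cons, List.not_mem_nil, or_false] at hS
      rcases hS with rfl | rfl | rfl
      · exact absurd h2 hA
      · exact h2
      · exact absurd h5 (by decide)
    have hC : r (({1, 3, 5} : Finset (Fin 7)).map e.toEmbedding) = 2 := by
      obtain ⟨S, hS, h5, h2⟩ := key 3 (by decide)
      simp only [List.mem_cons, List.not_mem_nil, or_false] at hS
      rcases hS with rfl | rfl | rfl
      · exact absurd h2 hA
      · exact absurd h5 (by decide)
      · exact h2
    refine hasCode_fano_or_nonFano (e := (Equiv.swap 1 2 * Equiv.swap 4 5 : Equiv.Perm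
      (Fin 7)).trans e) hr hl hu ⟨?_, ?_, ?_⟩ ?_ ?_ ?_
    · rw [relabel _ _ {6, 0, 3} (by decide)]; exact he.1
    · rw [relabel _ _ {6, 2, 5} (by decide)]; exact he.2.2
    · rw [relabel _ _ {6, 1, 4} (by decide)]; exact he.2.1
    · rw [relabel _ _ {0, 1, 2} (by decide)]; exact h1
    · rw [relabel _ _ {1, 3, 5} (by decide)]; exact hC
    · rw [relabel _ _ {0, 4, 5} (by decide)]; exact hB

/-- The critical matroids of rank three without four-point lines. -/
theorem IsCrit.hasCode_of_rk_three (hr : IsCrit r) (hl : ∀ T, r T = 2 → T.card ≤ 3)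
    (hu : r univ = 3) : HasCode r codeP7 ∨ HasCode r codeFano ∨ HasCode r codeNonFano := by
  obtain ⟨e, he⟩ := hr.exists_spokes hl hu
  obtain ⟨S, hS, h0, s1, s2, s3, h6, h2⟩ := he.exists_transversal hr hl 0 (by decide)
  -- interchanging the two points other than `6` on lines through `6` turns the line `S` into
  -- the line `{0, 1, 2}`
  have hσ : ∃ σ ∈ [(1 : Equiv.Perm (Fin 7)), Equiv.swap 1 4, Equiv.swap 2 5,
      Equiv.swap 1 4 * Equiv.swap 2 5], ({0, 1, 2} : Finset (Fin 7)).map σ.toEmbedding = S := by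
    clear * - hS h0 s1 s2 s3 h6
    revert S
    decide +kernel
  obtain ⟨σ, hσ, rfl⟩ := hσ
  have hσ' : ({6, 0, 3} : Finset (Fin 7)).map σ.toEmbedding = {6, 0, 3} ∧
      ({6, 1, 4} : Finset (Fin 7)).map σ.toEmbedding = {6, 1, 4} ∧
      ({6, 2, 5} : Finset (Fin 7)).map σ.toEmbedding = {6, 2, 5} := by
    clear * - hσ
    simp only [List.mem_cons, List.not_mem_nil, or_false] at hσ
    rcases hσ with rfl | rfl | rfl | rfl <;> decide
  have relabel : ∀ S : Finset (Fin 7),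
      S.map (σ.trans e).toEmbedding = (S.map σ.toEmbedding).map e.toEmbedding := by
    intro S
    rw [map_map]
    rfl
  refine hr.hasCode_of_spokes_line (e := σ.trans e) hl hu ⟨?_, ?_, ?_⟩ ?_
  · rw [relabel, hσ'.1]; exact he.1
  · rw [relabel, hσ'.2.1]; exact he.2.1
  · rw [relabel, hσ'.2.2]; exact he.2.2
  · rw [relabel]; exact h2

end

/-! ### Critical matroids without tight flats, of rank at least four -/

section

variable {β : Type*} [DecidableEq β] [Fintype β] {r : Finset β → ℕ} {S T F : Finset β}
  {w x y z t s h h₁ h₂ h₃ h₄ g : β}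

/-- If there are no tight flats, then a maximal proper flat `F` with `2 * r F - 1` elements is a
hyperplane. -/
theorem IsCrit.exists_almost_tight_hyperplane (hr : IsCrit r)
    (hnt : ∀ F, F.Nonempty → cl r F = F → F ≠ univ → F.card ≠ 2 * r F) (h2 : 2 ≤ r univ) :
    ∃ H, cl r H = H ∧ Hᶜ.card = 4 := by
  obtain ⟨x⟩ : Nonempty β := Fintype.card_pos_iff.1 (by rw [hr.card_univ]; omega)
  have hx : cl r {x} = {x} := by
    refine Subset.antisymm (fun y hy ↦ ?_) subset_cl
    by_contra hne
    exact hr.notMem_cl_singleton (by simpa using hne) hy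
  have hxu : ({x} : Finset β) ≠ univ := fun h ↦ by
    have := hr.rk_singleton x
    rw [h] at this
    omega
  obtain ⟨H, hH, hmax⟩ := (univ.filter fun H : Finset β ↦ H.Nonempty ∧ cl r H = H ∧ H ≠ univ ∧
    H.card + 1 = 2 * r H).exists_max_image Finset.card
    ⟨{x}, by simp [hx, hxu, hr.rk_singleton]⟩
  simp only [mem_filter, mem_univ, true_and] at hH hmax
  obtain ⟨hne, hHcl, hHne, hHt⟩ := hH
  refine ⟨H, hHcl, ?_⟩
  have hc := hr.card_univ
  have hcc := card_add_card_compl H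
  obtain ⟨a, ha, b, hb, hab, hba⟩ := hr.exists_parallel (T := Hᶜ) hne
    (fun x hx ↦ by rw [hHcl]; simpa using hx) (by omega)
  rw [mem_compl] at ha hb
  have hra := hr.rank.rk_insert (r := r) (S := H) (x := a) (by rwa [hHcl])
  have hsub : insert b (insert a H) ⊆ cl r (insert a H) := insert_subset hba subset_cl
  have hcard : (insert b (insert a H)).card = H.card + 2 := by
    rw [card_insert_of_notMem (by simp [hb, hab.symm]), card_insert_of_notMem ha]
  have hle := card_le_card hsub
  by_cases hG : cl r (insert a H) = univ
  · have : r univ = r H + 1 := by rw [← hG, hr.rank.rk_cl, hra]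
    omega
  · exfalso
    have hGn : (cl r (insert a H)).Nonempty := (insert_nonempty _ _).mono subset_cl
    have h1 := hr.restr _ hG
    have h3 := hnt _ hGn (hr.rank.cl_cl _) hG
    rw [hr.rank.rk_cl, hra] at h1 h3
    have h4 := hmax (cl r (insert a H)) ⟨hGn, hr.rank.cl_cl _, hG, by
      rw [hr.rank.rk_cl, hra]; omega⟩
    omega

/-- Without tight flats, a plane contains at most five points. -/
theorem IsCrit.no_six_in_plane (hr : IsCrit r)
    (hnt : ∀ F, F.Nonempty → cl r F = F → F ≠ univ → F.card ≠ 2 * r F) (h4 : 4 ≤ r univ)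
    {a b c d e f : β} (hnd : [a, b, c, d, e, f].Nodup) (hd : d ∈ cl r {a, b, c})
    (he : e ∈ cl r {a, b, c}) (hf : f ∈ cl r {a, b, c}) : False := by
  have h1 := hr.rank.rk_le_card {a, b, c}
  have h2 : ({a, b, c} : Finset β).card ≤ 3 := card_le_three
  have h3 := hr.rank.rk_cl (S := {a, b, c})
  have h5 := hr.card_lt hnt (T := cl r {a, b, c}) ⟨a, subset_cl (by simp)⟩ (by omega)
  have h6 : [a, b, c, d, e, f].toFinset ⊆ cl r {a, b, c} := by
    intro t ht
    simp only [List.mem_toFinset, List.mem_cons, List.not_mem_nil, or_false] at ht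
    rcases ht with rfl | rfl | rfl | rfl | rfl | rfl
    · exact subset_cl (by simp)
    · exact subset_cl (by simp)
    · exact subset_cl (by simp)
    all_goals assumption
  have h7 := card_le_card h6
  rw [List.toFinset_card_of_nodup hnd] at h7
  simp only [List.length_cons, List.length_nil] at h7
  omega

/-- Without tight flats, a line contains at most three points. -/
theorem IsCrit.no_four_on_line (hr : IsCrit r)
    (hnt : ∀ F, F.Nonempty → cl r F = F → F ≠ univ → F.card ≠ 2 * r F) (h3 : 3 ≤ r univ)
    (T : Finset β) (hT : r T = 2) : T.card ≤ 3 := by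
  have hne : T.Nonempty := by
    rw [nonempty_iff_ne_empty]
    rintro rfl
    rw [hr.rank.empty] at hT
    omega
  have := hr.card_lt hnt hne (by omega)
  omega

theorem IsCrit.eq_of_three_on_line (hr : IsCrit r) (hl : ∀ T, r T = 2 → T.card ≤ 3)
    {a b c d : β} (hab : a ≠ b) (hca : c ≠ a) (hcb : c ≠ b) (hda : d ≠ a) (hdb : d ≠ b)
    (hc : c ∈ cl r {a, b}) (hd : d ∈ cl r {a, b}) : c = d := by
  by_contra hcd
  have h1 := hl (cl r {a, b}) (by rw [hr.rank.rk_cl, hr.rk_pair hab])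
  have h2 : ({a, b, c, d} : Finset β) ⊆ cl r {a, b} := by
    intro t ht
    simp only [mem_insert, mem_singleton] at ht
    rcases ht with rfl | rfl | rfl | rfl
    exacts [left_mem_cl, right_mem_cl, hc, hd]
  have h3 := card_le_card h2
  rw [card_insert_of_notMem (by simp only [mem_insert, mem_singleton]; tauto),
    card_eq_three.2 ⟨b, c, d, hcb.symm, hdb.symm, hcd, rfl⟩] at h3
  omega

end

/-- The hypotheses on a `3 × 3` grid: its rows and columns are lines. -/
structure Grid {β : Type*} [DecidableEq β] [Fintype β] (r : Finset β → ℕ) (e : Fin 9 ≃ β) :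
    Prop where
  row : ∀ l ∈ [({0, 1, 2} : Finset (Fin 9)), {3, 4, 5}, {6, 7, 8}, {0, 3, 6}, {1, 4, 7}, {2, 5, 8}],
    r (l.map e.toEmbedding) = 2

section

variable {β : Type*} [DecidableEq β] [Fintype β] {r : Finset β → ℕ} {S T F : Finset β}

theorem exists_insert_codeK33 :
    ∀ S, CodeIndep codeK33 S → S.card < 4 → ∃ x, x ∉ S ∧ CodeIndep codeK33 (insert x S) := by
  decide +kernel

theorem exists_basis_codeK33 {S : Finset (Fin 9)} (hS : CodeIndep codeK33 S) :
    ∃ S', S ⊆ S' ∧ CodeIndep codeK33 S' ∧ S'.card = 4 := by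
  have hmax : ∀ S, CodeIndep codeK33 S → S.card ≤ 4 := fun S hS ↦ by
    simpa using hS (univ, 4) (by simp [codeK33])
  obtain ⟨T, hT, hT'⟩ := (univ.filter fun T ↦ S ⊆ T ∧ CodeIndep codeK33 T).exists_max_image
    card ⟨S, by simp [hS]⟩
  simp only [mem_filter, mem_univ, true_and] at hT hT'
  refine ⟨T, hT.1, hT.2, le_antisymm (hmax T hT.2) ?_⟩
  by_contra! hlt
  obtain ⟨x, hx, hx'⟩ := exists_insert_codeK33 T hT.2 hlt
  have := hT' (insert x T) ⟨hT.1.trans (subset_insert x T), hx'⟩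
  rw [card_insert_of_notMem hx] at this
  omega

/-- A set of four or five elements of the grid that contains each row and column with which it
shares two elements lies in the union of a row and a column. -/
theorem grid_plane : ∀ Q : Finset (Fin 9), (∀ l ∈ [({0, 1, 2} : Finset (Fin 9)), {3, 4, 5},
    {6, 7, 8}, {0, 3, 6}, {1, 4, 7}, {2, 5, 8}], 2 ≤ (Q ∩ l).card → l ⊆ Q) → Q.card ≤ 5 →
    4 ≤ Q.card → ∃ q ∈ codeK33, q.2 = 3 ∧ Q ⊆ q.1 := by
  decide +kernel

/-- The unions of a row and a column are planes. A set that the list declares independent extends to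
one with four elements, which by `grid_plane` does not lie in a plane. -/
theorem Grid.hasCode {e : Fin 9 ≃ β} (hr : IsCrit r)
    (hnt : ∀ F, F.Nonempty → cl r F = F → F ≠ univ → F.card ≠ 2 * r F) (h4 : r univ = 4)
    (hG : Grid r e) : HasCode r codeK33 := by
  have hle : ∀ q ∈ codeK33, r (q.1.map e.toEmbedding) ≤ q.2 := by
    have plane : ∀ l ∈ [({0, 1, 2} : Finset (Fin 9)), {3, 4, 5}, {6, 7, 8}],
        ∀ m ∈ [({0, 3, 6} : Finset (Fin 9)), {1, 4, 7}, {2, 5, 8}],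
        r ((l ∪ m).map e.toEmbedding) ≤ 3 := by
      intro l hl m hm
      have h1 := hG.row l (by simp only [List.mem_cons, List.not_mem_nil, or_false] at hl ⊢; tauto)
      have h2 := hG.row m (by simp only [List.mem_cons, List.not_mem_nil, or_false] at hm ⊢; tauto)
      have h3 := hr.rank.submod (l.map e.toEmbedding) (m.map e.toEmbedding)
      have h5 : (l ∩ m).card = 1 := by clear * - hl hm; revert l m; decide +kernel
      rw [← map_union, ← map_inter,
        hr.rk_of_card_le_two (S := (l ∩ m).map e.toEmbedding) (by rw [card_map]; omega),
        card_map] at h3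
      omega
    have h : ∀ q ∈ codeK33, (q.2 = 2 ∧ q.1 ∈ [({0, 1, 2} : Finset (Fin 9)), {3, 4, 5}, {6, 7, 8},
        {0, 3, 6}, {1, 4, 7}, {2, 5, 8}]) ∨ q.2 = 4 ∨
        (q.2 = 3 ∧ ∃ l ∈ [({0, 1, 2} : Finset (Fin 9)), {3, 4, 5}, {6, 7, 8}],
        ∃ m ∈ [({0, 3, 6} : Finset (Fin 9)), {1, 4, 7}, {2, 5, 8}], q.1 = l ∪ m) := by decide
    intro q hq
    rcases h q hq with ⟨h2, hm⟩ | hh | ⟨h3, l, hl, m, hm, heq⟩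
    · rw [h2, hG.row _ hm]
    · rw [hh, ← h4]
      exact hr.rank.mono (subset_univ _)
    · rw [h3, heq]
      exact plane l hl m hm
  refine ⟨e, fun S ↦ ⟨fun hS q hq ↦ ?_, fun hS ↦ ?_⟩⟩
  · have h1 := hr.rank.subset_of_indep (map_subset_map.2 (inter_subset_left : S ∩ q.1 ⊆ S))
      (by rw [hS, card_map])
    have h2 := hr.rank.mono ((map_subset_map (f := e.toEmbedding)).2
      (inter_subset_right : S ∩ q.1 ⊆ q.1))
    rw [card_map] at h1
    have := hle q hq
    omega
  · obtain ⟨S', hSS', hS', hS'c⟩ := exists_basis_codeK33 hS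
    suffices h : r (S'.map e.toEmbedding) = (S'.map e.toEmbedding).card by
      have := hr.rank.subset_of_indep ((map_subset_map (f := e.toEmbedding)).2 hSS') h
      rw [this, card_map]
    -- otherwise `S'` spans a plane with at most five points, which is closed under lines
    by_contra hne
    have h5 := hr.rank.rk_le_card (S'.map e.toEmbedding)
    rw [card_map, hS'c] at h5 hne
    have h6 : r (cl r (S'.map e.toEmbedding)) = r (S'.map e.toEmbedding) := hr.rank.rk_cl _
    have h7 := hr.card_lt hnt (T := cl r (S'.map e.toEmbedding))
      ((map_nonempty.2 (card_pos.1 (by omega))).mono subset_cl) (by omega)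
    set Q := (cl r (S'.map e.toEmbedding)).map e.symm.toEmbedding with hQ
    have hmem : ∀ i, i ∈ Q ↔ e i ∈ cl r (S'.map e.toEmbedding) := by
      intro i
      simp [hQ]
    have hQc : Q.card ≤ 5 := by rw [hQ, card_map]; omega
    have hsub : S' ⊆ Q := fun i hi ↦ (hmem i).2 (subset_cl (mem_map_of_mem _ hi))
    have hclosed : ∀ l ∈ [({0, 1, 2} : Finset (Fin 9)), {3, 4, 5}, {6, 7, 8}, {0, 3, 6},
        {1, 4, 7}, {2, 5, 8}], 2 ≤ (Q ∩ l).card → l ⊆ Q := by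
      intro l hl h2 k hk
      obtain ⟨i, hi, j, hj, hij⟩ := one_lt_card.1 h2
      rw [mem_inter] at hi hj
      exact (hmem k).2 (hr.rank.cl_pair_mono ((hmem i).1 hi.1) ((hmem j).1 hj.1)
        (hr.mem_cl_of_rk_eq_two (hG.row l hl) (mem_map_of_mem _ hi.2)
          (mem_map_of_mem _ hj.2) (mem_map_of_mem _ hk) (e.injective.ne hij)))
    have hcard := card_le_card hsub
    obtain ⟨q, hq, hq3, hQq⟩ := grid_plane Q hclosed hQc (by omega)
    have h8 := hS' q hq
    rw [inter_eq_left.2 (hsub.trans hQq)] at h8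
    omega

end

/-! ### The grid of a critical matroid without tight flats -/

section

variable {β : Type*} [DecidableEq β] [Fintype β] {r : Finset β → ℕ} {H : Finset β}
  {u v w x y z t s h h₁ h₂ h₃ h₄ g a b c d : β}

theorem IsCrit.rk_triple (hr : IsCrit r) (hab : a ≠ b) (hc : c ∈ cl r {a, b}) :
    r {a, b, c} = 2 := by
  rw [mem_cl, hr.rk_pair hab] at hc
  rw [← hc]
  congr 1
  ext; simp only [mem_insert, mem_singleton]; tauto

/-- A point outside a hyperplane `H` is on two lines that contain one further point outside `H` and
a point of `H`, unless it is on a line with two further points outside `H`. -/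
theorem IsCrit.exists_two_feet (hr : IsCrit r) (hcl : cl r H = H) (hu : u ∉ H)
    (hC : ∀ a b, a ∉ H → b ∉ H → a ≠ u → b ≠ u → a ≠ b → b ∉ cl r {a, u}) :
    ∃ p q h k, p ≠ q ∧ p ∉ H ∧ q ∉ H ∧ p ≠ u ∧ q ≠ u ∧ h ∈ H ∧ k ∈ H ∧ h ≠ k ∧
      h ∈ cl r {p, u} ∧ k ∈ cl r {q, u} := by
  obtain ⟨a, b, c, d, hab, hcd, hau, hbu, hcu, hdu, hbc, hbd, h1, h2⟩ := hr.exists_two_triangles u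
  have key : ∀ a b, a ≠ b → a ≠ u → b ≠ u → b ∈ cl r {a, u} →
      (a ∉ H ∧ b ∈ H ∧ b ∈ cl r {a, u}) ∨ (b ∉ H ∧ a ∈ H ∧ a ∈ cl r {b, u}) := by
    intro a b hab hau hbu h1
    have h1' : a ∈ cl r {b, u} := hr.mem_cl_pair hbu h1 right_mem_cl left_mem_cl
    have n1 := hr.not_both_mem hcl hu hab h1
    have n2 := fun ha hb ↦ hC a b ha hb hau hbu hab h1
    tauto
  obtain ⟨p, h, hp, hpu, hh, hpl, hset⟩ : ∃ p h, p ∉ H ∧ p ≠ u ∧ h ∈ H ∧ h ∈ cl r {p, u} ∧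
      ((p = a ∧ h = b) ∨ (p = b ∧ h = a)) := by
    rcases key a b hab hau hbu h1 with h | h
    · exact ⟨a, b, h.1, hau, h.2.1, h.2.2, Or.inl ⟨rfl, rfl⟩⟩
    · exact ⟨b, a, h.1, hbu, h.2.1, h.2.2, Or.inr ⟨rfl, rfl⟩⟩
  obtain ⟨q, k, hq, hqu, hk, hql, hset'⟩ : ∃ q k, q ∉ H ∧ q ≠ u ∧ k ∈ H ∧ k ∈ cl r {q, u} ∧
      ((q = c ∧ k = d) ∨ (q = d ∧ k = c)) := by
    rcases key c d hcd hcu hdu h2 with h | h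
    · exact ⟨c, d, h.1, hcu, h.2.1, h.2.2, Or.inl ⟨rfl, rfl⟩⟩
    · exact ⟨d, c, h.1, hdu, h.2.1, h.2.2, Or.inr ⟨rfl, rfl⟩⟩
  have hpq : p ≠ q := by
    rintro rfl
    have hhk : h = k := by
      by_contra hhk
      exact hr.not_both_mem hcl hu hhk
        (hr.mem_cl_pair (fun h' ↦ hu (h' ▸ hh)) hpl right_mem_cl hql) ⟨hh, hk⟩
    clear * - hset hset' hhk hbc hbd
    grind
  refine ⟨p, q, h, k, hpq, hp, hq, hpu, hqu, hh, hk, ?_, hpl, hql⟩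
  rintro rfl
  have h3 := hr.mem_cl_of_meet (fun h' : h = u ↦ hu (h' ▸ hh)) hpq hpl hql
  exact hC p q hp hq hpu hqu hpq (hr.swap_mem_cl hpu.symm h3)

/-- Four points form the complement of the hyperplane `H`, and no three of them are collinear. -/
structure IsQuad (r : Finset β → ℕ) (H : Finset β) : Prop where
  crit : IsCrit r
  tight : ∀ F, F.Nonempty → cl r F = F → F ≠ univ → F.card ≠ 2 * r F
  rank : 4 ≤ r univ
  flat : cl r H = H
  card : Hᶜ.card = 4

namespace IsQuad

theorem line (hQ : IsQuad r H) : ∀ T, r T = 2 → T.card ≤ 3 :=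
  hQ.crit.no_four_on_line hQ.tight (by have := hQ.rank; omega)

/-- No three points outside `H` are collinear: a fourth one would span a plane with six points
together with these. -/
theorem notMem_cl (hQ : IsQuad r H) (hx : x ∉ H) (hy : y ∉ H) (hz : z ∉ H) (hxy : x ≠ y)
    (hzx : z ≠ x) (hzy : z ≠ y) : z ∉ cl r {x, y} := by
  intro hzl
  have hr := hQ.crit
  have hsub : ({x, y, z} : Finset β) ⊆ Hᶜ := by
    intro t ht
    simp only [mem_insert, mem_singleton] at ht
    rw [mem_compl]
    rcases ht with rfl | rfl | rfl <;> assumption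
  obtain ⟨w, hw⟩ := card_eq_one.1 (show (Hᶜ \ {x, y, z}).card = 1 by
    rw [card_sdiff_of_subset hsub, hQ.card, card_eq_three.2 ⟨x, y, z, hxy, hzx.symm, hzy.symm, rfl⟩])
  have hmem : ∀ t, t ∉ H → t ≠ w → t = x ∨ t = y ∨ t = z := by
    intro t ht htw
    by_contra hcon
    have : t ∈ Hᶜ \ {x, y, z} := by
      rw [mem_sdiff, mem_compl]
      simp only [mem_insert, mem_singleton]
      exact ⟨ht, hcon⟩
    rw [hw, mem_singleton] at this
    exact htw this
  have hw' : w ∈ Hᶜ \ {x, y, z} := by rw [hw]; exact mem_singleton_self w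
  simp only [mem_sdiff, mem_compl, mem_insert, mem_singleton, not_or] at hw'
  obtain ⟨hwH, hwx, hwy, hwz⟩ := hw'
  have hin : ∀ t, t ∉ H → t ≠ w → t ∈ cl r {x, y} := by
    intro t ht htw
    rcases hmem t ht htw with rfl | rfl | rfl
    exacts [left_mem_cl, right_mem_cl, hzl]
  have hwl : w ∉ cl r {x, y} := fun h ↦
    hwz (hr.eq_of_three_on_line hQ.line hxy hwx hwy hzx hzy h hzl)
  obtain ⟨p, q, h, k, hpq, hp, hq, hpw, hqw, hh, hk, hhk, hpl, hql⟩ :=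
    hr.exists_two_feet hQ.flat hwH fun a b ha hb haw hbw hab h ↦
      hwl (hr.rank.cl_pair_mono (hin a ha haw) (hin b hb hbw)
        (hr.swap_mem_cl hab.symm h |> fun h' ↦ by rwa [pair_comm] at h' ⊢))
  have hmono := hr.rank.cl_mono (show ({x, y} : Finset β) ⊆ {x, y, w} by
    intro t; simp only [mem_insert, mem_singleton]; tauto)
  have mw : w ∈ cl r {x, y, w} := subset_cl (by simp)
  refine hr.no_six_in_plane hQ.tight hQ.rank (a := x) (b := y) (c := w) (d := z) (e := h) (f := k)
    ?_ (hmono hzl) (hr.rank.cl_pair_mono (hmono (hin p hp hpw)) mw hpl)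
    (hr.rank.cl_pair_mono (hmono (hin q hq hqw)) mw hql)
  simp only [List.nodup_cons, List.mem_cons, List.not_mem_nil, or_false, not_false_eq_true,
    List.nodup_nil, and_true]
  clear * - hx hy hz hwH hh hk hxy hzx hzy hwx hwy hwz hhk
  grind

theorem feet_ne (hQ : IsQuad r H) (hx : x ∉ H) (hy : y ∉ H) (hz : z ∉ H) (hxy : x ≠ y)
    (hzx : z ≠ x) (hzy : z ≠ y) (hh : h ∈ H) (h1 : h ∈ cl r {x, y}) (h2 : g ∈ cl r {y, z}) :
    h ≠ g := by
  rintro rfl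
  refine hQ.notMem_cl hx hz hy hzx.symm hxy.symm hzy.symm
    (hQ.crit.mem_cl_of_meet (fun h' ↦ hy (h' ▸ hh)) hzx.symm h1 (by rwa [pair_comm]))

/-- If two sides of a triangle outside `H` meet `H` in a point, then the third side does not. -/
theorem no_triangle (hQ : IsQuad r H) (hx : x ∉ H) (hy : y ∉ H) (hz : z ∉ H) (hxy : x ≠ y)
    (hzx : z ≠ x) (hzy : z ≠ y) (hh : h₁ ∈ H) (hk : h₂ ∈ H) (hg : g ∈ H) (h1 : h₁ ∈ cl r {x, y})
    (h2 : h₂ ∈ cl r {y, z}) (h3 : g ∈ cl r {z, x}) : False := by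
  have hr := hQ.crit
  have mx : x ∈ cl r {x, y, z} := subset_cl (by simp)
  have my : y ∈ cl r {x, y, z} := subset_cl (by simp)
  have mz : z ∈ cl r {x, y, z} := subset_cl (by simp)
  have n1 := hQ.feet_ne hx hy hz hxy hzx hzy hh h1 h2
  have n2 := hQ.feet_ne hy hz hx hzy.symm hxy hzx.symm hk h2 h3
  have n3 := hQ.feet_ne hz hx hy hzx hzy.symm hxy.symm hg h3 h1
  refine hr.no_six_in_plane hQ.tight hQ.rank (a := x) (b := y) (c := z) (d := h₁) (e := h₂) (f := g)
    ?_ (hr.rank.cl_pair_mono mx my h1) (hr.rank.cl_pair_mono my mz h2)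
    (hr.rank.cl_pair_mono mz mx h3)
  simp only [List.nodup_cons, List.mem_cons, List.not_mem_nil, or_false, not_false_eq_true,
    List.nodup_nil, and_true]
  clear * - hx hy hz hh hk hg hxy hzx hzy n1 n2 n3
  grind

end IsQuad

/-- The four points outside `H` form a cycle `w, x, y, z` whose sides meet `H` in
`h₁, h₂, h₃, h₄`. -/
structure QuadCycle (r : Finset β → ℕ) (H : Finset β) (w x y z h₁ h₂ h₃ h₄ : β) : Prop where
  quad : IsQuad r H
  out : w ∉ H ∧ x ∉ H ∧ y ∉ H ∧ z ∉ H
  ne : w ≠ x ∧ w ≠ y ∧ w ≠ z ∧ x ≠ y ∧ x ≠ z ∧ y ≠ z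
  mem : h₁ ∈ H ∧ h₂ ∈ H ∧ h₃ ∈ H ∧ h₄ ∈ H
  line : h₁ ∈ cl r {w, x} ∧ h₂ ∈ cl r {x, y} ∧ h₃ ∈ cl r {y, z} ∧ h₄ ∈ cl r {z, w}

/-- By `exists_two_feet` each of the four points is joined to two others by a line that meets `H`,
and by `no_triangle` these pairs form a cycle. -/
theorem IsQuad.exists_cycle (hQ : IsQuad r H) :
    ∃ w x y z h₁ h₂ h₃ h₄, QuadCycle r H w x y z h₁ h₂ h₃ h₄ := by
  have hr := hQ.crit
  have two : ∀ u, u ∉ H → ∃ p q h k, p ≠ q ∧ p ∉ H ∧ q ∉ H ∧ p ≠ u ∧ q ≠ u ∧ h ∈ H ∧ k ∈ H ∧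
      h ≠ k ∧ h ∈ cl r {p, u} ∧ k ∈ cl r {q, u} := fun u hu ↦
    hr.exists_two_feet hQ.flat hu fun a b ha hb hau hbu hab ↦
      hQ.notMem_cl ha hu hb hau hab.symm hbu
  obtain ⟨w, hw⟩ : (Hᶜ).Nonempty := card_pos.1 (by rw [hQ.card]; omega)
  rw [mem_compl] at hw
  obtain ⟨x, z, h₁, h₄, hxz, hx, hz, hxw, hzw, hh₁, hh₄, -, hl₁, hl₄⟩ := two w hw
  have hsub : ({w, x, z} : Finset β) ⊆ Hᶜ := by
    intro t ht
    simp only [mem_insert, mem_singleton] at ht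
    rw [mem_compl]
    rcases ht with rfl | rfl | rfl <;> assumption
  obtain ⟨y, hy⟩ := card_eq_one.1 (show (Hᶜ \ {w, x, z}).card = 1 by
    rw [card_sdiff_of_subset hsub, hQ.card, card_eq_three.2 ⟨w, x, z, hxw.symm, hzw.symm, hxz, rfl⟩])
  have hmem : ∀ t, t ∉ H → t ≠ y → t = w ∨ t = x ∨ t = z := by
    intro t ht hty
    by_contra hcon
    have : t ∈ Hᶜ \ {w, x, z} := by
      rw [mem_sdiff, mem_compl]
      simp only [mem_insert, mem_singleton]
      exact ⟨ht, hcon⟩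
    rw [hy, mem_singleton] at this
    exact hty this
  have hy' : y ∈ Hᶜ \ {w, x, z} := by rw [hy]; exact mem_singleton_self y
  simp only [mem_sdiff, mem_compl, mem_insert, mem_singleton, not_or] at hy'
  obtain ⟨hyH, hyw, hyx, hyz⟩ := hy'
  have hl₁' : h₁ ∈ cl r {w, x} := by rwa [pair_comm]
  have hl₄' : h₄ ∈ cl r {w, z} := by rwa [pair_comm]
  have nx : ∀ h k, h ∈ H → k ∈ H → h ∈ cl r {w, y} → k ∈ cl r {x, y} → False :=
    fun h k hh hk h1 h2 ↦ hQ.no_triangle hw hx hyH hxw.symm hyw hyx hh₁ hk hh hl₁' h2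
      (by rwa [pair_comm])
  have nz : ∀ h k, h ∈ H → k ∈ H → h ∈ cl r {w, y} → k ∈ cl r {z, y} → False :=
    fun h k hh hk h1 h2 ↦ hQ.no_triangle hw hz hyH hzw.symm hyw hyz hh₄ hk hh hl₄' h2
      (by rwa [pair_comm])
  obtain ⟨p, q, h, k, hpq, hp, hq, hpy, hqy, hh, hk, -, hpl, hql⟩ := two y hyH
  have hfin : ∃ h₂ h₃, h₂ ∈ H ∧ h₃ ∈ H ∧ h₂ ∈ cl r {x, y} ∧ h₃ ∈ cl r {z, y} := by
    rcases hmem p hp hpy with rfl | rfl | rfl <;> rcases hmem q hq hqy with rfl | rfl | rfl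
    · exact absurd rfl hpq
    · exact (nx h k hh hk hpl hql).elim
    · exact (nz h k hh hk hpl hql).elim
    · exact (nx k h hk hh hql hpl).elim
    · exact absurd rfl hpq
    · exact ⟨h, k, hh, hk, hpl, hql⟩
    · exact (nz k h hk hh hql hpl).elim
    · exact ⟨k, h, hk, hh, hql, hpl⟩
    · exact absurd rfl hpq
  obtain ⟨h₂, h₃, hh₂, hh₃, hl₂, hl₃⟩ := hfin
  exact ⟨w, x, y, z, h₁, h₂, h₃, h₄, hQ, ⟨hw, hx, hyH, hz⟩,
    ⟨hxw.symm, Ne.symm hyw, hzw.symm, Ne.symm hyx, hxz, hyz⟩, ⟨hh₁, hh₂, hh₃, hh₄⟩,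
    ⟨hl₁', hl₂, by rwa [pair_comm], hl₄⟩⟩

namespace QuadCycle

theorem rotate (hC : QuadCycle r H w x y z h₁ h₂ h₃ h₄) : QuadCycle r H x y z w h₂ h₃ h₄ h₁ := by
  obtain ⟨hQ, ho, hn, hm, hl⟩ := hC
  exact ⟨hQ, by tauto, ⟨hn.2.2.2.1, hn.2.2.2.2.1, hn.1.symm, hn.2.2.2.2.2, hn.2.1.symm,
    hn.2.2.1.symm⟩, by tauto, by tauto⟩

theorem adjacent_ne (hC : QuadCycle r H w x y z h₁ h₂ h₃ h₄) : h₁ ≠ h₂ := by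
  obtain ⟨hQ, ho, hn, hm, hl⟩ := hC
  exact hQ.feet_ne ho.1 ho.2.1 ho.2.2.1 hn.1 hn.2.1.symm hn.2.2.2.1.symm hm.1 hl.1 hl.2.1

theorem opposite_ne (hC : QuadCycle r H w x y z h₁ h₂ h₃ h₄) : h₁ ≠ h₃ := by
  have hne := hC.adjacent_ne
  obtain ⟨hQ, ho, hn, hm, hl⟩ := hC
  rintro rfl
  have hr := hQ.crit
  have mw : w ∈ cl r {w, x, y} := subset_cl (by simp)
  have mx : x ∈ cl r {w, x, y} := subset_cl (by simp)
  have my : y ∈ cl r {w, x, y} := subset_cl (by simp)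
  have m1 := hr.rank.cl_pair_mono mw mx hl.1
  have hz : z ∈ cl r {y, h₁} := hr.swap_mem_cl (fun h ↦ ho.2.2.1 (h ▸ hm.1)) hl.2.2.1
  refine hr.no_six_in_plane hQ.tight hQ.rank (a := w) (b := x) (c := y) (d := z) (e := h₁) (f := h₂)
    ?_ (hr.rank.cl_pair_mono my m1 hz) m1 (hr.rank.cl_pair_mono mx my hl.2.1)
  simp only [List.nodup_cons, List.mem_cons, List.not_mem_nil, or_false, not_false_eq_true,
    List.nodup_nil, and_true]
  clear * - ho hn hm hne
  grind

theorem notMem_adjacent (hC : QuadCycle r H w x y z h₁ h₂ h₃ h₄) (hg : g ∈ H) (h1 : g ≠ h₁)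
    (h2 : g ≠ h₂) : g ∉ cl r {h₁, h₂} := by
  intro hgl
  have hne := hC.adjacent_ne
  obtain ⟨hQ, ho, hn, hm, hl⟩ := hC
  have hr := hQ.crit
  have mw : w ∈ cl r {w, x, y} := subset_cl (by simp)
  have mx : x ∈ cl r {w, x, y} := subset_cl (by simp)
  have my : y ∈ cl r {w, x, y} := subset_cl (by simp)
  have m1 := hr.rank.cl_pair_mono mw mx hl.1
  have m2 := hr.rank.cl_pair_mono mx my hl.2.1
  refine hr.no_six_in_plane hQ.tight hQ.rank (a := w) (b := x) (c := y) (d := h₁) (e := h₂) (f := g)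
    ?_ m1 m2 (hr.rank.cl_pair_mono m1 m2 hgl)
  simp only [List.nodup_cons, List.mem_cons, List.not_mem_nil, or_false, not_false_eq_true,
    List.nodup_nil, and_true]
  clear * - ho hn hm hne hg h1 h2
  grind

theorem notMem_side (hC : QuadCycle r H w x y z h₁ h₂ h₃ h₄) (hg : g ∈ H) (h1 : g ≠ h₁) :
    g ∉ cl r {w, x} := fun hgl ↦ by
  obtain ⟨hQ, ho, hn, hm, hl⟩ := hC
  exact h1 (hQ.crit.eq_of_three_on_line hQ.line hn.1 (fun h ↦ ho.1 (h ▸ hg))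
    (fun h ↦ ho.2.1 (h ▸ hg)) (fun h ↦ ho.1 (h ▸ hm.1)) (fun h ↦ ho.2.1 (h ▸ hm.1)) hgl hl.1)

theorem notMem_diagonal (hC : QuadCycle r H w x y z h₁ h₂ h₃ h₄) (hg : g ∈ H) :
    g ∉ cl r {w, y} := fun hgl ↦ by
  obtain ⟨hQ, ho, hn, hm, hl⟩ := hC
  exact hQ.no_triangle ho.1 ho.2.1 ho.2.2.1 hn.1 hn.2.1.symm hn.2.2.2.1.symm hm.1 hm.2.1 hg hl.1
    hl.2.1 (by rwa [pair_comm])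

/-- A further point `g` of `H` is on no line with two points outside `H`. -/
theorem notMem_outer (hC : QuadCycle r H w x y z h₁ h₂ h₃ h₄) (hg : g ∈ H)
    (hne : g ≠ h₁ ∧ g ≠ h₂ ∧ g ≠ h₃ ∧ g ≠ h₄) (hab : a ≠ b) (ha : a = w ∨ a = x ∨ a = y ∨ a = z)
    (hb : b = w ∨ b = x ∨ b = y ∨ b = z) : g ∉ cl r {a, b} := by
  have n1 := hC.notMem_side hg hne.1
  have n2 := hC.rotate.notMem_side hg hne.2.1
  have n3 := hC.rotate.rotate.notMem_side hg hne.2.2.1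
  have n4 := hC.rotate.rotate.rotate.notMem_side hg hne.2.2.2
  have n5 := hC.notMem_diagonal hg
  have n6 := hC.rotate.notMem_diagonal hg
  clear hC
  rcases ha with rfl | rfl | rfl | rfl <;> rcases hb with rfl | rfl | rfl | rfl <;>
    first
    | exact absurd rfl hab
    | assumption
    | (rw [pair_comm]; assumption)

/-- A line with `g` and two of the intersections of the sides with `H` contains those of opposite
sides. -/
theorem inner_line (hC : QuadCycle r H w x y z h₁ h₂ h₃ h₄) (hg : g ∈ H)
    (hne : g ≠ h₁ ∧ g ≠ h₂ ∧ g ≠ h₃ ∧ g ≠ h₄) (hab : a ≠ b)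
    (ha : a = h₁ ∨ a = h₂ ∨ a = h₃ ∨ a = h₄) (hb : b = h₁ ∨ b = h₂ ∨ b = h₃ ∨ b = h₄)
    (hl : g ∈ cl r {a, b}) :
    (g ∈ cl r {h₁, h₃} ∧ (a = h₁ ∨ a = h₃) ∧ (b = h₁ ∨ b = h₃)) ∨
      (g ∈ cl r {h₂, h₄} ∧ (a = h₂ ∨ a = h₄) ∧ (b = h₂ ∨ b = h₄)) := by
  have n1 := hC.notMem_adjacent hg hne.1 hne.2.1
  have n2 := hC.rotate.notMem_adjacent hg hne.2.1 hne.2.2.1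
  have n3 := hC.rotate.rotate.notMem_adjacent hg hne.2.2.1 hne.2.2.2
  have n4 := hC.rotate.rotate.rotate.notMem_adjacent hg hne.2.2.2 hne.1
  have hl' : g ∈ cl r {b, a} := by rwa [pair_comm]
  clear hC
  rcases ha with rfl | rfl | rfl | rfl <;> rcases hb with rfl | rfl | rfl | rfl <;>
    first
    | exact absurd rfl hab
    | exact absurd hl (by assumption)
    | exact absurd hl' (by assumption)
    | exact Or.inl ⟨by assumption, by simp, by simp⟩
    | exact Or.inr ⟨by assumption, by simp, by simp⟩

/-- The cycle spans the matroid, which has one further point, the intersection of the lines spanned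
by opposite intersections with `H`. -/
theorem hasCode (hC : QuadCycle r H w x y z h₁ h₂ h₃ h₄) : HasCode r codeK33 := by
  have a1 := hC.adjacent_ne
  have a2 := hC.rotate.adjacent_ne
  have a3 := hC.rotate.rotate.adjacent_ne
  have a4 := hC.rotate.rotate.rotate.adjacent_ne
  have o1 := hC.opposite_ne
  have o2 := hC.rotate.opposite_ne
  obtain ⟨hQ, ho, hn, hm, hl⟩ := id hC
  have hr := hQ.crit
  have h4 := hQ.rank
  have hnd : ([w, x, y, z] ++ [h₁, h₂, h₃, h₄]).Nodup := by
    rw [List.nodup_append]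
    refine ⟨?_, ?_, fun s hs t ht hst ↦ ?_⟩
    · simp only [List.nodup_cons, List.mem_cons, List.not_mem_nil, or_false, not_false_eq_true,
        List.nodup_nil, and_true]
      clear * - hn
      tauto
    · simp only [List.nodup_cons, List.mem_cons, List.not_mem_nil, or_false, not_false_eq_true,
        List.nodup_nil, and_true]
      clear * - a1 a2 a3 a4 o1 o2
      grind
    · subst hst
      simp only [List.mem_cons, List.not_mem_nil, or_false] at hs ht
      have hs' : s ∉ H := by rcases hs with rfl | rfl | rfl | rfl <;> tauto
      exact hs' (by rcases ht with rfl | rfl | rfl | rfl <;> tauto)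
  simp only [List.cons_append, List.nil_append] at hnd
  have h8 := List.toFinset_card_of_nodup hnd
  simp only [List.length_cons, List.length_nil] at h8
  have hsub : [w, x, y, z, h₁, h₂, h₃, h₄].toFinset ⊆ cl r {w, x, y, z} := by
    have mw : w ∈ cl r {w, x, y, z} := subset_cl (by simp)
    have mx : x ∈ cl r {w, x, y, z} := subset_cl (by simp)
    have my : y ∈ cl r {w, x, y, z} := subset_cl (by simp)
    have mz : z ∈ cl r {w, x, y, z} := subset_cl (by simp)
    intro t ht
    simp only [List.mem_toFinset, List.mem_cons, List.not_mem_nil, or_false] at ht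
    rcases ht with rfl | rfl | rfl | rfl | rfl | rfl | rfl | rfl
    · exact mw
    · exact mx
    · exact my
    · exact mz
    · exact hr.rank.cl_pair_mono mw mx hl.1
    · exact hr.rank.cl_pair_mono mx my hl.2.1
    · exact hr.rank.cl_pair_mono my mz hl.2.2.1
    · exact hr.rank.cl_pair_mono mz mw hl.2.2.2
  have hu : r univ = 4 := by
    by_contra hne
    have h1 := hr.rank.rk_le_card {w, x, y, z}
    have h2 : ({w, x, y, z} : Finset β).card ≤ 4 := card_le_four
    have h3 := hr.rank.rk_cl {w, x, y, z}
    have h5 := hr.card_lt hQ.tight (T := cl r {w, x, y, z}) ⟨w, subset_cl (by simp)⟩ (by omega)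
    have h6 := card_le_card hsub
    omega
  have hc := hr.card_univ
  obtain ⟨g, hg⟩ := card_eq_one.1 (show ([w, x, y, z, h₁, h₂, h₃, h₄].toFinsetᶜ).card = 1 by
    have := card_add_card_compl [w, x, y, z, h₁, h₂, h₃, h₄].toFinset
    omega)
  have hmem : ∀ t, t ≠ g → t = w ∨ t = x ∨ t = y ∨ t = z ∨ t = h₁ ∨ t = h₂ ∨ t = h₃ ∨ t = h₄ := by
    intro t htg
    by_contra hcon
    have : t ∈ [w, x, y, z, h₁, h₂, h₃, h₄].toFinsetᶜ := by
      rw [mem_compl, List.mem_toFinset]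
      simpa only [List.mem_cons, List.not_mem_nil, or_false] using hcon
    rw [hg, mem_singleton] at this
    exact htg this
  have hg' : g ∈ [w, x, y, z, h₁, h₂, h₃, h₄].toFinsetᶜ := by rw [hg]; exact mem_singleton_self g
  rw [mem_compl, List.mem_toFinset] at hg'
  simp only [List.mem_cons, List.not_mem_nil, or_false, not_or] at hg'
  obtain ⟨gw, gx, gy, gz, g1, g2, g3, g4⟩ := hg'
  have hHc : Hᶜ = {w, x, y, z} := by
    symm
    refine eq_of_subset_of_card_le ?_ ?_
    · intro t ht
      simp only [mem_insert, mem_singleton] at ht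
      rw [mem_compl]
      rcases ht with rfl | rfl | rfl | rfl
      exacts [ho.1, ho.2.1, ho.2.2.1, ho.2.2.2]
    · rw [hQ.card, card_insert_of_notMem, card_eq_three.2 ⟨x, y, z, hn.2.2.2.1, hn.2.2.2.2.1,
        hn.2.2.2.2.2, rfl⟩]
      simp only [mem_insert, mem_singleton, not_or]
      exact ⟨hn.1, hn.2.1, hn.2.2.1⟩
  have hgH : g ∈ H := by
    by_contra h
    rw [← mem_compl, hHc] at h
    simp only [mem_insert, mem_singleton] at h
    exact h.elim gw fun h ↦ h.elim gx fun h ↦ h.elim gy gz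
  -- the lines through `g` with three points
  have hgne : g ≠ h₁ ∧ g ≠ h₂ ∧ g ≠ h₃ ∧ g ≠ h₄ := ⟨g1, g2, g3, g4⟩
  have hout : ∀ t, t ∉ H → t = w ∨ t = x ∨ t = y ∨ t = z := by
    intro t ht
    rw [← mem_compl, hHc] at ht
    simpa only [mem_insert, mem_singleton] using ht
  have hin : ∀ t, t ∈ H → t ≠ g → t = h₁ ∨ t = h₂ ∨ t = h₃ ∨ t = h₄ := by
    intro t ht htg
    rcases hmem t htg with rfl | rfl | rfl | rfl | h
    · exact absurd ht ho.1
    · exact absurd ht ho.2.1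
    · exact absurd ht ho.2.2.1
    · exact absurd ht ho.2.2.2
    · exact h
  have key : ∀ a b, a ≠ b → a ≠ g → b ≠ g → b ∈ cl r {a, g} →
      (g ∈ cl r {h₁, h₃} ∧ (a = h₁ ∨ a = h₃) ∧ (b = h₁ ∨ b = h₃)) ∨
      (g ∈ cl r {h₂, h₄} ∧ (a = h₂ ∨ a = h₄) ∧ (b = h₂ ∨ b = h₄)) := by
    intro a b hab hag hbg hbl
    have hgl : g ∈ cl r {a, b} := hr.mem_cl_pair hab left_mem_cl hbl right_mem_cl
    by_cases ha : a ∈ H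
    · by_cases hb : b ∈ H
      · exact hC.inner_line hgH hgne hab (hin a ha hag) (hin b hb hbg) hgl
      · exact (hr.not_both_mem hQ.flat hb hag hgl ⟨ha, hgH⟩).elim
    · by_cases hb : b ∈ H
      · exact (hr.not_both_mem hQ.flat ha hbg (by rwa [pair_comm]) ⟨hb, hgH⟩).elim
      · exact absurd hgl (hC.notMem_outer hgH hgne hab (hout a ha) (hout b hb))
  obtain ⟨a, b, c, d, hab, hcd, hag, hbg, hcg, hdg, hbc, hbd, hl1, hl2⟩ :=
    hr.exists_two_triangles g
  have k1 := key a b hab hag hbg hl1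
  have k2 := key c d hcd hcg hdg hl2
  have hfin : g ∈ cl r {h₁, h₃} ∧ g ∈ cl r {h₄, h₂} := by
    rw [pair_comm h₄]
    clear * - k1 k2 hab hcd hbc hbd
    grind
  have hcard : Fintype.card β = 9 := by omega
  have hset : univ.image ![w, x, h₁, z, y, h₃, h₄, h₂, g] = (univ : Finset β) := by
    ext t
    have := hmem t
    clear * - this
    simp [Fin.exists_fin_succ, eq_comm]
    tauto
  obtain ⟨e, he⟩ := exists_equiv _ hset hcard
  refine Grid.hasCode (e := e) hr hQ.tight hu ⟨?_⟩
  simp only [List.forall_mem_cons, List.not_mem_nil, false_imp_iff, implies_true, and_true,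
    map_insert, map_singleton, Equiv.coe_toEmbedding, he]
  exact ⟨hr.rk_triple hn.1 hl.1, hr.rk_triple hn.2.2.2.2.2.symm (by rw [pair_comm]; exact hl.2.2.1),
    hr.rk_triple o2.symm hfin.2, hr.rk_triple hn.2.2.1 (by rw [pair_comm]; exact hl.2.2.2),
    hr.rk_triple hn.2.2.2.1 hl.2.1, hr.rk_triple o1 hfin.1⟩

end QuadCycle

/-- A critical matroid is one of the ten matroids. -/
theorem IsCrit.exists_hasCode (hr : IsCrit r) : ∃ c ∈ tenCodes, HasCode r c.2 := by
  by_cases hnt : ∀ F, F.Nonempty → cl r F = F → F ≠ univ → F.card ≠ 2 * r F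
  · have h2 := hr.two_le_rk
    by_cases hu2 : r univ = 2
    · exact ⟨⟨_, codeU25⟩, by simp [tenCodes], hr.hasCode_u25 hu2⟩
    by_cases hu3 : r univ = 3
    · rcases hr.hasCode_of_rk_three (hr.no_four_on_line hnt hu3.ge) hu3 with h | h | h
      · exact ⟨⟨_, codeP7⟩, by simp [tenCodes], h⟩
      · exact ⟨⟨_, codeFano⟩, by simp [tenCodes], h⟩
      · exact ⟨⟨_, codeNonFano⟩, by simp [tenCodes], h⟩
    · obtain ⟨H, hcl, hH⟩ := hr.exists_almost_tight_hyperplane hnt h2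
      obtain ⟨w, x, y, z, h₁, h₂, h₃, h₄, hC⟩ :=
        IsQuad.exists_cycle ⟨hr, hnt, by omega, hcl, hH⟩
      exact ⟨⟨_, codeK33⟩, by simp [tenCodes], hC.hasCode⟩
  · push Not at hnt
    obtain ⟨F, hF, hcl, hne, ht⟩ := hnt
    exact hr.hasCode_of_tight hF hcl hne ht

end

/-! ### The ten matroids are critical -/

section

variable {β : Type*} [DecidableEq β] {r : Finset β → ℕ}

theorem IsRank.comap {γ : Type*} [DecidableEq γ] (hr : IsRank r) (f : γ ↪ β) :
    IsRank fun S : Finset γ ↦ r (S.map f) where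
  empty := by simp [hr.empty]
  mono _ _ h := hr.mono (map_subset_map.2 h)
  insert_le x S := by simpa using hr.insert_le (f x) (S.map f)
  submod S T := by simpa only [map_union, map_inter] using hr.submod (S.map f) (T.map f)

end

/-- Representatives of the parallel classes of the contraction by an independent set `C`, for the
matroid described by `L`. -/
def classReps {n : ℕ} (L : List (Finset (Fin n) × ℕ)) (C : Finset (Fin n)) : Finset (Fin n) :=
  univ.filter fun x ↦ x ∉ C ∧ CodeIndep L (insert x C) ∧
    ∀ y < x, y ∉ C → CodeIndep L (insert y C) → CodeIndep L (insert x (insert y C))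

section

variable {n k : ℕ} {L : List (Finset (Fin n) × ℕ)} {r : Finset (Fin n) → ℕ} {C T X : Finset (Fin n)}

theorem card_le_classReps (hr : IsRank r) (h : ∀ S, r S = S.card ↔ CodeIndep L S)
    (hC : r C = C.card) (h1 : ∀ x ∈ T, x ∉ cl r C)
    (h2 : ∀ x ∈ T, ∀ y ∈ T, x ≠ y → x ∉ cl r (insert y C)) : T.card ≤ (classReps L C).card := by
  -- the representative of the parallel class of `x`
  have hne : ∀ x ∈ T, (univ.filter fun y ↦ y ∉ cl r C ∧ y ∈ cl r (insert x C)).Nonempty :=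
    fun x hx ↦ ⟨x, by simp [h1 x hx, subset_cl (mem_insert_self x C)]⟩
  have hf : ∀ x ∈ T, ∃ y, y ∉ cl r C ∧ y ∈ cl r (insert x C) ∧
      ∀ z, z ∉ cl r C → z ∈ cl r (insert x C) → y ≤ z := by
    intro x hx
    have hm := min'_mem _ (hne x hx)
    simp only [mem_filter, mem_univ, true_and] at hm
    exact ⟨_, hm.1, hm.2, fun z hz hz' ↦ min'_le _ _ (by simp [hz, hz'])⟩
  choose! f hf0 hf1 hf2 using hf
  have hcl : ∀ x ∈ T, x ∈ cl r (insert (f x) C) := fun x hx ↦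
    hr.exchange (hf1 x hx) (hf0 x hx)
  have hind : ∀ {y}, y ∉ cl r C → CodeIndep L (insert y C) := by
    intro y hy
    rw [← h, hr.rk_insert hy, hC, card_insert_of_notMem fun hyC ↦ hy (subset_cl hyC)]
  refine card_le_card_of_injOn f (fun x hx ↦ ?_) (fun x hx y hy hxy ↦ ?_)
  · rw [mem_coe] at hx
    simp only [classReps, coe_filter, mem_univ, true_and, Set.mem_ofPred_eq]
    refine ⟨fun hfC ↦ hf0 x hx (subset_cl hfC), hind (hf0 x hx), fun y hy hyC hyi ↦ ?_⟩
    have hyC' : y ∉ cl r C := by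
      rw [← h, card_insert_of_notMem hyC] at hyi
      rw [mem_cl]
      omega
    have hfy : f x ∉ cl r (insert y C) := by
      intro hc
      have hy' := hr.exchange hc (hf0 x hx)
      refine absurd (hf2 x hx y hyC' ?_) (not_le.2 hy)
      refine hr.cl_subset ?_ hy'
      exact insert_subset (hf1 x hx) ((subset_insert _ _).trans subset_cl)
    rw [← h, hr.rk_insert hfy, hr.rk_insert hyC', hC, card_insert_of_notMem,
      card_insert_of_notMem hyC]
    exact fun h' ↦ hfy (subset_cl h')
  · rw [mem_coe] at hx hy
    by_contra hne
    refine h2 x hx y hy hne (hr.cl_subset ?_ (hcl x hx))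
    rw [hxy]
    exact insert_subset (hf1 y hy) ((subset_insert _ _).trans subset_cl)

/-- To bound the number of elements of the simple restrictions of the contractions of a matroid, it
suffices to consider spanning restrictions of contractions by independent sets. -/
theorem contr_of_spanning {β : Type*} [DecidableEq β] [Fintype β] {r : Finset β → ℕ}
    (hr : IsRank r)
    (h : ∀ C T : Finset β, C.Nonempty → r C = C.card → (∀ x ∈ T, x ∉ cl r C) →
      (∀ x ∈ T, ∀ y ∈ T, x ≠ y → x ∉ cl r (insert y C)) → T.card + 2 * r C ≤ 2 * r univ)
    (h1 : ∀ x, r {x} = 1) :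
    ∀ X T : Finset β, X.Nonempty → (∀ x ∈ T, r (insert x X) = r X + 1) →
    (∀ x ∈ T, ∀ y ∈ T, x ≠ y → r (insert x (insert y X)) = r X + 2) →
    T.card + 2 * r X ≤ 2 * r (T ∪ X) := by
  intro X T
  induction hd : r univ - r (T ∪ X) using Nat.strong_induction_on generalizing X with
  | _ d ih =>
  intro hX hT1 hT2
  have hle := hr.mono (subset_univ (T ∪ X))
  by_cases hsp : r (T ∪ X) = r univ
  · obtain ⟨C, hCX, hC, hCr⟩ := hr.exists_basis X
    have hXC : X ⊆ cl r C := hr.subset_cl_of_le hCX hCr.ge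
    have hclC : ∀ S, cl r (S ∪ C) = cl r (S ∪ X) := fun S ↦
      (hr.cl_eq (union_subset_union_right hCX |>.trans subset_cl)
        ((union_subset (subset_union_left.trans subset_cl)
          (hXC.trans (hr.cl_mono subset_union_right)))))
    obtain ⟨a, ha⟩ := hX
    have hCne : C.Nonempty := by
      rw [nonempty_iff_ne_empty]
      rintro rfl
      have := hr.mono (singleton_subset_iff.2 ha)
      rw [h1, ← hCr, hr.empty] at this
      omega
    rw [hsp, ← hCr]
    refine h C T hCne hC (fun x hx ↦ ?_) (fun x hx y hy hxy ↦ ?_)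
    · have := hclC ∅
      rw [empty_union, empty_union] at this
      rw [this, mem_cl, hT1 x hx]
      omega
    · have := hclC {y}
      rw [singleton_union, singleton_union] at this
      rw [this, mem_cl, hT2 x hx y hy hxy, hT1 y hy]
      omega
  · obtain ⟨z, hz⟩ : ∃ z, z ∉ cl r (T ∪ X) := by
      by_contra! hcon
      have h2 := hr.rk_cl (T ∪ X)
      rw [show cl r (T ∪ X) = univ from eq_univ_iff_forall.2 hcon] at h2
      omega
    have hadd : ∀ S ⊆ T ∪ X, r (insert z S) = r S + 1 := fun S hS ↦
      hr.rk_insert fun hc ↦ hz (hr.cl_mono hS hc)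
    have hTX : ∀ x ∈ T, insert x X ⊆ T ∪ X := fun x hx ↦
      insert_subset (mem_union_left _ hx) subset_union_right
    have e1 := hadd X subset_union_right
    have e2 := hadd (T ∪ X) subset_rfl
    have e3 : T ∪ insert z X = insert z (T ∪ X) := union_insert z T X
    have := ih (r univ - r (T ∪ insert z X)) (by rw [e3, e2]; omega) (insert z X) rfl
      (insert_nonempty _ _)
      (fun x hx ↦ by rw [insert_comm, hadd _ (hTX x hx), hT1 x hx, e1])
      (fun x hx y hy hxy ↦ by
        rw [insert_comm y z, insert_comm x z, hadd _ (insert_subset (mem_union_left _ hx) (hTX y hy)),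
          hT2 x hx y hy hxy, e1])
    rw [e3, e2, e1] at this
    omega

/-- A finite check that implies criticality: the sets `univ.erase x` are unions of two independent
sets, and contractions have few parallel classes. -/
theorem isCrit_of_code (hr : IsRank r) (h : ∀ S, r S = S.card ↔ CodeIndep L S)
    (hn : n = 2 * k + 1) (hk : (univ, k) ∈ L) (simple : ∀ x y, CodeIndep L {x, y})
    (cover : ∀ x, ∃ I, CodeIndep L I ∧ CodeIndep L ((univ.erase x) \ I))
    (classes : ∀ j ∈ Finset.Ico 1 (k - 1), ∀ C ∈ powersetCard j univ, CodeIndep L C →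
      (classReps L C).card ≤ 2 * (k - j)) : IsCrit r := by
  have hle : ∀ S, r S ≤ k := by
    intro S
    obtain ⟨B, hBS, hB, hBr⟩ := hr.exists_basis S
    have := (h B).1 hB _ hk
    rw [inter_univ] at this
    omega
  have restr : ∀ T : Finset (Fin n), T ≠ univ → T.card ≤ 2 * r T := by
    intro T hT
    obtain ⟨x, hx⟩ : ∃ x, x ∉ T := by
      by_contra! hcon
      exact hT (eq_univ_iff_forall.2 hcon)
    obtain ⟨I, hI, hJ⟩ := cover x
    rw [← h] at hI hJ
    have h1 := hr.subset_of_indep (inter_subset_right : T ∩ I ⊆ I) hI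
    have h2 := hr.subset_of_indep (show T \ I ⊆ (univ.erase x) \ I from
      sdiff_subset_sdiff (fun y hy ↦ mem_erase.2 ⟨fun h ↦ hx (h ▸ hy), mem_univ y⟩) subset_rfl) hJ
    have h3 := hr.mono (inter_subset_left : T ∩ I ⊆ T)
    have h4 := hr.mono (sdiff_subset : T \ I ⊆ T)
    have h5 := card_inter_add_card_sdiff T I
    omega
  have huniv : r univ = k := by
    refine le_antisymm (hle _) ?_
    let x : Fin n := ⟨0, by omega⟩
    have h1 := restr (univ.erase x) (by simp)
    have h2 := hr.mono (subset_univ (univ.erase x))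
    rw [card_erase_of_mem (mem_univ x), card_univ, Fintype.card_fin] at h1
    omega
  have hs : ∀ x y, r {x, y} = ({x, y} : Finset (Fin n)).card := fun x y ↦ (h _).2 (simple x y)
  refine ⟨hr, hs, by rw [huniv, Fintype.card_fin]; omega, restr, contr_of_spanning hr ?_
    fun x ↦ by simpa using hs x x⟩
  intro C T hC hCi hT1 hT2
  have hCk := hle C
  have hCpos := card_pos.2 hC
  have hC1 := card_le_classReps hr h hCi hT1 hT2
  rw [huniv]
  by_cases hlt : C.card < k - 1
  · have := classes C.card (mem_Ico.2 ⟨hCpos, hlt⟩) C (mem_powersetCard.2 ⟨subset_univ _, rfl⟩)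
      ((h C).1 hCi)
    omega
  · have hT : T.card ≤ 1 := by
      rw [card_le_one]
      intro x hx y hy
      by_contra hxy
      have h1 := hr.rk_insert (hT2 x hx y hy hxy)
      rw [hr.rk_insert (hT1 y hy)] at h1
      have := hle (insert x (insert y C))
      omega
    rcases Nat.le_one_iff_eq_zero_or_eq_one.1 hT with h0 | h0
    · omega
    · obtain ⟨x, hx⟩ := card_eq_one.1 h0
      have h1 := hr.rk_insert (hT1 x (by simp [hx]))
      have := hle (insert x C)
      omega

end

/-! ### Bit masks -/

/-- Whether the natural number `m` has at most `k` binary digits `1`. -/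
def atMostBits : ℕ → ℕ → Bool
  | 0, m => m == 0
  | k + 1, m => m == 0 || atMostBits k (m &&& (m - 1))

/-- `CodeIndep` for sets given as bit masks. -/
def maskIndep (L : List (ℕ × ℕ)) (m : ℕ) : Bool :=
  L.all fun q ↦ atMostBits q.2 (m &&& q.1)

/-- `classReps` for sets given as bit masks. -/
def maskReps (n : ℕ) (L : List (ℕ × ℕ)) (m : ℕ) : List ℕ :=
  (List.range n).filter fun x ↦ !m.testBit x && (maskIndep L (m ||| 2 ^ x) &&
    (List.range x).all fun y ↦ m.testBit y || (!maskIndep L (m ||| 2 ^ y) ||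
      maskIndep L (m ||| 2 ^ y ||| 2 ^ x)))

/-- The bit mask of a set. -/
def mask {n : ℕ} (S : Finset (Fin n)) : ℕ := Nat.ofBits fun i ↦ decide (i ∈ S)

/-- The condition on contractions in `isCrit_of_code`, for sets given as bit masks. -/
def maskCheck (n k : ℕ) (L : List (ℕ × ℕ)) : Bool :=
  (List.range (2 ^ n)).all fun m ↦ (List.range (k - 1)).all fun j ↦
    j == 0 || (!atMostBits j m || (atMostBits (j - 1) m || (!maskIndep L m ||
      (maskReps n L m).length ≤ 2 * (k - j))))

theorem length_bitIndices_clear {m : ℕ} (hm : m ≠ 0) :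
    (m &&& (m - 1)).bitIndices.length + 1 = m.bitIndices.length := by
  induction m using Nat.strong_induction_on with
  | _ m ih =>
  obtain ⟨a, rfl | rfl⟩ := Nat.even_or_odd' m
  · have ha : a ≠ 0 := by omega
    have h : 2 * a &&& (2 * a - 1) = 2 * (a &&& (a - 1)) := by
      refine Nat.eq_of_testBit_eq fun i ↦ ?_
      rw [show 2 * a - 1 = 2 * (a - 1) + 1 by omega]
      rcases i with _ | i
      · simp
      · rw [Nat.testBit_and]
        simp only [Nat.testBit_succ]
        rw [show 2 * a / 2 = a by omega, show (2 * (a - 1) + 1) / 2 = a - 1 by omega,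
          show 2 * (a &&& (a - 1)) / 2 = a &&& (a - 1) by omega, Nat.testBit_and]
    rw [h, Nat.bitIndices_two_mul, Nat.bitIndices_two_mul, List.length_map, List.length_map]
    exact ih a (by omega) ha
  · have h : (2 * a + 1) &&& (2 * a + 1 - 1) = 2 * a := by
      refine Nat.eq_of_testBit_eq fun i ↦ ?_
      rcases i with _ | i
      · simp
      · rw [Nat.testBit_and]
        simp only [Nat.testBit_succ]
        rw [show (2 * a + 1 - 1) / 2 = a by omega, show (2 * a + 1) / 2 = a by omega,
          show 2 * a / 2 = a by omega, Bool.and_self]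
    rw [h, Nat.bitIndices_two_mul, Nat.bitIndices_two_mul_add_one, List.length_cons]

theorem atMostBits_iff {k m : ℕ} : atMostBits k m = true ↔ m.bitIndices.length ≤ k := by
  induction k generalizing m with
  | zero =>
    simp only [atMostBits, beq_iff_eq, Nat.le_zero, List.length_eq_zero_iff]
    refine ⟨fun h ↦ by simp [h], fun h ↦ ?_⟩
    by_contra hm
    have := length_bitIndices_clear hm
    rw [h] at this
    simp at this
  | succ k ih =>
    simp only [atMostBits, Bool.or_eq_true, beq_iff_eq, ih]
    by_cases hm : m = 0
    · simp [hm]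
    · have := length_bitIndices_clear hm
      simp only [hm, false_or]
      omega

section

variable {n k : ℕ} {L : List (Finset (Fin n) × ℕ)} {S T : Finset (Fin n)} {x : Fin n} {i : ℕ}

theorem testBit_mask : (mask S).testBit i = true ↔ ∃ h : i < n, (⟨i, h⟩ : Fin n) ∈ S := by
  rw [mask, Nat.testBit_ofBits]
  split_ifs with h
  · simp [h]
  · simp [h]

theorem testBit_mask_val : (mask S).testBit x = true ↔ x ∈ S := by
  simp [testBit_mask]

theorem mask_inter : mask (S ∩ T) = mask S &&& mask T := by
  refine Nat.eq_of_testBit_eq fun i ↦ ?_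
  rw [Bool.eq_iff_iff, Nat.testBit_and, Bool.and_eq_true]
  simp only [testBit_mask, mem_inter]
  grind

theorem mask_insert : mask (insert x S) = mask S ||| 2 ^ (x : ℕ) := by
  refine Nat.eq_of_testBit_eq fun i ↦ ?_
  rw [Bool.eq_iff_iff, Nat.testBit_or, Bool.or_eq_true, Nat.testBit_two_pow, decide_eq_true_iff]
  simp only [testBit_mask, mem_insert, Fin.ext_iff]
  have := x.2
  grind

theorem length_bitIndices_mask : (mask S).bitIndices.length = S.card := by
  rw [← List.toFinset_card_of_nodup Nat.bitIndices_nodup, ← card_map Fin.valEmbedding]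
  congr 1
  ext i
  simp only [List.mem_toFinset, Nat.mem_bitIndices, testBit_mask, mem_map, Fin.valEmbedding_apply]
  constructor
  · rintro ⟨h, h'⟩
    exact ⟨_, h', rfl⟩
  · rintro ⟨a, ha, rfl⟩
    exact ⟨a.2, ha⟩

theorem mask_lt : mask S < 2 ^ n := Nat.ofBits_lt_two_pow _

theorem maskIndep_iff :
    maskIndep (L.map fun q ↦ (mask q.1, q.2)) (mask S) = true ↔ CodeIndep L S := by
  simp [maskIndep, CodeIndep, atMostBits_iff, ← mask_inter, length_bitIndices_mask]

theorem card_classReps_le :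
    (classReps L S).card ≤ (maskReps n (L.map fun q ↦ (mask q.1, q.2)) (mask S)).length := by
  refine le_trans ?_ (List.toFinset_card_le _)
  rw [← card_map Fin.valEmbedding]
  refine card_le_card fun i hi ↦ ?_
  obtain ⟨x, hx, rfl⟩ := mem_map.1 hi
  simp only [classReps, mem_filter, mem_univ, true_and] at hx
  simp only [maskReps, List.mem_toFinset, List.mem_filter, List.mem_range, Fin.valEmbedding_apply,
    x.2, true_and, Bool.and_eq_true, List.all_eq_true, Bool.or_eq_true, Bool.not_eq_true',
    ← Bool.not_eq_true, testBit_mask_val, ← mask_insert, maskIndep_iff]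
  refine ⟨hx.1, hx.2.1, fun y hy ↦ ?_⟩
  have h := hx.2.2 ⟨y, hy.trans x.2⟩ hy
  have h1 : (mask S).testBit y = true ↔ (⟨y, hy.trans x.2⟩ : Fin n) ∈ S :=
    testBit_mask_val (x := ⟨y, hy.trans x.2⟩)
  have h2 : mask S ||| 2 ^ y = mask (insert (⟨y, hy.trans x.2⟩ : Fin n) S) :=
    (mask_insert (x := ⟨y, hy.trans x.2⟩)).symm
  rw [h1, h2, ← mask_insert, maskIndep_iff, maskIndep_iff]
  tauto

theorem classes_of_maskCheck (h : maskCheck n k (L.map fun q ↦ (mask q.1, q.2)) = true) :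
    ∀ j ∈ Finset.Ico 1 (k - 1), ∀ C ∈ powersetCard j univ, CodeIndep L C →
      (classReps L C).card ≤ 2 * (k - j) := by
  intro j hj C hC hCi
  rw [mem_Ico] at hj
  have hCc := (mem_powersetCard.1 hC).2
  simp only [maskCheck, List.all_eq_true, List.mem_range, Bool.or_eq_true, Bool.not_eq_true',
    ← Bool.not_eq_true, decide_eq_true_iff, beq_iff_eq, atMostBits_iff] at h
  have h1 := h (mask C) mask_lt j hj.2
  rw [length_bitIndices_mask, maskIndep_iff] at h1
  have h2 := card_classReps_le (L := L) (S := C)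
  rcases h1 with h1 | h1 | h1 | h1 | h1
  · omega
  · omega
  · omega
  · exact absurd hCi h1
  · exact h2.trans h1

end

section

variable {β γ : Type*} [DecidableEq β] [Fintype β] [DecidableEq γ] [Fintype γ] {r : Finset β → ℕ}

theorem IsCrit.of_comap (e : γ ≃ β) (hr : IsRank r)
    (h : IsCrit fun S : Finset γ ↦ r (S.map e.toEmbedding)) : IsCrit r := by
  have key : ∀ S : Finset β, ∃ T : Finset γ, S = T.map e.toEmbedding := fun S ↦
    ⟨S.map e.symm.toEmbedding, by ext; simp⟩
  refine ⟨hr, fun x y ↦ ?_, ?_, fun T hT ↦ ?_, fun X T hX h1 h2 ↦ ?_⟩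
  · have := h.simple (e.symm x) (e.symm y)
    rw [← card_map e.toEmbedding] at this
    simpa using this
  · have := h.dense
    rw [map_univ_equiv, Fintype.card_congr e] at this
    exact this
  · obtain ⟨T, rfl⟩ := key T
    rw [card_map]
    refine h.restr T ?_
    rintro rfl
    exact hT (map_univ_equiv e)
  · obtain ⟨T, rfl⟩ := key T
    obtain ⟨X, rfl⟩ := key X
    have := h.contr X T (by simpa using hX) (fun x hx ↦ ?_) (fun x hx y hy hxy ↦ ?_)
    · rw [card_map, ← map_union]
      exact this
    · simpa using h1 (e x) (mem_map_of_mem _ hx)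
    · simpa using h2 (e x) (mem_map_of_mem _ hx) (e y) (mem_map_of_mem _ hy) (e.injective.ne hxy)

/-- The properties of a description by flats that are checked by computation. -/
structure IsCritCode {n : ℕ} (k : ℕ) (L : List (Finset (Fin n) × ℕ)) : Prop where
  size : n = 2 * k + 1
  rank : (univ, k) ∈ L
  simple : ∀ x y, CodeIndep L {x, y}
  cover : ∀ x, ∃ I, CodeIndep L I ∧ CodeIndep L ((univ.erase x) \ I)
  classes : maskCheck n k (L.map fun q ↦ (mask q.1, q.2)) = true

theorem isCrit_of_hasCode {n k : ℕ} {L : List (Finset (Fin n) × ℕ)} (hL : IsCritCode k L)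
    (hr : IsRank r) (h : HasCode r L) : IsCrit r := by
  obtain ⟨v, hv⟩ := h
  exact IsCrit.of_comap v hr (isCrit_of_code (hr.comap _) hv hL.size hL.rank hL.simple hL.cover
    (classes_of_maskCheck hL.classes))

end

theorem isCritCode_u25 : IsCritCode 2 codeU25 :=
  ⟨rfl, by decide +kernel, by decide +kernel, by decide +kernel, by decide +kernel⟩

theorem isCritCode_puu : IsCritCode 3 codePUU :=
  ⟨rfl, by decide +kernel, by decide +kernel, by decide +kernel, by decide +kernel⟩

theorem isCritCode_o7 : IsCritCode 3 codeO7 :=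
  ⟨rfl, by decide +kernel, by decide +kernel, by decide +kernel, by decide +kernel⟩

theorem isCritCode_p7 : IsCritCode 3 codeP7 :=
  ⟨rfl, by decide +kernel, by decide +kernel, by decide +kernel, by decide +kernel⟩

theorem isCritCode_nonFano : IsCritCode 3 codeNonFano :=
  ⟨rfl, by decide +kernel, by decide +kernel, by decide +kernel, by decide +kernel⟩

theorem isCritCode_fano : IsCritCode 3 codeFano :=
  ⟨rfl, by decide +kernel, by decide +kernel, by decide +kernel, by decide +kernel⟩

theorem isCritCode_puk : IsCritCode 4 codePUK :=
  ⟨rfl, by decide +kernel, by decide +kernel, by decide +kernel, by decide +kernel⟩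

theorem isCritCode_k5e : IsCritCode 4 codeK5e :=
  ⟨rfl, by decide +kernel, by decide +kernel, by decide +kernel, by decide +kernel⟩

theorem isCritCode_k33 : IsCritCode 4 codeK33 :=
  ⟨rfl, by decide +kernel, by decide +kernel, by decide +kernel, by decide +kernel⟩

theorem isCritCode_pkk : IsCritCode 5 codePKK :=
  ⟨rfl, by decide +kernel, by decide +kernel, by decide +kernel, by decide +kernel⟩

theorem isCritCode_of_mem_tenCodes : ∀ c ∈ tenCodes, ∃ k, IsCritCode k c.2 := by
  simp only [tenCodes, List.forall_mem_cons, List.not_mem_nil, false_imp_iff, implies_true,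
    and_true]
  exact ⟨⟨_, isCritCode_u25⟩, ⟨_, isCritCode_puu⟩, ⟨_, isCritCode_o7⟩, ⟨_, isCritCode_p7⟩,
    ⟨_, isCritCode_nonFano⟩, ⟨_, isCritCode_fano⟩, ⟨_, isCritCode_puk⟩, ⟨_, isCritCode_k5e⟩,
    ⟨_, isCritCode_k33⟩, ⟨_, isCritCode_pkk⟩⟩

/-! ### Critical matroids and their rank functions -/

section

variable {α : Type*} {M N : Matroid α} {I T X : Set α}

/-- A minor is a restriction of a contraction by an independent set. -/
theorem exists_eq_contract_restrict (h : N.IsMinor M) :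
    ∃ I T, M.Indep I ∧ T ⊆ M.E \ I ∧ N = (M.contract I).restrict T := by
  obtain ⟨C, D, hC, hD, hCD, rfl⟩ := h.exists_eq_contract_delete_disjoint
  obtain ⟨I, hI⟩ := M.exists_isBasis C
  refine ⟨I, ((M.E \ I) \ (C \ I)) \ D, hI.indep, Set.sdiff_subset.trans Set.sdiff_subset, ?_⟩
  rw [hI.contract_eq_contract_delete, Matroid.delete_eq_restrict, Matroid.delete_eq_restrict]
  exact Matroid.restrict_restrict_eq _ Set.sdiff_subset

theorem contract_restrict_isMinor (hT : T ⊆ M.E \ I) :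
    ((M.contract I).restrict T).IsMinor M := by
  rw [← Matroid.delete_compl (M := M.contract I) (R := T) hT]
  exact Matroid.contract_delete_isMinor _ _ _

theorem restrict_isMinor (hT : T ⊆ M.E) : (M.restrict T).IsMinor M := by
  have := contract_restrict_isMinor (M := M) (I := ∅) (T := T) (by simpa using hT)
  rwa [Matroid.contract_empty] at this

theorem eRank_contract_restrict (hI : M.Indep I) (hT : T ⊆ M.E \ I) :
    ((M.contract I).restrict T).eRank + I.encard = M.eRk (T ∪ I) := by
  obtain ⟨J, hJ⟩ := (M.contract I).exists_isBasis T hT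
  rw [Matroid.eRank_restrict, ← hJ.encard_eq_eRk,
    ← (hI.union_isBasis_union_of_contract_isBasis hJ).encard_eq_eRk, Set.encard_union_eq]
  exact (Set.disjoint_sdiff_left.mono_left hT).mono_left hJ.subset

theorem contract_restrict_indep_iff (hI : M.Indep I) (hT : T ⊆ M.E \ I) (hX : X ⊆ T) :
    ((M.contract I).restrict T).Indep X ↔ M.Indep (X ∪ I) := by
  rw [Matroid.restrict_indep_iff, hI.contract_indep_iff]
  have := Set.disjoint_sdiff_left.mono_left (hX.trans hT)
  tauto

theorem IsSimple.restrict (h : IsSimple M) (hT : T ⊆ M.E) : IsSimple (M.restrict T) :=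
  fun x hx y hy ↦ Matroid.restrict_indep_iff.2 ⟨h x (hT hx) y (hT hy),
    Set.insert_subset hx (Set.singleton_subset_iff.2 hy)⟩

end

/-- A simple matroid with more than twice as many elements as its rank, whose simple proper minors
have at most twice as many elements as their rank. -/
def IsCritical {α : Type*} (M : Matroid α) : Prop :=
  IsSimple M ∧ 2 * M.eRank.toNat < M.E.ncard ∧
    ∀ N : Matroid α, N.IsStrictMinor M → IsSimple N → N.E.ncard ≤ 2 * N.eRank.toNat

/-- The rank function of a matroid, on finite subsets of the ground set. -/
noncomputable def rkOn {α : Type*} (M : Matroid α) (S : Finset M.E) : ℕ :=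
  (M.eRk (Subtype.val '' (S : Set M.E))).toNat

section

variable {α : Type*} {M : Matroid α} {S : Finset M.E}

theorem encard_image_val : (Subtype.val '' (S : Set M.E)).encard = S.card := by
  rw [Subtype.val_injective.encard_image, Set.encard_coe_eq_coe_finsetCard]

theorem rkOn_univ [Fintype M.E] : rkOn M univ = M.eRank.toNat := by
  rw [rkOn, coe_univ, Set.image_univ, Subtype.range_coe, Matroid.eRk_ground]

end

section

variable {α : Type*} {M : Matroid α} [M.Finite] {S T : Finset M.E}

theorem cast_toNat_eRk (X : Set α) : ((M.eRk X).toNat : ℕ∞) = M.eRk X :=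
  ENat.natCast_toNat (Matroid.eRk_ne_top_iff.2 (M.isRkFinite_set X))

theorem cast_toNat_eRank : (M.eRank.toNat : ℕ∞) = M.eRank :=
  ENat.natCast_toNat ((Matroid.eRank_ne_top_iff M).2 inferInstance)

theorem cast_rkOn : (rkOn M S : ℕ∞) = M.eRk (Subtype.val '' (S : Set M.E)) := cast_toNat_eRk _

theorem indep_iff_rkOn : M.Indep (Subtype.val '' (S : Set M.E)) ↔ rkOn M S = S.card := by
  rw [Matroid.indep_iff_eRk_eq_encard, encard_image_val, ← cast_rkOn, Nat.cast_inj]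

theorem isRank_rkOn [DecidableEq M.E] : IsRank (rkOn M) where
  empty := by simp [rkOn]
  mono S T h := by
    rw [← Nat.cast_le (α := ℕ∞), cast_rkOn, cast_rkOn]
    exact M.eRk_mono (Set.image_mono (Finset.coe_subset.2 h))
  insert_le x S := by
    rw [← Nat.cast_le (α := ℕ∞), Nat.cast_add, cast_rkOn, cast_rkOn, coe_insert, Set.image_insert_eq]
    exact M.eRk_insert_le_add_one _ _
  submod S T := by
    rw [← Nat.cast_le (α := ℕ∞), Nat.cast_add, Nat.cast_add, cast_rkOn, cast_rkOn, cast_rkOn,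
      cast_rkOn, coe_union, coe_inter, Set.image_union, Set.image_inter Subtype.val_injective,
      add_comm]
    exact M.eRk_inter_add_eRk_union_le _ _

theorem indep_pair_iff [DecidableEq M.E] (x y : M.E) :
    M.Indep {(x : α), (y : α)} ↔ rkOn M {x, y} = ({x, y} : Finset M.E).card := by
  rw [← indep_iff_rkOn, coe_insert, coe_singleton, Set.image_insert_eq, Set.image_singleton]

theorem IsCritical.isCrit [DecidableEq M.E] [Fintype M.E] (h : IsCritical M) :
    IsCrit (rkOn M) := by
  obtain ⟨hs, hd, hm⟩ := h
  have hr := isRank_rkOn (M := M)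
  have hE : M.E.ncard = Fintype.card M.E := by
    rw [← Nat.card_coe_set_eq, Nat.card_eq_fintype_card]
  have hncard : ∀ T : Finset M.E, (Subtype.val '' (T : Set M.E)).ncard = T.card := fun T ↦ by
    rw [Set.ncard_image_of_injective _ Subtype.val_injective, Set.ncard_coe_finset]
  have hsub : ∀ T : Finset M.E, Subtype.val '' (T : Set M.E) ⊆ M.E := fun T ↦
    Subtype.coe_image_subset _ _
  refine ⟨hr, fun x y ↦ (indep_pair_iff x y).1 (hs x x.2 y y.2), by rwa [rkOn_univ, ← hE],
    fun T hT ↦ ?_, fun X T hX h1 h2 ↦ ?_⟩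
  · have := hm (M.restrict (Subtype.val '' (T : Set M.E)))
      (Matroid.isStrictMinor_iff_isMinor_ssubset.2 ⟨restrict_isMinor (hsub T), ?_⟩)
      (hs.restrict (hsub T))
    · rw [Matroid.eRank_restrict, Matroid.restrict_ground_eq, hncard] at this
      exact this
    · refine (hsub T).ssubset_of_ne fun h ↦ hT (eq_univ_iff_forall.2 fun x ↦ ?_)
      have hx : (x : α) ∈ Subtype.val '' (T : Set M.E) := by
        exact h.symm ▸ x.2
      simpa using hx
  · obtain ⟨B, hBX, hB, hBr⟩ := hr.exists_basis X
    have hXB : X ⊆ cl (rkOn M) B := hr.subset_cl_of_le hBX hBr.ge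
    have hBi : M.Indep (Subtype.val '' (B : Set M.E)) := indep_iff_rkOn.2 hB
    obtain ⟨b, hb⟩ : B.Nonempty := by
      obtain ⟨a, ha⟩ := hX
      rw [← card_pos, ← hB, hBr]
      have h3 := hr.mono (singleton_subset_iff.2 ha)
      have h4 := (indep_pair_iff a a).1 (hs a a.2 a a.2)
      rw [pair_eq_singleton, card_singleton] at h4
      omega
    have hTX : ∀ x ∈ T, x ∉ X := fun x hx hxX ↦ by
      have := h1 x hx
      rw [insert_eq_of_mem hxX] at this
      omega
    have hTsub : Subtype.val '' (T : Set M.E) ⊆ M.E \ Subtype.val '' (B : Set M.E) := by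
      rintro _ ⟨x, hx, rfl⟩
      refine ⟨x.2, ?_⟩
      rintro ⟨y, hy, hyx⟩
      rw [Subtype.val_injective hyx] at hy
      exact hTX x hx (hBX hy)
    have hBX' : ∀ S, rkOn M (S ∪ B) = rkOn M (S ∪ X) := fun S ↦
      hr.rk_eq (union_subset (subset_union_left.trans subset_cl)
        ((hBX.trans subset_union_right).trans subset_cl))
        (union_subset (subset_union_left.trans subset_cl)
        (hXB.trans (hr.cl_mono subset_union_right)))
    have hN := hm ((M.contract (Subtype.val '' (B : Set M.E))).restrict
      (Subtype.val '' (T : Set M.E)))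
      (Matroid.isStrictMinor_iff_isMinor_ssubset.2 ⟨contract_restrict_isMinor hTsub, ?_⟩) ?_
    · rw [Matroid.restrict_ground_eq, hncard] at hN
      have h3 := eRank_contract_restrict hBi hTsub
      rw [encard_image_val, ← Set.image_union, ← coe_union, ← cast_rkOn, hBX' T] at h3
      have h4 : ((M.contract (Subtype.val '' (B : Set M.E))).restrict
          (Subtype.val '' (T : Set M.E))).eRank.toNat + B.card = rkOn M (T ∪ X) := by
        have hne : ((M.contract (Subtype.val '' (B : Set M.E))).restrict
          (Subtype.val '' (T : Set M.E))).eRank ≠ ⊤ := fun h ↦ by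
          rw [h, top_add] at h3
          exact ENat.natCast_ne_top _ h3.symm
        rw [← ENat.natCast_toNat hne] at h3
        exact_mod_cast h3
      omega
    · rw [Matroid.restrict_ground_eq]
      refine (hsub T).ssubset_of_ne fun h ↦ ?_
      have : (b : α) ∈ Subtype.val '' (T : Set M.E) := h.symm ▸ b.2
      exact (hTsub this).2 ⟨b, hb, rfl⟩
    · rintro _ ⟨x, hx, rfl⟩ _ ⟨y, hy, rfl⟩
      have hxy : ({(x : α), (y : α)} : Set α) = Subtype.val '' (({x, y} : Finset M.E) : Set M.E) := by
        rw [coe_insert, coe_singleton, Set.image_insert_eq, Set.image_singleton]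
      rw [contract_restrict_indep_iff hBi hTsub (Set.insert_subset ⟨x, hx, rfl⟩
        (Set.singleton_subset_iff.2 ⟨y, hy, rfl⟩)), hxy, ← Set.image_union, ← coe_union,
        indep_iff_rkOn, hBX', card_union_of_disjoint, ← hB, hBr]
      · by_cases hne : x = y
        · subst hne
          rw [pair_eq_singleton, card_singleton, singleton_union, h1 x hx, add_comm]
        · rw [card_pair hne, insert_union, singleton_union, h2 x hx y hy hne, add_comm]
      · rw [disjoint_left]
        intro t ht htB
        simp only [mem_insert, mem_singleton] at ht
        rcases ht with rfl | rfl
        · exact hTX _ hx (hBX htB)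
        · exact hTX _ hy (hBX htB)

theorem IsCrit.isCritical [DecidableEq M.E] [Fintype M.E] (h : IsCrit (rkOn M)) :
    IsCritical M := by
  have hr := h.rank
  have hE : M.E.ncard = Fintype.card M.E := by
    rw [← Nat.card_coe_set_eq, Nat.card_eq_fintype_card]
  have hfin : ∀ T : Set α, T ⊆ M.E → ∃ S : Finset M.E, Subtype.val '' (S : Set M.E) = T :=
    fun T hT ↦ ⟨(Set.toFinite (Subtype.val ⁻¹' T)).toFinset, by
      rw [Set.Finite.coe_toFinset, Set.image_preimage_eq_of_subset (by simpa using hT)]⟩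
  refine ⟨fun x hx y hy ↦ (indep_pair_iff ⟨x, hx⟩ ⟨y, hy⟩).2 (h.simple _ _),
    by rw [hE, ← rkOn_univ]; exact h.dense, fun N hN hNs ↦ ?_⟩
  obtain ⟨I, T, hI, hT, rfl⟩ := exists_eq_contract_restrict hN.isMinor
  obtain ⟨B, rfl⟩ := hfin I hI.subset_ground
  obtain ⟨S, rfl⟩ := hfin T (hT.trans Set.sdiff_subset)
  have hB := indep_iff_rkOn.1 hI
  have h3 := eRank_contract_restrict hI hT
  rw [encard_image_val, ← Set.image_union, ← coe_union, ← cast_rkOn] at h3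
  have h4 : ((M.contract (Subtype.val '' (B : Set M.E))).restrict
      (Subtype.val '' (S : Set M.E))).eRank.toNat + B.card = rkOn M (S ∪ B) := by
    have hne : ((M.contract (Subtype.val '' (B : Set M.E))).restrict
      (Subtype.val '' (S : Set M.E))).eRank ≠ ⊤ := fun h ↦ by
      rw [h, top_add] at h3
      exact ENat.natCast_ne_top _ h3.symm
    rw [← ENat.natCast_toNat hne] at h3
    exact_mod_cast h3
  rw [Matroid.restrict_ground_eq, Set.ncard_image_of_injective _ Subtype.val_injective,
    Set.ncard_coe_finset]
  have hdisj : ∀ x ∈ S, x ∉ B := fun x hx hxB ↦ (hT ⟨x, hx, rfl⟩).2 ⟨x, hxB, rfl⟩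
  have hpair : ∀ x ∈ S, ∀ y ∈ S, rkOn M ({x, y} ∪ B) = ({x, y} : Finset M.E).card + B.card := by
    intro x hx y hy
    have hxy : ({(x : α), (y : α)} : Set α) = Subtype.val '' (({x, y} : Finset M.E) : Set M.E) := by
      rw [coe_insert, coe_singleton, Set.image_insert_eq, Set.image_singleton]
    have h5 := hNs x ⟨x, hx, rfl⟩ y ⟨y, hy, rfl⟩
    rw [contract_restrict_indep_iff hI hT (Set.insert_subset ⟨x, hx, rfl⟩
      (Set.singleton_subset_iff.2 ⟨y, hy, rfl⟩)), hxy, ← Set.image_union, ← coe_union,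
      indep_iff_rkOn, card_union_of_disjoint] at h5
    · exact h5
    · rw [disjoint_left]
      intro t ht htB
      simp only [mem_insert, mem_singleton] at ht
      rcases ht with rfl | rfl
      · exact hdisj _ hx htB
      · exact hdisj _ hy htB
  rcases B.eq_empty_or_nonempty with rfl | hBne
  · rw [union_empty, card_empty, add_zero] at h4
    rw [h4]
    refine h.restr S fun hS ↦ ?_
    have := hN.ssubset
    rw [Matroid.restrict_ground_eq, hS, coe_univ, Set.image_univ, Subtype.range_coe] at this
    exact this.ne rfl
  · have := h.contr B S hBne (fun x hx ↦ ?_) (fun x hx y hy hxy ↦ ?_)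
    · omega
    · have := hpair x hx x hx
      rw [pair_eq_singleton, singleton_union, card_singleton] at this
      omega
    · have := hpair x hx y hy
      rw [insert_union, singleton_union, card_pair hxy] at this
      omega

theorem isCritical_iff_isCrit [DecidableEq M.E] [Fintype M.E] :
    IsCritical M ↔ IsCrit (rkOn M) := ⟨fun h ↦ h.isCrit, fun h ↦ h.isCritical⟩

end

/-! ### Covering by two independent sets -/

/-- Edmonds' covering condition is sufficient: a set none of whose subsets has more elements than
the sum of its ranks in two matroids is the union of an independent set of the first and one of the
second. -/
theorem IsRank.exists_cover {β : Type*} [DecidableEq β] (S : Finset β) :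
    ∀ r s : Finset β → ℕ, IsRank r → IsRank s → (∀ X ⊆ S, X.card ≤ r X + s X) →
      ∃ I J, I ∪ J = S ∧ r I = I.card ∧ s J = J.card := by
  induction S using Finset.induction_on with
  | empty => exact fun r s hr hs _ ↦ ⟨∅, ∅, by simp, by simp [hr.empty], by simp [hs.empty]⟩
  | insert e S he ih =>
    -- if `e` may be assigned to the first matroid, contract it there
    have step : ∀ r s : Finset β → ℕ, IsRank r → IsRank s →
        (∀ X ⊆ S, X.card + 1 ≤ r (insert e X) + s X) →
        ∃ I J, I ∪ J = insert e S ∧ r I = I.card ∧ s J = J.card := by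
      intro r s hr hs h
      have he1 : ∀ X, 1 ≤ r (insert e X) := fun X ↦ by
        have h1 := h ∅ (empty_subset _)
        have h2 := hr.mono (insert_subset_insert e (empty_subset X))
        rw [hs.empty, card_empty] at h1
        omega
      have hr' : IsRank fun X ↦ r (insert e X) - 1 := by
        refine ⟨?_, fun A B h ↦ Nat.sub_le_sub_right (hr.mono (insert_subset_insert e h)) 1,
          fun x A ↦ ?_, fun A B ↦ ?_⟩
        · have := hr.insert_le e ∅
          rw [hr.empty] at this
          omega
        · have := hr.insert_le x (insert e A)
          rw [insert_comm] at this
          have := he1 A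
          omega
        · have h1 := hr.submod (insert e A) (insert e B)
          rw [← insert_union_distrib, ← insert_inter_distrib] at h1
          have h2 := he1 A
          have h3 := he1 B
          have h4 := he1 (A ∪ B)
          have h5 := he1 (A ∩ B)
          omega
      obtain ⟨I, J, hIJ, hI, hJ⟩ := ih _ s hr' hs fun X hX ↦ by
        have h1 := h X hX
        have h2 := he1 X
        omega
      refine ⟨insert e I, J, by rw [insert_union, hIJ], ?_, hJ⟩
      rw [card_insert_of_notMem fun h ↦ he (hIJ ▸ mem_union_left _ h), ← hI]
      have := he1 I
      omega
    intro r s hr hs h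
    by_cases hX : ∀ X ⊆ S, X.card + 1 ≤ r (insert e X) + s X
    · exact step r s hr hs hX
    by_cases hY : ∀ Y ⊆ S, Y.card + 1 ≤ s (insert e Y) + r Y
    · obtain ⟨J, I, hJI, hJ, hI⟩ := step s r hs hr hY
      exact ⟨I, J, by rw [union_comm, hJI], hI, hJ⟩
    -- otherwise the two violating sets can be uncrossed
    push Not at hX hY
    obtain ⟨X, hXS, hX⟩ := hX
    obtain ⟨Y, hYS, hY⟩ := hY
    have h1 := hr.submod (insert e X) Y
    have h2 := hs.submod X (insert e Y)
    rw [insert_union, insert_inter_of_notMem fun h ↦ he (hYS h)] at h1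
    rw [union_insert, inter_insert_of_notMem fun h ↦ he (hXS h)] at h2
    have h3 := h (insert e (X ∪ Y)) (insert_subset_insert e (union_subset hXS hYS))
    have h4 := h (X ∩ Y) ((inter_subset_left.trans hXS).trans (subset_insert _ _))
    rw [card_insert_of_notMem fun h ↦ he (union_subset hXS hYS h)] at h3
    have h5 := card_union_add_card_inter X Y
    omega

theorem ncard_eq_toNat_eRk {α : Type*} {N : Matroid α} {X : Set α}
    (h : N.Indep X) : X.ncard = (N.eRk X).toNat := by
  rw [Set.ncard, h.eRk_eq_encard]

section

variable {α : Type*} {M N : Matroid α} [N.Finite] {T X : Set α}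

theorem toNat_eRk_mono (h : T ⊆ X) : (N.eRk T).toNat ≤ (N.eRk X).toNat := by
  rw [← Nat.cast_le (α := ℕ∞), cast_toNat_eRk, cast_toNat_eRk]
  exact N.eRk_mono h

/-- Edmonds' covering theorem for two copies of a matroid. -/
theorem coverable_two_iff :
    Coverable 2 N ↔ ∀ X ⊆ N.E, X.ncard ≤ 2 * (N.eRk X).toNat := by
  classical
  constructor
  · rintro ⟨I, hI, hIE⟩ X hX
    have hXI : ∀ i, (X ∩ I i).ncard ≤ (N.eRk X).toNat := fun i ↦
      (ncard_eq_toNat_eRk ((hI i).subset Set.inter_subset_right)).le.trans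
        (toNat_eRk_mono Set.inter_subset_left)
    have h : X = X ∩ I 0 ∪ X ∩ I 1 := by
      ext x
      constructor
      · intro hx
        obtain ⟨i, hi⟩ := Set.mem_iUnion.1 (hIE.ge (hX hx))
        fin_cases i
        · exact Or.inl ⟨hx, hi⟩
        · exact Or.inr ⟨hx, hi⟩
      · rintro (h | h) <;> exact h.1
    calc X.ncard ≤ (X ∩ I 0).ncard + (X ∩ I 1).ncard := by
          conv_lhs => rw [h]
          exact Set.ncard_union_le _ _
      _ ≤ 2 * (N.eRk X).toNat := by
          have := hXI 0
          have := hXI 1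
          omega
  · intro h
    have := N.ground_finite.fintype
    obtain ⟨I, J, hIJ, hI, hJ⟩ := IsRank.exists_cover (univ : Finset N.E) (rkOn N) (rkOn N)
      isRank_rkOn isRank_rkOn fun X _ ↦ by
        have := h _ (Subtype.coe_image_subset N.E (X : Set N.E))
        rw [Set.ncard_image_of_injective _ Subtype.val_injective, Set.ncard_coe_finset] at this
        rw [rkOn]
        omega
    refine ⟨fun i ↦ if i = 0 then Subtype.val '' (I : Set N.E) else Subtype.val '' (J : Set N.E),
      fun i ↦ ?_, ?_⟩
    · by_cases hi : i = 0
      · simpa [hi] using indep_iff_rkOn.2 hI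
      · simpa [hi] using indep_iff_rkOn.2 hJ
    · refine Set.Subset.antisymm (Set.iUnion_subset fun i ↦ ?_) fun x hx ↦ ?_
      · by_cases hi : i = 0
        · simp [hi]
        · simp [hi]
      · have h1 : (⟨x, hx⟩ : N.E) ∈ I ∪ J := hIJ ▸ mem_univ _
        rcases mem_union.1 h1 with h1 | h1
        · exact Set.mem_iUnion.2 ⟨0, by simpa [hx] using h1⟩
        · exact Set.mem_iUnion.2 ⟨1, by simpa [hx] using h1⟩

/-- By minimality, the set that violates Edmonds' condition is the whole ground set. -/
theorem isMinimalSimpleObstruction_iff_isCritical :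
    IsMinimalSimpleObstruction 2 N ↔ IsCritical N := by
  have hfin : ∀ {K : Matroid α}, K.IsMinor N → K.Finite := fun h ↦
    ⟨N.ground_finite.subset h.subset⟩
  constructor
  · rintro ⟨⟨hs, hc⟩, hm⟩
    refine ⟨hs, ?_, fun K hK hKs ↦ ?_⟩
    · rw [coverable_two_iff] at hc
      push Not at hc
      obtain ⟨X, hXE, hX⟩ := hc
      rcases hXE.eq_or_ssubset with rfl | hss
      · rwa [Matroid.eRk_ground] at hX
      · have := hfin (restrict_isMinor hXE)
        refine absurd ⟨hs.restrict hXE, fun h ↦ ?_⟩ (hm (N.restrict X)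
          (Matroid.isStrictMinor_iff_isMinor_ssubset.2 ⟨restrict_isMinor hXE, hss⟩))
        have := coverable_two_iff.1 h X subset_rfl
        rw [Matroid.restrict_eRk_eq _ subset_rfl] at this
        omega
    · have := hfin hK.isMinor
      have h := coverable_two_iff.1 (not_not.1 fun h ↦ hm K hK ⟨hKs, h⟩) K.E subset_rfl
      rwa [Matroid.eRk_ground] at h
  · rintro ⟨hs, hd, hm⟩
    refine ⟨⟨hs, fun h ↦ ?_⟩, fun K hK h ↦ ?_⟩
    · have := coverable_two_iff.1 h N.E subset_rfl
      rw [Matroid.eRk_ground] at this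
      omega
    · obtain ⟨hKs, hc⟩ := h
      have := hfin hK.isMinor
      rw [coverable_two_iff] at hc
      push Not at hc
      obtain ⟨X, hXE, hX⟩ := hc
      have := hm (K.restrict X) ((restrict_isMinor hXE).trans_isStrictMinor hK)
        (hKs.restrict hXE)
      rw [Matroid.eRank_restrict, Matroid.restrict_ground_eq] at this
      omega

/-! ### Density -/

theorem IsSimple.eq_of_mem_closure (h : IsSimple (M.restrict T)) {s t : α} (hs : s ∈ T)
    (ht : t ∈ T) (hst : s ∈ M.closure {t}) : s = t := by
  by_contra hne
  have hi := (h s hs t ht).of_restrict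
  rw [Set.pair_comm] at hi
  have := (hi.notMem_closure_sdiff_of_mem (e := s) (by simp))
  rw [Set.pair_sdiff_right (Ne.symm hne)] at this
  exact this hst

theorem IsSimple.isNonloop (h : IsSimple (M.restrict T)) {t : α} (ht : t ∈ T) :
    M.IsNonloop t := by
  have := (h t ht t ht).of_restrict
  rwa [Set.pair_eq_singleton, Matroid.indep_singleton] at this

/-- The rank-one flats correspond to the elements of a simplification `T`. -/
theorem numRankOneFlats_eq_ncard (h : IsSimple (M.restrict T))
    (hT : ∀ e, M.IsNonloop e → ∃ t ∈ T, e ∈ M.closure {t}) : numRankOneFlats M = T.ncard := by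
  rw [numRankOneFlats]
  symm
  refine Set.ncard_congr (fun t _ ↦ M.closure {t}) (fun t ht ↦ ?_) (fun s t hs ht hst ↦ ?_)
    fun F hF ↦ ?_
  · exact ⟨M.isFlat_closure _, by rw [Matroid.eRk_closure_eq, (h.isNonloop ht).eRk_eq]⟩
  · exact h.eq_of_mem_closure hs ht (hst ▸
      M.mem_closure_of_mem rfl (Set.singleton_subset_iff.2 (h.isNonloop hs).mem_ground))
  · obtain ⟨hF1, hF2⟩ := hF
    obtain ⟨e, heF, he, hFe⟩ := (Matroid.eRk_eq_one_iff hF1.subset_ground).1 hF2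
    obtain ⟨t, ht, het⟩ := hT e he
    refine ⟨t, ht, ?_⟩
    rw [← he.closure_eq_of_mem_closure het]
    refine Set.Subset.antisymm ?_ hFe
    rw [← hF1.closure]
    exact M.closure_subset_closure (Set.singleton_subset_iff.2 heF)

/-- Maximal simple restrictions are simplifications. -/
theorem exists_simplification :
    ∃ T ⊆ N.E, IsSimple (N.restrict T) ∧ T.ncard = numRankOneFlats N ∧ N.eRk T = N.eRank := by
  obtain ⟨T, hT⟩ := (N.ground_finite.finite_subsets.subset
    (Set.sep_subset {T | T ⊆ N.E} fun T ↦ IsSimple (N.restrict T))).exists_maximal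
    ⟨∅, Set.empty_subset _, fun x hx ↦ absurd hx (Set.notMem_empty x)⟩
  obtain ⟨⟨hTE, hTs⟩, hTm⟩ := hT
  have key : ∀ e, N.IsNonloop e → ∃ t ∈ T, e ∈ N.closure {t} := by
    intro e he
    by_contra! hcon
    have hpair : ∀ t ∈ T, N.Indep {e, t} := fun t ht ↦ by
      by_contra hn
      refine hcon t ht ?_
      rw [← (he.closure_eq_closure_iff_eq_or_dep (hTs.isNonloop ht)).2 (Or.inr hn)]
      exact N.mem_closure_of_mem rfl (Set.singleton_subset_iff.2 he.mem_ground)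
    have heT : e ∈ T := hTm ⟨Set.insert_subset he.mem_ground hTE, fun x hx y hy ↦
      Matroid.restrict_indep_iff.2 ⟨?_, Set.insert_subset hx (Set.singleton_subset_iff.2 hy)⟩⟩
      (Set.subset_insert e T) (Set.mem_insert e T)
    · exact hcon e heT (N.mem_closure_of_mem rfl (Set.singleton_subset_iff.2 he.mem_ground))
    · rcases hx with rfl | hx
      · rcases hy with rfl | hy
        · rwa [Set.pair_eq_singleton, Matroid.indep_singleton]
        · exact hpair _ hy
      · rcases hy with rfl | hy
        · rw [Set.pair_comm]
          exact hpair _ hx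
        · exact (hTs x hx y hy).of_restrict
  refine ⟨T, hTE, hTs, (numRankOneFlats_eq_ncard hTs key).symm, ?_⟩
  refine Matroid.Spanning.eRk_eq ((N.spanning_iff_ground_subset_closure hTE).2 fun e he ↦ ?_)
  rcases N.isLoop_or_isNonloop e he with hl | hn
  · exact hl.mem_closure T
  · obtain ⟨t, ht, het⟩ := key e hn
    exact N.closure_subset_closure (Set.singleton_subset_iff.2 ht) het

/-- In rank zero both sides hold, as there are no rank-one flats. -/
theorem density_le_two_iff : density N ≤ 2 ↔ numRankOneFlats N ≤ 2 * N.eRank.toNat := by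
  rw [density]
  split_ifs with h
  · have : {F : Set α | N.IsFlat F ∧ N.eRk F = 1} = ∅ := by
      refine Set.eq_empty_of_forall_notMem fun F hF ↦ ?_
      have := N.eRk_le_eRank F
      rw [hF.2, h] at this
      simp at this
    rw [numRankOneFlats, this]
    simp
  · have hpos : 0 < N.eRank.toNat := Nat.pos_of_ne_zero fun h0 ↦ h (by
      rw [← cast_toNat_eRank, h0, Nat.cast_zero])
    rw [div_le_iff₀ (by exact_mod_cast hpos)]
    exact_mod_cast Iff.rfl

theorem IsSimple.numRankOneFlats_eq (h : IsSimple M) : numRankOneFlats M = M.E.ncard :=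
  numRankOneFlats_eq_ncard (by rwa [Matroid.restrict_ground_eq_self]) fun e he ↦
    ⟨e, he.mem_ground, M.mem_closure_of_mem rfl (Set.singleton_subset_iff.2 he.mem_ground)⟩

theorem strictlyDensityCritical_iff_isCritical :
    StrictlyDensityCritical 2 N ↔ IsCritical N := by
  have hfin : ∀ {K : Matroid α}, K.IsMinor N → K.Finite := fun h ↦
    ⟨N.ground_finite.subset h.subset⟩
  constructor
  · rintro ⟨hd, hm⟩
    rw [← not_le, density_le_two_iff, not_le] at hd
    obtain ⟨T, hTE, hTs, hTn, hTr⟩ := exists_simplification (N := N)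
    have hT : T = N.E := by
      by_contra hne
      have := hfin (restrict_isMinor hTE)
      have h := hm (N.restrict T) (Matroid.isStrictMinor_iff_isMinor_ssubset.2
        ⟨restrict_isMinor hTE, hTE.ssubset_of_ne hne⟩)
      rw [density_le_two_iff, hTs.numRankOneFlats_eq, Matroid.eRank_restrict, hTr,
        Matroid.restrict_ground_eq] at h
      omega
    subst hT
    rw [Matroid.restrict_ground_eq_self] at hTs
    refine ⟨hTs, hTn ▸ hd, fun K hK hKs ↦ ?_⟩
    have := hfin hK.isMinor
    rw [← hKs.numRankOneFlats_eq]
    exact density_le_two_iff.1 (hm K hK)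
  · rintro ⟨hs, hd, hm⟩
    refine ⟨?_, fun K hK ↦ ?_⟩
    · rwa [← not_le, density_le_two_iff, not_le, hs.numRankOneFlats_eq]
    · have := hfin hK.isMinor
      obtain ⟨T, hTE, hTs, hTn, hTr⟩ := exists_simplification (N := K)
      have h := hm (K.restrict T) ((restrict_isMinor hTE).trans_isStrictMinor hK) hTs
      rw [Matroid.eRank_restrict, hTr, Matroid.restrict_ground_eq, hTn] at h
      exact density_le_two_iff.2 h

end

/-! ### Matroids described by a list of flats -/

section

variable {α γ : Type*} {M : Matroid α} {N : Matroid γ} {n : ℕ} {L : List (Finset (Fin n) × ℕ)}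

theorem hasCode_rkOn_iff [M.Finite] : HasCode (rkOn M) L ↔ ∃ v : Fin n ≃ M.E,
    ∀ S : Finset (Fin n), M.Indep ((fun i ↦ (v i : α)) '' (S : Set (Fin n))) ↔ CodeIndep L S := by
  have : ∀ (v : Fin n ≃ M.E) (S : Finset (Fin n)), rkOn M (S.map v.toEmbedding) = S.card ↔
      M.Indep ((fun i ↦ (v i : α)) '' (S : Set (Fin n))) := fun v S ↦ by
    rw [← S.card_map v.toEmbedding, ← indep_iff_rkOn, coe_map, Set.image_image]
    rfl
  simp_rw [HasCode, this]

/-- A labelling of the ground set whose independent sets are those described by `L`. -/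
theorem hasCode_of_labelling [M.Finite] {f : Fin n → α} (hf : f.Injective)
    (hE : Set.range f = M.E) (h : ∀ S : Finset (Fin n), M.Indep (f '' S) ↔ CodeIndep L S) :
    HasCode (rkOn M) L :=
  hasCode_rkOn_iff.2 ⟨(Equiv.ofInjective f hf).trans (Equiv.setCongr hE), h⟩

theorem HasCode.of_isIso [M.Finite] [N.Finite] (hN : HasCode (rkOn N) L) (h : IsIso M N) :
    HasCode (rkOn M) L := by
  obtain ⟨e, he⟩ := h
  obtain ⟨v, hv⟩ := hasCode_rkOn_iff.1 hN
  refine hasCode_rkOn_iff.2 ⟨v.trans e.symm, fun S ↦ ?_⟩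
  have := he ((fun i ↦ e.symm (v i)) '' S)
  rw [Set.image_image, Set.image_image] at this
  simp only [Equiv.apply_symm_apply] at this
  exact this.trans (hv S)

theorem HasCode.isIso [M.Finite] [N.Finite] (hM : HasCode (rkOn M) L) (hN : HasCode (rkOn N) L) :
    IsIso M N := by
  obtain ⟨v, hv⟩ := hasCode_rkOn_iff.1 hM
  obtain ⟨w, hw⟩ := hasCode_rkOn_iff.1 hN
  refine ⟨v.symm.trans w, fun I ↦ ?_⟩
  have hS : (((Set.toFinite (v ⁻¹' I)).toFinset : Finset (Fin n)) : Set (Fin n)) = v ⁻¹' I :=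
    Set.Finite.coe_toFinset _
  have h := (hv (Set.toFinite (v ⁻¹' I)).toFinset).trans (hw _).symm
  rw [hS, ← Set.image_image (fun x : M.E ↦ (x : α)) v, Set.image_preimage_eq _ v.surjective] at h
  rw [h, ← v.image_symm_eq_preimage, Set.image_image]
  rfl

end

/-! ### Forests -/

/-- The graph whose edges are listed. -/
def listGraph {V : Type*} (l : List (V × V)) : SimpleGraph V :=
  SimpleGraph.fromEdgeSet {e | e ∈ l.map fun p ↦ s(p.1, p.2)}

theorem listGraph_cons {V : Type*} (p : V × V) (l : List (V × V)) :
    listGraph (p :: l) = listGraph l ⊔ SimpleGraph.edge p.1 p.2 := by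
  rw [listGraph, listGraph, SimpleGraph.edge, ← SimpleGraph.fromEdgeSet_union]
  congr 1
  ext e
  simp 

section

variable {V : Type*} [DecidableEq V]

/-- A label of the component of each vertex of the graph whose edges are listed. -/
def componentLabel : List (V × V) → V → V
  | [] => id
  | p :: l => fun x ↦ if componentLabel l x = componentLabel l p.1 then componentLabel l p.2
      else componentLabel l x

/-- Each edge of the list joins two components of the graph formed by the edges after it. -/
def joinsComponents : List (V × V) → Bool
  | [] => true
  | p :: l => !decide (componentLabel l p.1 = componentLabel l p.2) && joinsComponents l

theorem reachable_listGraph_iff (l : List (V × V)) (u v : V) :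
    (listGraph l).Reachable u v ↔ componentLabel l u = componentLabel l v := by
  induction l generalizing u v with
  | nil => simp [listGraph, componentLabel, SimpleGraph.reachable_bot]
  | cons p l ih =>
    rw [listGraph_cons]
    constructor
    · rintro ⟨w⟩
      induction w with
      | nil => rfl
      | cons h _ ih' =>
        refine Eq.trans ?_ ih'
        rw [SimpleGraph.sup_adj, SimpleGraph.edge_adj] at h
        rcases h with h | ⟨⟨rfl, rfl⟩ | ⟨rfl, rfl⟩, -⟩
        · simp only [componentLabel, (ih _ _).1 h.reachable]
        · simp [componentLabel]
        · simp [componentLabel]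
    · have hG := fun {x y} (h : componentLabel l x = componentLabel l y) ↦
        ((ih x y).2 h).mono (le_sup_left (b := SimpleGraph.edge p.1 p.2))
      have hp : (listGraph l ⊔ SimpleGraph.edge p.1 p.2).Reachable p.1 p.2 := by
        by_cases hp : p.1 = p.2
        · rw [hp]
        · exact SimpleGraph.Adj.reachable (by simp [SimpleGraph.edge_adj, hp])
      intro h
      simp only [componentLabel] at h
      split_ifs at h with h1 h2 h2
      · exact hG (h1.trans h2.symm)
      · exact (hG h1).trans (hp.trans (hG h))
      · exact (hG h).trans (hp.symm.trans (hG h2.symm))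
      · exact hG h

theorem isAcyclic_listGraph_iff {l : List (V × V)} (hd : ∀ p ∈ l, p.1 ≠ p.2)
    (hn : (l.map fun p ↦ s(p.1, p.2)).Nodup) :
    (listGraph l).IsAcyclic ↔ joinsComponents l = true := by
  induction l with
  | nil => simp [listGraph, joinsComponents]
  | cons p l ih =>
    rw [List.map_cons, List.nodup_cons] at hn
    have hadj : ¬ (listGraph l).Adj p.1 p.2 := fun h ↦
      hn.1 ((SimpleGraph.fromEdgeSet_adj _).1 h).1
    rw [listGraph_cons, SimpleGraph.isAcyclic_sup_fromEdgeSet_iff,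
      ih (fun q hq ↦ hd q (List.mem_cons_of_mem _ hq)) hn.2, reachable_listGraph_iff]
    simp [joinsComponents, hadj, hd p, and_comm]

/-- Independence in a cycle matroid whose edges are labelled by `Fin n`. -/
theorem cycleMatroid_indep_image_iff [Finite V] {G : SimpleGraph V} {n : ℕ} {f : Fin n → V × V}
    (hf : (fun i ↦ s((f i).1, (f i).2)).Injective)
    (hE : ∀ i, s((f i).1, (f i).2) ∈ G.edgeSet) (S : Finset (Fin n)) :
    (cycleMatroid G).Indep ((fun i ↦ s((f i).1, (f i).2)) '' S) ↔
      joinsComponents (((List.finRange n).filter (· ∈ S)).map f) = true := by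
  rw [← isAcyclic_listGraph_iff]
  · have h1 : ((fun i ↦ s((f i).1, (f i).2)) '' (S : Set (Fin n))) ⊆ G.edgeSet := by
      rintro _ ⟨i, -, rfl⟩
      exact hE i
    have h2 : ((fun i ↦ s((f i).1, (f i).2)) '' (S : Set (Fin n))) = {e | e ∈
        (((List.finRange n).filter (· ∈ S)).map f).map fun p ↦ s(p.1, p.2)} := by
      ext e
      simp
    exact (and_iff_right h1).trans (by rw [h2, listGraph])
  · simp only [List.mem_map]
    rintro _ ⟨i, -, rfl⟩
    exact G.ne_of_adj (hE i)
  · rw [List.map_map]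
    exact ((List.nodup_finRange n).filter _).map hf

end

/-! ### The ten matroids have the listed flats -/

theorem uniform_indep_iff {r n : ℕ} {S : Finset (Fin n)} :
    (uniform r n).Indep S ↔ S.card ≤ r := by
  rw [← Set.ncard_coe_finset]
  exact Iff.rfl

theorem ofLines_indep_iff {n : ℕ} {L : Finset (Finset (Fin n))}
    {hL : ∀ l ∈ L, ∀ m ∈ L, l ≠ m → (l ∩ m).card ≤ 1} {S : Finset (Fin n)} :
    (ofLines n L hL).Indep S ↔ S.card ≤ 3 ∧ ∀ l ∈ L, S ⊆ l → S.card ≤ 2 := by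
  simp_rw [← Set.ncard_coe_finset, ← coe_subset]
  exact Iff.rfl

instance {n : ℕ} {L : Finset (Finset (Fin n))}
    {hL : ∀ l ∈ L, ∀ m ∈ L, l ≠ m → (l ∩ m).card ≤ 1} : (ofLines n L hL).Finite :=
  ⟨Set.toFinite _⟩

theorem hasCode_uniform : HasCode (rkOn (uniform 2 5)) codeU25 :=
  hasCode_of_labelling (f := id) Function.injective_id Set.range_id fun S ↦ by
    rw [Set.image_id, uniform_indep_iff]
    simp [codeU25, CodeIndep]

theorem hasCode_ofLines {n : ℕ} {L : Finset (Finset (Fin n))}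
    {hL : ∀ l ∈ L, ∀ m ∈ L, l ≠ m → (l ∩ m).card ≤ 1} {C : List (Finset (Fin n) × ℕ)}
    (h : ∀ S : Finset (Fin n), (S.card ≤ 3 ∧ ∀ l ∈ L, S ⊆ l → S.card ≤ 2) ↔ CodeIndep C S) :
    HasCode (rkOn (ofLines n L hL)) C :=
  hasCode_of_labelling (f := id) Function.injective_id Set.range_id fun S ↦ by
    rw [Set.image_id, ofLines_indep_iff, h]

set_option maxRecDepth 4000 in
theorem hasCode_rkOn_fano : HasCode (rkOn fano) codeFano := hasCode_ofLines (by decide +kernel)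

set_option maxRecDepth 4000 in
theorem hasCode_rkOn_nonFano : HasCode (rkOn nonFano) codeNonFano :=
  hasCode_ofLines (by decide +kernel)

set_option maxRecDepth 4000 in
theorem hasCode_rkOn_p7 : HasCode (rkOn p7) codeP7 := hasCode_ofLines (by decide +kernel)

set_option maxRecDepth 4000 in
theorem hasCode_rkOn_o7 : HasCode (rkOn o7) codeO7 := hasCode_ofLines (by decide +kernel)

theorem range_edge_eq {V : Type*} {G : SimpleGraph V} {n : ℕ} {f : Fin n → V × V}
    (h1 : ∀ i, G.Adj (f i).1 (f i).2)
    (h2 : ∀ x y, G.Adj x y → ∃ i, f i = (x, y) ∨ f i = (y, x)) :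
    Set.range (fun i ↦ s((f i).1, (f i).2)) = G.edgeSet := by
  ext e
  induction e with
  | _ x y =>
    constructor
    · rintro ⟨i, hi⟩
      rw [← hi]
      exact h1 i
    · intro h
      obtain ⟨i, hi | hi⟩ := h2 x y h
      · exact ⟨i, by simp only [hi]⟩
      · exact ⟨i, by simp only [hi, Sym2.eq_swap]⟩

/-- The edges of `K₄`: the star of the vertex `3`, and the opposite triangle. -/
def edgesK4 : Fin 6 → Fin 4 × Fin 4 := ![(3, 2), (3, 0), (3, 1), (0, 1), (1, 2), (0, 2)]

/-- The connected flats of `M(K₄)`. -/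
def codeK4 : List (Finset (Fin 6) × ℕ) :=
  [({1, 2, 3}, 2), ({0, 2, 4}, 2), ({0, 1, 5}, 2), ({3, 4, 5}, 2), (univ, 3)]

/-- The edges of `K₅ \ e`, in the labelling of `codeK5e`. -/
def edgesK5e : Fin 9 → Fin 5 × Fin 5 :=
  ![(0, 2), (0, 3), (0, 4), (1, 2), (1, 3), (1, 4), (3, 4), (2, 4), (2, 3)]

/-- The edges of `K_{3,3}`, in the labelling of `codeK33`. -/
def edgesK33 : Fin 9 → (Fin 3 ⊕ Fin 3) × (Fin 3 ⊕ Fin 3) :=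
  ![(.inl 0, .inr 0), (.inl 0, .inr 1), (.inl 0, .inr 2), (.inl 1, .inr 0), (.inl 1, .inr 1),
    (.inl 1, .inr 2), (.inl 2, .inr 0), (.inl 2, .inr 1), (.inl 2, .inr 2)]

theorem edgesK4_injective : (fun i ↦ s((edgesK4 i).1, (edgesK4 i).2)).Injective := by decide

theorem range_edgesK4 :
    Set.range (fun i ↦ s((edgesK4 i).1, (edgesK4 i).2)) = (⊤ : SimpleGraph (Fin 4)).edgeSet :=
  range_edge_eq (by simp only [SimpleGraph.top_adj]; decide)
    (by simp only [SimpleGraph.top_adj]; decide)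

theorem mk4_indep_iff (S : Finset (Fin 6)) :
    mk4.Indep ((fun i ↦ s((edgesK4 i).1, (edgesK4 i).2)) '' S) ↔ CodeIndep codeK4 S := by
  rw [cycleMatroid_indep_image_iff edgesK4_injective
    (fun i ↦ range_edgesK4.subset ⟨i, rfl⟩)]
  revert S
  decide +kernel

theorem hasCode_mk5e :
    HasCode (rkOn (cycleMatroid ((⊤ : SimpleGraph (Fin 5)).deleteEdges {s(0, 1)}))) codeK5e := by
  have hinj : (fun i ↦ s((edgesK5e i).1, (edgesK5e i).2)).Injective := by decide
  have hr := range_edge_eq (G := (⊤ : SimpleGraph (Fin 5)).deleteEdges {s(0, 1)}) (f := edgesK5e)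
    (by simp only [SimpleGraph.deleteEdges_adj, SimpleGraph.top_adj, Set.mem_singleton_iff]; decide)
    (by simp only [SimpleGraph.deleteEdges_adj, SimpleGraph.top_adj, Set.mem_singleton_iff]; decide)
  refine hasCode_of_labelling hinj hr fun S ↦ ?_
  rw [cycleMatroid_indep_image_iff hinj fun i ↦ hr.subset ⟨i, rfl⟩]
  revert S
  decide +kernel

/-- The sets `S` of edges that avoid a spanning tree of `K_{3,3}`. -/
theorem exists_disjoint_tree_iff : ∀ S : Finset (Fin 9),
    (∃ T ∈ powersetCard 5 Sᶜ,
      joinsComponents (((List.finRange 9).filter (· ∈ T)).map edgesK33) = true) ↔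
      CodeIndep codeK33 S := by
  decide +kernel

theorem card_le_of_joinsComponents : ∀ S : Finset (Fin 9),
    joinsComponents (((List.finRange 9).filter (· ∈ S)).map edgesK33) = true → S.card ≤ 5 := by
  decide +kernel

theorem hasCode_mk33_dual :
    HasCode (rkOn (cycleMatroid (completeBipartiteGraph (Fin 3) (Fin 3)))✶) codeK33 := by
  have hinj : (fun i ↦ s((edgesK33 i).1, (edgesK33 i).2)).Injective := by decide
  have hr := range_edge_eq (G := completeBipartiteGraph (Fin 3) (Fin 3)) (f := edgesK33)
    (by simp only [completeBipartiteGraph_adj]; decide)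
    (by simp only [completeBipartiteGraph_adj]; decide)
  set M := cycleMatroid (completeBipartiteGraph (Fin 3) (Fin 3))
  set f := fun i ↦ s((edgesK33 i).1, (edgesK33 i).2)
  have hM : ∀ S : Finset (Fin 9), M.Indep (f '' S) ↔
      joinsComponents (((List.finRange 9).filter (· ∈ S)).map edgesK33) = true :=
    cycleMatroid_indep_image_iff hinj fun i ↦ hr.subset ⟨i, rfl⟩
  refine hasCode_of_labelling (M := M✶) hinj hr fun S ↦ ?_
  rw [← exists_disjoint_tree_iff, Matroid.dual_indep_iff_exists']
  -- the independent sets of `M` are labelled by at most five elements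
  have hlab : ∀ B, M.Indep B → ∃ T : Finset (Fin 9), f '' T = B ∧ T.card ≤ 5 ∧
      joinsComponents (((List.finRange 9).filter (· ∈ T)).map edgesK33) = true := fun B hB ↦ by
    have hT : f '' ((Set.toFinite (f ⁻¹' B)).toFinset : Finset (Fin 9)) = B := by
      rw [Set.Finite.coe_toFinset, Set.image_preimage_eq_of_subset]
      exact hB.subset_ground.trans hr.ge
    have h := (hM _).1 (hT ▸ hB)
    exact ⟨_, hT, card_le_of_joinsComponents _ h, h⟩
  have hcard : ∀ T : Finset (Fin 9), (f '' T).encard = T.card := fun T ↦ by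
    rw [hinj.encard_image, Set.encard_coe_eq_coe_finsetCard]
  constructor
  · rintro ⟨-, B, hB, hSB⟩
    obtain ⟨T, rfl, hT, hTj⟩ := hlab B hB.indep
    refine ⟨T, mem_powersetCard.2 ⟨fun x hx ↦ ?_, hT.antisymm ?_⟩, hTj⟩
    · exact mem_compl.2 fun hxS ↦ Set.disjoint_left.1 hSB ⟨x, hxS, rfl⟩ ⟨x, hx, rfl⟩
    · have h0 : M.Indep (f '' (({0, 1, 2, 3, 6} : Finset (Fin 9)) : Set (Fin 9))) :=
        (hM _).2 (by decide +kernel)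
      have h1 := h0.encard_le_eRank
      rw [← hB.encard_eq_eRank, hcard, hcard] at h1
      exact_mod_cast h1
  · rintro ⟨T, hT, hTj⟩
    rw [mem_powersetCard] at hT
    refine ⟨?_, f '' T, ?_, ?_⟩
    · rintro _ ⟨i, -, rfl⟩
      exact hr.subset ⟨i, rfl⟩
    · obtain ⟨B, hB, hTB⟩ := ((hM T).2 hTj).exists_isBase_superset
      obtain ⟨T', rfl, hT', -⟩ := hlab B hB.indep
      rw [Set.image_subset_image_iff hinj, coe_subset] at hTB
      rwa [eq_of_subset_of_card_le hTB (by omega)]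
    · rw [Set.disjoint_image_iff hinj, disjoint_coe]
      exact disjoint_right.2 fun x hx ↦ mem_compl.1 (hT.1 hx)

section

variable {α β : Type*} {M : Matroid α} {N : Matroid β} [M.Finite] [N.Finite] {p : α} {q : β}
  {hp : M.IsNonloop p} {hq : N.IsNonloop q}

instance : (parallelConnection M N p q hp hq).Finite :=
  ⟨(M.ground_finite.image _).union ((N.ground_finite.sdiff).image _)⟩

/-- A parallel connection of matroids described by lists, with basepoints `i` and `j`; the element
`k` of the parallel connection is the element `g k` of one of the two matroids. -/
theorem hasCode_parallelConnection {a b n : ℕ} {v : Fin a → α} {w : Fin b → β} {i : Fin a}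
    {j : Fin b} {L₁ : List (Finset (Fin a) × ℕ)} {L₂ : List (Finset (Fin b) × ℕ)}
    {L : List (Finset (Fin n) × ℕ)} {g : Fin n → Fin a ⊕ Fin b}
    (hv : v.Injective) (hw : w.Injective) (hvE : Set.range v = M.E) (hwE : Set.range w = N.E)
    (hM : ∀ S : Finset (Fin a), M.Indep (v '' S) ↔ CodeIndep L₁ S)
    (hN : ∀ S : Finset (Fin b), N.Indep (w '' S) ↔ CodeIndep L₂ S)
    (hi : v i = p) (hj : w j = q) (hg : g.Injective) (hgr : ∀ x, x ≠ .inr j ↔ ∃ k, g k = x)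
    (hL : ∀ S : Finset (Fin n), j ∉ (S.image g).toRight ∧
      ((CodeIndep L₁ (S.image g).toLeft ∧ CodeIndep L₂ (insert j (S.image g).toRight)) ∨
        (i ∉ (S.image g).toLeft ∧ CodeIndep L₁ (insert i (S.image g).toLeft) ∧
          CodeIndep L₂ (S.image g).toRight)) ↔ CodeIndep L S) :
    HasCode (rkOn (parallelConnection M N p q hp hq)) L := by
  subst hi hj
  refine hasCode_of_labelling (f := Sum.map v w ∘ g) ((hv.sumMap hw).comp hg) ?_ fun S ↦ ?_
  · change _ = Sum.inl '' M.E ∪ Sum.inr '' (N.E \ {w j})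
    rw [← hvE, ← hwE]
    ext x
    constructor
    · rintro ⟨k, rfl⟩
      have hk := (hgr (g k)).2 ⟨k, rfl⟩
      rw [Function.comp_apply]
      generalize g k = y at hk
      rcases y with y | y
      · exact Or.inl ⟨v y, ⟨y, rfl⟩, rfl⟩
      · exact Or.inr ⟨w y, ⟨⟨y, rfl⟩, fun h ↦ hk (congrArg Sum.inr (hw h))⟩, rfl⟩
    · rintro (⟨_, ⟨y, rfl⟩, rfl⟩ | ⟨_, ⟨⟨y, rfl⟩, hy⟩, rfl⟩)
      · obtain ⟨k, hk⟩ := (hgr (.inl y)).1 Sum.inl_ne_inr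
        exact ⟨k, by rw [Function.comp_apply, hk]; rfl⟩
      · obtain ⟨k, hk⟩ := (hgr (.inr y)).1 fun h ↦ hy (congrArg w (Sum.inr_injective h))
        exact ⟨k, by rw [Function.comp_apply, hk]; rfl⟩
  · have h1 : Sum.inl ⁻¹' ((Sum.map v w ∘ g) '' (S : Set (Fin n))) = v '' (S.image g).toLeft := by
      rw [Set.image_comp, ← coe_image]
      ext x
      simp only [Set.mem_preimage, Set.mem_image, mem_coe, mem_toLeft]
      constructor
      · rintro ⟨y | y, hy, h⟩
        · exact ⟨y, hy, Sum.inl_injective h⟩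
        · exact absurd h Sum.inr_ne_inl
      · rintro ⟨y, hy, rfl⟩
        exact ⟨_, hy, rfl⟩
    have h2 : Sum.inr ⁻¹' ((Sum.map v w ∘ g) '' (S : Set (Fin n))) = w '' (S.image g).toRight := by
      rw [Set.image_comp, ← coe_image]
      ext x
      simp only [Set.mem_preimage, Set.mem_image, mem_coe, mem_toRight]
      constructor
      · rintro ⟨y | y, hy, h⟩
        · exact absurd h Sum.inl_ne_inr
        · exact ⟨y, hy, Sum.inr_injective h⟩
      · rintro ⟨y, hy, rfl⟩
        exact ⟨_, hy, rfl⟩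
    change ParallelIndep M N _ _ _ ↔ _
    rw [← hL S, ← hM, ← hN, ← hM, ← hN, coe_insert, coe_insert, Set.image_insert_eq,
      Set.image_insert_eq, ParallelIndep, h1, h2, hw.mem_set_image, hv.mem_set_image, mem_coe,
      mem_coe]

end

theorem u24_indep_iff (S : Finset (Fin 4)) : u24.Indep (id '' S) ↔ CodeIndep [(univ, 2)] S := by
  rw [Set.image_id, uniform_indep_iff]
  simp [CodeIndep]

theorem hasCode_parallelConnection_u24_u24 :
    HasCode (rkOn (parallelConnection u24 u24 0 0 u24_isNonloop u24_isNonloop)) codePUU :=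
  hasCode_parallelConnection (i := 0) (j := 0)
    (g := ![.inl 1, .inl 2, .inl 3, .inr 1, .inr 2, .inr 3, .inl 0])
    Function.injective_id Function.injective_id Set.range_id Set.range_id
    u24_indep_iff u24_indep_iff rfl rfl (by decide) (by decide) (by decide +kernel)

theorem hasCode_parallelConnection_u24_mk4 :
    HasCode (rkOn (parallelConnection u24 mk4 0 s(0, 1) u24_isNonloop mk4_isNonloop)) codePUK :=
  hasCode_parallelConnection (i := 0) (j := 3)
    (g := ![.inl 1, .inl 2, .inl 3, .inr 0, .inr 1, .inr 2, .inl 0, .inr 4, .inr 5])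
    Function.injective_id edgesK4_injective Set.range_id range_edgesK4
    u24_indep_iff mk4_indep_iff rfl rfl (by decide) (by decide) (by decide +kernel)

theorem hasCode_parallelConnection_mk4_mk4 :
    HasCode (rkOn (parallelConnection mk4 mk4 s(0, 1) s(0, 1) mk4_isNonloop mk4_isNonloop))
      codePKK :=
  hasCode_parallelConnection (i := 3) (j := 3)
    (g := ![.inl 0, .inl 1, .inl 2, .inr 0, .inr 1, .inr 2, .inl 3, .inl 4, .inl 5, .inr 4, .inr 5])
    edgesK4_injective edgesK4_injective range_edgesK4 range_edgesK4
    mk4_indep_iff mk4_indep_iff rfl rfl (by decide) (by decide) (by decide +kernel)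

theorem forall₂_hasCode :
    List.Forall₂ (fun N c ↦ N.2.Finite ∧ HasCode (rkOn N.2) c.2) tenMatroids tenCodes := by
  refine .cons ⟨inferInstance, hasCode_uniform⟩ <|
    .cons ⟨inferInstance, hasCode_parallelConnection_u24_u24⟩ <|
    .cons ⟨?_, hasCode_rkOn_o7⟩ <| .cons ⟨?_, hasCode_rkOn_p7⟩ <| .cons ⟨?_, hasCode_rkOn_nonFano⟩ <|
    .cons ⟨?_, hasCode_rkOn_fano⟩ <|
    .cons ⟨inferInstance, hasCode_parallelConnection_u24_mk4⟩ <|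
    .cons ⟨inferInstance, hasCode_mk5e⟩ <| .cons ⟨inferInstance, hasCode_mk33_dual⟩ <|
    .cons ⟨inferInstance, hasCode_parallelConnection_mk4_mk4⟩ .nil
  all_goals exact ⟨Set.toFinite (α := Fin 7) _⟩

/-! ### The ten matroids are pairwise non-isomorphic -/

/-- The number of four-element sets all of whose three-element subsets are independent. -/
def numArcs {n : ℕ} (L : List (Finset (Fin n) × ℕ)) : ℕ :=
  #{S : Finset (Fin n) | S.card = 4 ∧ ∀ x ∈ S, CodeIndep L (S.erase x)}

theorem HasCode.numArcs_eq {β : Type*} {r : Finset β → ℕ} {n m : ℕ}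
    {L : List (Finset (Fin n) × ℕ)} {K : List (Finset (Fin m) × ℕ)} (hL : HasCode r L)
    (hK : HasCode r K) : numArcs L = numArcs K := by
  obtain ⟨v, hv⟩ := hL
  obtain ⟨w, hw⟩ := hK
  have hmap : ∀ S : Finset (Fin n), (S.map (v.trans w.symm).toEmbedding).map w.toEmbedding =
      S.map v.toEmbedding := fun S ↦ by
    rw [map_map]
    congr 1
    ext x
    simp
  have h : ∀ S : Finset (Fin n), CodeIndep K (S.map (v.trans w.symm).toEmbedding) ↔
      CodeIndep L S := fun S ↦ by rw [← hw, ← hv, hmap, card_map]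
  refine card_equiv (v.trans w.symm).finsetCongr fun S ↦ ?_
  simp only [mem_filter_univ, Equiv.finsetCongr_apply, card_map, mem_map, forall_exists_index,
    and_imp, forall_apply_eq_imp_iff₂]
  exact and_congr_right fun _ ↦ forall₂_congr fun x _ ↦ by rw [← map_erase, h]

set_option maxHeartbeats 1000000 in
theorem numArcs_values : numArcs codeU25 = 0 ∧ numArcs codePUU = 9 ∧ numArcs codeO7 = 10 ∧
    numArcs codeP7 = 15 ∧ numArcs codeNonFano = 11 ∧ numArcs codeFano = 7 ∧
    numArcs codePUK = 81 ∧ numArcs codeK5e = 84 ∧ numArcs codeK33 = 90 ∧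
    numArcs codePKK = 266 := by
  refine ⟨?_, ?_, ?_, ?_, ?_, ?_, ?_, ?_, ?_, ?_⟩ <;> decide +kernel

theorem pairwise_numArcs_ne : tenCodes.Pairwise fun c d ↦ numArcs c.2 ≠ numArcs d.2 := by
  simp [tenCodes, numArcs_values]

theorem pairwise_not_isIso : tenMatroids.Pairwise fun N N' ↦ ¬ IsIso N.2 N'.2 := by
  have h := forall₂_hasCode
  rw [List.forall₂_iff_get] at h
  obtain ⟨hlen, h⟩ := h
  rw [List.pairwise_iff_get]
  intro i j hij hiso
  obtain ⟨hi, hic⟩ := h i i.2 (i.2.trans_eq hlen)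
  obtain ⟨hj, hjc⟩ := h j j.2 (j.2.trans_eq hlen)
  exact List.pairwise_iff_get.1 pairwise_numArcs_ne ⟨i, i.2.trans_eq hlen⟩ ⟨j, j.2.trans_eq hlen⟩
    hij (hic.numArcs_eq (hjc.of_isIso hiso))

theorem isCritical_iff {α : Type*} {M : Matroid α} [M.Finite] :
    IsCritical M ↔ ∃ N ∈ tenMatroids, IsIso M N.2 := by
  classical
  have := M.ground_finite.fintype
  have h := List.forall₂_iff_get.1 forall₂_hasCode
  obtain ⟨hlen, h⟩ := h
  rw [isCritical_iff_isCrit]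
  constructor
  · intro hM
    obtain ⟨c, hc, hMc⟩ := hM.exists_hasCode
    obtain ⟨i, rfl⟩ := List.mem_iff_get.1 hc
    obtain ⟨hi, hic⟩ := h i (i.2.trans_eq hlen.symm) i.2
    exact ⟨_, List.get_mem _ ⟨i, i.2.trans_eq hlen.symm⟩, hMc.isIso hic⟩
  · rintro ⟨N, hN, hMN⟩
    obtain ⟨i, rfl⟩ := List.mem_iff_get.1 hN
    obtain ⟨hi, hic⟩ := h i i.2 (i.2.trans_eq hlen)
    obtain ⟨k, hk⟩ := isCritCode_of_mem_tenCodes _ (List.get_mem _ ⟨i, i.2.trans_eq hlen⟩)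
    exact isCrit_of_hasCode hk isRank_rkOn (hic.of_isIso hMN)

end MatroidCover


theorem theorem1p3 :
    MatroidCover.tenMatroids.length = 10 ∧
    MatroidCover.tenMatroids.Pairwise (fun N N' ↦ ¬ MatroidCover.IsIso N.2 N'.2) ∧
    ∀ (α : Type u) (M : Matroid α), M.Finite →
      (MatroidCover.IsMinimalSimpleObstruction 2 M ↔
        ∃ N ∈ MatroidCover.tenMatroids, MatroidCover.IsIso M N.2) ∧
      (MatroidCover.StrictlyDensityCritical 2 M ↔
        ∃ N ∈ MatroidCover.tenMatroids, MatroidCover.IsIso M N.2) :=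
  ⟨rfl, MatroidCover.pairwise_not_isIso, fun _ _ _ ↦
    ⟨MatroidCover.isMinimalSimpleObstruction_iff_isCritical.trans MatroidCover.isCritical_iff,
      MatroidCover.strictlyDensityCritical_iff_isCritical.trans MatroidCover.isCritical_iff⟩⟩
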